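/- Let $M$ be an arbitrary (possibly ill-founded) model of $ZFC^-$ ($ZFC$ without the power set axiom) $+\;V=L\;+$ ``there is a largest cardinal $\kappa$, and $\kappa$ is weakly compact'' (strongly inaccessible, and every $\kappa$-tree has a branch). All notions below, including $\omega$, $\mathbf Z$, ``finite'', the hierarchy $L_\xi$ and ``$L_\xi$ is a model of $ZFC^-$'', are interpreted in $M$. Let $A_0\subseteq L_\kappa$ and let $\langle A_n\rangle,\langle B_n\rangle,\langle \xi_n\rangle$ $(n\in\omega)$ be sequences in $M$ such that: - $B_0=\kappa$, and $\xi_0$ is the least ordinal $\xi>\kappa$ with $A_0\in L_{\xi}$ and $L_{\xi}\models ZFC^-$; - $A_{n+1}=(\{0\}\times A_n)\cup(\{1\}\times B_n)$; - $B_{n+1}\subseteq B_n$ has cardinality $\kappa$, and every function $F:\kappa\to\gamma$ with $F\in L_{\xi_n}$ and $0<\gamma<\kappa$ is constant on a tail of $B_{n+1}$; - $\xi_{n+1}$ is the least ordinal $\xi>\xi_n$ with $A_{n+1}\in L_{\xi}$ and $L_{\xi}\models ZFC^-$. Put $L_{\xi_\infty}=\bigcup_n L_{\xi_n}$, and let $A\in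 L_{\xi_\infty}$ be the underlying set of the first-order structure $\mathcal A$ under consideration. Let $X$ be the set of all functions $\mathbf Z\to\kappa$. A finite set $s\subseteq\mathbf Z$ is a support for a function $f$ on $X$ if $f(x)$ depends only on $x\restriction s$. Let $\mathcal F$ be the set of all $f:X\to A$ in $L_{\xi_\infty}$ that have a finite support. A set $U\subseteq X$ is measurable if its characteristic function $X\to\{0,1\}$ lies in $L_{\xi_\infty}$ and has a finite support. For $s=\{s_1<\dots<s_n\}\subseteq \mathbf Z$ finite, $m\in\omega$ and $G:\kappa\to\kappa$ in $L_{\xi_\infty}$, let $A_{s,m,G}$ be the set of $x\in X$ with $x(s_1)<\dots<x(s_n)$, all $x(s_i)\in B_m$, $G(0)<x(s_1)$, and $G(x(s_{i-1}))<x(s_i)$ for $1<i\le n$. A measurable set has measure $1$ if it contains some $A_{s,m,G}$. For $f,g\in\mathcal F$ put $f\sim g$ iff $\{x\in X: f(x)=g(x)\}$ has measure $1$; the underlying set $A^\star$ of the ``ultrapower'' $\mathcal A^\star$ is the set of all classes $[f]$, $f\in\mathcal F$. A finite $s\subseteq \mathbf Z$ is a support for $x\in A^\star$ if it is a support for some $f\in\mathcal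 F$ with $x=[f]$. A block is a set of the form $[a,b]=\{i\in\mathbf Z: a\le i\le b\}$ with $a\le b$ in $\mathbf Z$, or the empty set; a block support for $x$ is a support for $x$ that is a block. **Lemma.** Every $x\in A^\star$ has a minimum block support: there is a block support $s_0$ for $x$ that is contained in every block support for $x$. -/

import Mathlib

universe u

namespace IntUltrapower

open FirstOrder FirstOrder.Language

/-! ## The language of set theory and the theory `ZFC-` -/

/-- The relation symbols of the language of set theory: one binary symbol. -/
inductive SetRel : ℕ → Type
  | mem : SetRel 2

/-- The first-order language of set theory (equality is logical). -/
def setLang : FirstOrder.Language.{0, 0} := ⟨fun _ => Empty, SetRel⟩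

/-- The axioms of `ZFC` without the power set axiom, for a structure `⟨N, mem⟩`. The arguments `D₁`
and `D₂` are the families of classes and of binary relations on `N` that are definable with
parameters over `⟨N, mem⟩`; they serve to express the two axiom schemes. -/
structure ZFCMinus {N : Type u} (mem : N → N → Prop) (D₁ : Set (Set N)) (D₂ : Set (Set (N × N))) :
    Prop where
  extensionality : ∀ x y, (∀ z, mem z x ↔ mem z y) → x = y
  foundation : ∀ x, (∃ y, mem y x) → ∃ y, mem y x ∧ ∀ z, mem z y → ¬ mem z x
  pairing : ∀ x y, ∃ p, ∀ z, mem z p ↔ z = x ∨ z = y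
  union : ∀ x, ∃ v, ∀ z, mem z v ↔ ∃ y, mem y x ∧ mem z y
  infinity : ∃ w, (∃ e, mem e w ∧ ∀ z, ¬ mem z e) ∧
    ∀ x, mem x w → ∃ y, mem y w ∧ ∀ z, mem z y ↔ mem z x ∨ z = x
  separation : ∀ P ∈ D₁, ∀ a, ∃ b, ∀ x, mem x b ↔ mem x a ∧ x ∈ P
  replacement : ∀ R ∈ D₂, ∀ a, (∀ x, mem x a → ∃! y, (x, y) ∈ R) →
    ∃ b, ∀ y, mem y b ↔ ∃ x, mem x a ∧ (x, y) ∈ R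
  choice : ∀ a, (∀ x, mem x a → ∃ y, mem y x) →
    (∀ x y, mem x a → mem y a → x ≠ y → ¬ ∃ z, mem z x ∧ mem z y) →
    ∃ c, ∀ x, mem x a → ∃! z, mem z c ∧ mem z x

section Internal

variable {M : Type u} [setLang.Structure M]

/-- The membership relation of the structure `M`. -/
def Eps (x y : M) : Prop := Structure.RelMap (L := setLang) SetRel.mem ![x, y]

infix:50 " ∈ₘ " => Eps

variable (M) in
/-- `M` is a model of `ZFC-`. -/
def IsModelZFCMinus : Prop :=
  ZFCMinus (N := M) Eps {P | (Set.univ : Set M).Definable₁ setLang P}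
    {R | (Set.univ : Set M).Definable₂ setLang R}

/-! ## Elementary set theory inside `M`

Everything below is the interpretation in `M` of the usual set-theoretic notion. -/

/-- The class of elements of the set `a` of `M`. -/
def els (a : M) : Set M := {x | x ∈ₘ a}

def Sub (a b : M) : Prop := ∀ z, z ∈ₘ a → z ∈ₘ b

def IsEmptySet (e : M) : Prop := ∀ z, ¬ z ∈ₘ e

/-- `p = {a, b}`. -/
def IsUPair (p a b : M) : Prop := ∀ z, z ∈ₘ p ↔ z = a ∨ z = b

/-- `p` is the (Kuratowski) ordered pair `⟨a, b⟩`. -/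
def IsOPair (p a b : M) : Prop := ∃ v w, IsUPair v a a ∧ IsUPair w a b ∧ IsUPair p v w

/-- `y = x ∪ {x}`. -/
def IsSucc (y x : M) : Prop := ∀ z, z ∈ₘ y ↔ z ∈ₘ x ∨ z = x

/-- `o` is the ordinal `1`. -/
def IsOne (o : M) : Prop := ∃ e, IsEmptySet e ∧ IsSucc o e

/-- `t` is the ordinal `2 = {0, 1}`. -/
def IsTwo (t : M) : Prop := ∃ o, IsOne o ∧ IsSucc t o

def IsTransSet (a : M) : Prop := ∀ x, x ∈ₘ a → Sub x a

/-- `a` is a (von Neumann) ordinal. -/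
def IsOrd (a : M) : Prop := IsTransSet a ∧ ∀ x, x ∈ₘ a → IsTransSet x

/-- `n` is a natural number of `M`, i.e. an element of the `ω` of `M`. -/
def IsNat (n : M) : Prop :=
  IsOrd n ∧ ∀ m, m = n ∨ m ∈ₘ n → IsEmptySet m ∨ ∃ k, IsSucc m k

/-- `⟨x, y⟩ ∈ f`; for a function `f` this says `f(x) = y`. -/
def App (f x y : M) : Prop := ∃ p, IsOPair p x y ∧ p ∈ₘ f

/-- The set `f` of `M` is a function with domain `d` and values in `c`. -/
def IsFun (f : M) (d c : Set M) : Prop :=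
  (∀ p, p ∈ₘ f → ∃ x ∈ d, ∃ y ∈ c, IsOPair p x y) ∧ ∀ x ∈ d, ∃! y, App f x y

/-- `f` is an injection (in `M`) from `a` to `b`. -/
def IsInjection (f a b : M) : Prop :=
  IsFun f (els a) (els b) ∧ ∀ x y v, App f x v → App f y v → x = y

/-- `f` is a bijection (in `M`) from `a` onto `b`. -/
def IsBijection (f a b : M) : Prop :=
  IsInjection f a b ∧ ∀ v, v ∈ₘ b → ∃ x, App f x v

/-- `s` is finite in the sense of `M`. -/
def IsFin (s : M) : Prop := ∃ n f, IsNat n ∧ IsBijection f n s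

/-- `k` is a cardinal, i.e. an initial ordinal. -/
def IsCardinal (k : M) : Prop := IsOrd k ∧ ∀ a, a ∈ₘ k → ¬ ∃ f, IsBijection f a k

/-- `a` has cardinality less than the cardinal `k`. -/
def CardLT (a k : M) : Prop := ∃ m f, m ∈ₘ k ∧ IsInjection f a m

/-! ## Weak compactness inside `M` -/

/-- `k` is strongly inaccessible: an uncountable regular cardinal such that every `a < k` has a
power set, of cardinality less than `k`. -/
structure IsInaccessible (k : M) : Prop where
  cardinal : IsCardinal k
  uncountable : ∃ w, w ∈ₘ k ∧ ∀ n, n ∈ₘ w ↔ IsNat n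
  regular : ∀ a f, a ∈ₘ k → IsFun f (els a) (els k) →
    ∃ b, b ∈ₘ k ∧ ∀ x y, App f x y → y ∈ₘ b
  strongLimit : ∀ a, a ∈ₘ k → ∃ P, (∀ z, z ∈ₘ P ↔ Sub z a) ∧ CardLT P k

/-- `⟨T, R⟩` is a tree: `R` is a transitive relation on `T` that well-orders
`seg(a) = {y ∈ T | y R a}` for every `a ∈ T`. -/
structure IsTree (T R : M) : Prop where
  rel : ∀ p, p ∈ₘ R → ∃ x y, x ∈ₘ T ∧ y ∈ₘ T ∧ IsOPair p x y
  trans : ∀ x y z, App R x y → App R y z → App R x z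
  irrefl : ∀ a x, App R x a → ¬ App R x x
  total : ∀ a x y, App R x a → App R y a → App R x y ∨ x = y ∨ App R y x
  wf : ∀ a c, (∀ x, x ∈ₘ c → App R x a) → (∃ x, x ∈ₘ c) →
    ∃ x, x ∈ₘ c ∧ ∀ y, y ∈ₘ c → ¬ App R y x

/-- The rank of the node `t`, i.e. the order type of `seg(t)`, is the ordinal `a`. -/
def HasRank (R t a : M) : Prop :=
  IsOrd a ∧ ∃ g, IsFun g {y | App R y t} (els a) ∧ (∀ v, v ∈ₘ a → ∃ y, App g y v) ∧
    ∀ y z v w, App g y v → App g z w → (App R y z ↔ v ∈ₘ w)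

/-- `⟨T, R⟩` is a `k`-tree. -/
structure IsKTree (k T R : M) : Prop where
  tree : IsTree T R
  rank_lt : ∀ t, t ∈ₘ T → ∃ a, a ∈ₘ k ∧ HasRank R t a
  level : ∀ a, a ∈ₘ k → ∃ V, (∀ t, t ∈ₘ V ↔ t ∈ₘ T ∧ HasRank R t a) ∧ (∃ t, t ∈ₘ V) ∧ CardLT V k

/-- `b` is a branch through the `k`-tree `⟨T, R⟩`. -/
structure IsBranch (k T R b : M) : Prop where
  sub : Sub b T
  meets : ∀ a, a ∈ₘ k → ∃! t, t ∈ₘ b ∧ HasRank R t a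
  down : ∀ x y, x ∈ₘ b → App R y x → y ∈ₘ b

/-- `k` is weakly compact: strongly inaccessible, and every `k`-tree has a branch. -/
def IsWeaklyCompact (k : M) : Prop :=
  IsInaccessible k ∧ ∀ T R, IsKTree k T R → ∃ b, IsBranch k T R b

/-- `k` is the largest cardinal. -/
def IsLargestCardinal (k : M) : Prop :=
  IsCardinal k ∧ ∀ m, IsCardinal m → m ∈ₘ k ∨ m = k

/-! ## The constructible hierarchy inside `M` -/

/-- `s ∈ N ^ n`: `s` is an `n`-tuple (function with domain `n`) from the set `N`. -/
def IsTuple (N n s : M) : Prop := IsFun s (els n) (els N)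

/-- `F` is a set of pairs `⟨n, R⟩` that contains the basic relations `{s ∈ N ^ n | s i ∈ s j}` and
`{s ∈ N ^ n | s i = s j}` and is closed under complements, intersections and projections. -/
structure IsDefFamily (N F : M) : Prop where
  mem : ∀ n i j R, IsNat n → i ∈ₘ n → j ∈ₘ n →
    (∀ s, s ∈ₘ R ↔ IsTuple N n s ∧ ∃ a b, App s i a ∧ App s j b ∧ a ∈ₘ b) → App F n R
  eq : ∀ n i j R, IsNat n → i ∈ₘ n → j ∈ₘ n →
    (∀ s, s ∈ₘ R ↔ IsTuple N n s ∧ ∃ a, App s i a ∧ App s j a) → App F n R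
  compl : ∀ n R R', IsNat n → App F n R →
    (∀ s, s ∈ₘ R' ↔ IsTuple N n s ∧ ¬ s ∈ₘ R) → App F n R'
  inter : ∀ n R₁ R₂ R', IsNat n → App F n R₁ → App F n R₂ →
    (∀ s, s ∈ₘ R' ↔ s ∈ₘ R₁ ∧ s ∈ₘ R₂) → App F n R'
  proj : ∀ n n' R R', IsNat n → IsSucc n' n → App F n' R →
    (∀ s, s ∈ₘ R' ↔ IsTuple N n s ∧ ∃ t, t ∈ₘ R ∧ Sub s t) → App F n R'

/-- `R` is an `n`-ary relation on `N` that is first-order definable (without parameters) over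
`⟨N, ∈⟩`, in the sense of `M`: it belongs to the least family as above. (If `M` is not an
`ω`-model, this includes formulas of nonstandard length.) -/
def IsDefRel (N n R : M) : Prop := ∀ F, IsDefFamily N F → App F n R

/-- The subsets of `N` definable with parameters over `⟨N, ∈⟩`, in the sense of `M`: the classes
`{x | s ⌢ ⟨x⟩ ∈ R}` with `s ∈ N ^ n` and `R` an `(n+1)`-ary definable relation. -/
def DefSets (N : M) : Set (Set M) :=
  {P | ∃ n n' s R, IsNat n ∧ IsSucc n' n ∧ IsTuple N n s ∧ IsDefRel N n' R ∧
    ∀ x, x ∈ P ↔ ∃ t, t ∈ₘ R ∧ Sub s t ∧ App t n x}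

/-- The binary relations on `N` definable with parameters over `⟨N, ∈⟩`, in the sense of `M`. -/
def DefRels (N : M) : Set (Set (M × M)) :=
  {P | ∃ n n' n'' s R, IsNat n ∧ IsSucc n' n ∧ IsSucc n'' n' ∧ IsTuple N n s ∧ IsDefRel N n'' R ∧
    ∀ x y, (x, y) ∈ P ↔ ∃ t, t ∈ₘ R ∧ Sub s t ∧ App t n x ∧ App t n' y}

/-- `N = L_a`, where `a` is an ordinal of `M` and the constructible hierarchy is computed in `M`:
there is a function `f` on `a + 1` with `f(b) = ⋃_{c < b} Def(f(c))` for `b ≤ a`, and `f(a) = N`. -/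
def IsL (a N : M) : Prop :=
  IsOrd a ∧ ∃ f a', IsSucc a' a ∧ IsFun f (els a') Set.univ ∧
    (∀ b v, App f b v →
      ∀ z, z ∈ₘ v ↔ ∃ c w, c ∈ₘ b ∧ App f c w ∧ els z ∈ DefSets w) ∧
    App f a N

variable (M) in
/-- `M` satisfies `V = L`. -/
def VEqL : Prop := ∀ x : M, ∃ a N, IsL a N ∧ x ∈ₘ N

/-- `M` thinks that `⟨N, ∈⟩` is a model of `ZFC-`. -/
def InnerZFCMinus (N : M) : Prop :=
  ZFCMinus (N := {x : M // x ∈ₘ N}) (fun x y => x.1 ∈ₘ y.1)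
    {P | Subtype.val '' P ∈ DefSets N}
    {R | Prod.map Subtype.val Subtype.val '' R ∈ DefRels N}

/-! ## The construction of length `ω` -/

/-- `x` is the least ordinal above `b` such that `A ∈ L_x` and `L_x` is a model of `ZFC-`. -/
def IsNextXi (b A x : M) : Prop :=
  IsOrd x ∧ b ∈ₘ x ∧ (∃ N, IsL x N ∧ A ∈ₘ N ∧ InnerZFCMinus N) ∧
    ∀ y, IsOrd y → b ∈ₘ y → (∃ N, IsL y N ∧ A ∈ₘ N ∧ InnerZFCMinus N) → x = y ∨ x ∈ₘ y

/-- `B'` is a subset of `B` of cardinality `k`, and every `F : k → c` in `L_x`, where `0 < c < k`,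
is constant on a tail of `B'`. -/
def IsThinning (k x B B' : M) : Prop :=
  Sub B' B ∧ (∃ f, IsBijection f B' k) ∧
    ∀ N F c, IsL x N → F ∈ₘ N → c ∈ₘ k → ¬ IsEmptySet c → IsFun F (els k) (els c) →
      ∃ h v, h ∈ₘ k ∧ v ∈ₘ c ∧ ∀ a, a ∈ₘ B' → h = a ∨ h ∈ₘ a → App F a v

/-- `C = ({0} × A) ∪ ({1} × B)`. -/
def IsCoded (C A B : M) : Prop :=
  ∀ p, p ∈ₘ C ↔ (∃ e a, IsEmptySet e ∧ a ∈ₘ A ∧ IsOPair p e a) ∨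
    ∃ o b, IsOne o ∧ b ∈ₘ B ∧ IsOPair p o b

/-- The sequences `sA = ⟨A_n⟩`, `sB = ⟨B_n⟩`, `sX = ⟨ξ_n⟩` (sets of `M`, indexed by the `ω` of `M`)
are produced by the length `ω` construction from the input `A₀ ⊆ L_k`. At each successor step an
arbitrary admissible set `B_{n+1}` is allowed. -/
structure IsOmegaConstruction (k A₀ sA sB sX : M) : Prop where
  input : ∃ N, IsL k N ∧ Sub A₀ N
  seqA : IsFun sA {n | IsNat n} Set.univ
  seqB : IsFun sB {n | IsNat n} Set.univ
  seqX : IsFun sX {n | IsNat n} Set.univ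
  zeroA : ∀ e, IsEmptySet e → App sA e A₀
  zeroB : ∀ e, IsEmptySet e → App sB e k
  zeroX : ∀ e x, IsEmptySet e → App sX e x → IsNextXi k A₀ x
  succA : ∀ n n' A B A', IsNat n → IsSucc n' n → App sA n A → App sB n B → App sA n' A' →
    IsCoded A' A B
  succB : ∀ n n' x B B', IsNat n → IsSucc n' n → App sX n x → App sB n B → App sB n' B' →
    IsThinning k x B B'
  succX : ∀ n n' x A' x', IsNat n → IsSucc n' n → App sX n x → App sA n' A' → App sX n' x' →
    IsNextXi x A' x'

/-- `y ∈ L_{ξ_∞}`, where `ξ_∞ = sup ξ_n`; that is, `y ∈ L_{ξ_n}` for some `n`. -/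
def InLInf (sX y : M) : Prop := ∃ n x N, IsNat n ∧ App sX n x ∧ IsL x N ∧ y ∈ₘ N

/-! ## The integers of `M` -/

/-- `z` represents the integer `n`. -/
def IsIntNonneg (z n : M) : Prop := IsNat n ∧ ∃ e, IsEmptySet e ∧ IsOPair z e n

/-- `z` represents the integer `-n - 1`. -/
def IsIntNeg (z n : M) : Prop := IsNat n ∧ ∃ o, IsOne o ∧ IsOPair z o n

/-- `z` is an integer of `M`. -/
def IsInt (z : M) : Prop := ∃ n, IsIntNonneg z n ∨ IsIntNeg z n

/-- The order of the integers of `M`. -/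
def IntLT (z w : M) : Prop :=
  ∃ n m, (IsIntNonneg z n ∧ IsIntNonneg w m ∧ n ∈ₘ m) ∨ (IsIntNeg z n ∧ IsIntNonneg w m) ∨
    (IsIntNeg z n ∧ IsIntNeg w m ∧ m ∈ₘ n)

def IntLE (z w : M) : Prop := z = w ∨ IntLT z w

/-! ## The ultrapower

From here on `k` is the cardinal, `sB` and `sX` are the sequences `⟨B_n⟩` and `⟨ξ_n⟩` and `A` is the
underlying set of the structure whose ultrapower is formed. -/

/-- The measure space `X`: all functions (of `M`) from the integers to `k`. -/
def SpaceX (k : M) : Set M := {x | IsFun x {z | IsInt z} (els k)}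

/-- `s` is a support for the function `f` on `X`: a finite set of integers such that `f(x)` depends
only on the restriction of `x` to `s`. -/
def IsFunSupport (k f s : M) : Prop :=
  IsFin s ∧ (∀ i, i ∈ₘ s → IsInt i) ∧
    ∀ x ∈ SpaceX k, ∀ y ∈ SpaceX k, (∀ i, i ∈ₘ s → ∀ v, App x i v ↔ App y i v) →
      ∀ v, App f x v ↔ App f y v

/-- The class `ℱ` of functions from `X` to `A` that lie in `L_{ξ_∞}` and have a finite support. -/
def FunClass (k sX A : M) : Set M :=
  {f | InLInf sX f ∧ IsFun f (SpaceX k) (els A) ∧ ∃ s, IsFunSupport k f s}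

/-- The basic set `A_{s,m,G}`: those `x ∈ X` that are strictly increasing on `s`, take values in
`B_m` on `s`, and for which `x(s_1), …, x(s_n)` is `G` spread apart, where `s_1 < … < s_n` are
the elements of `s`. -/
def BasicSet (k sB s m G : M) : Set M :=
  {x | x ∈ SpaceX k ∧
    (∀ i j v w, i ∈ₘ s → j ∈ₘ s → IntLT i j → App x i v → App x j w → v ∈ₘ w) ∧
    (∀ i v B, i ∈ₘ s → App x i v → App sB m B → v ∈ₘ B) ∧
    (∀ i v e g, i ∈ₘ s → (∀ j, j ∈ₘ s → ¬ IntLT j i) → App x i v → IsEmptySet e → App G e g →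
      g ∈ₘ v) ∧
    ∀ i j v w g, i ∈ₘ s → j ∈ₘ s → IntLT i j → (∀ l, l ∈ₘ s → ¬ (IntLT i l ∧ IntLT l j)) →
      App x i v → App x j w → App G v g → g ∈ₘ w}

/-- A subset of `X` is measurable if its characteristic function lies in the analogue of `ℱ` with
`{0, 1}` in place of `A`. -/
def IsMeasurable (k sX : M) (U : Set M) : Prop :=
  ∃ c t o, IsTwo t ∧ IsOne o ∧ c ∈ FunClass k sX t ∧ ∀ x ∈ SpaceX k, x ∈ U ↔ App c x o

/-- The measurable set `U ⊆ X` has measure one: it contains some `A_{s,m,G}`, where `s` is a finite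
set of integers, `m ∈ ω` and `G : k → k` lies in `L_{ξ_∞}`. -/
def HasMeasureOne (k sB sX : M) (U : Set M) : Prop :=
  U ⊆ SpaceX k ∧ IsMeasurable k sX U ∧
    ∃ s m G, IsFin s ∧ (∀ i, i ∈ₘ s → IsInt i) ∧ IsNat m ∧
      IsFun G (els k) (els k) ∧ InLInf sX G ∧ BasicSet k sB s m G ⊆ U

/-- `f` and `g` agree on a set of measure one. -/
def Equivalent (k sB sX f g : M) : Prop :=
  HasMeasureOne k sB sX {x | x ∈ SpaceX k ∧ ∀ v, App f x v ↔ App g x v}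

/-- The equivalence class `[f]`. -/
def eqClass (k sB sX A f : M) : Set M := {g | g ∈ FunClass k sX A ∧ Equivalent k sB sX f g}

/-- The (underlying set of the) ultrapower: all equivalence classes of functions in `ℱ`. -/
def Ultrapower (k sB sX A : M) : Set (Set M) :=
  {x | ∃ f ∈ FunClass k sX A, x = eqClass k sB sX A f}

/-- `s` is a support for the element `x` of the ultrapower: it is a support for some `f ∈ ℱ` with
`x = [f]`. -/
def IsSupport (k sB sX A : M) (x : Set M) (s : M) : Prop :=
  ∃ f ∈ FunClass k sX A, x = eqClass k sB sX A f ∧ IsFunSupport k f s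

/-- `s` is a block: empty, or an interval `[a, b]` of integers with `a ≤ b`. -/
def IsBlock (s : M) : Prop :=
  IsEmptySet s ∨ ∃ a b, IsInt a ∧ IsInt b ∧ IntLE a b ∧
    ∀ i, i ∈ₘ s ↔ IsInt i ∧ IntLE a i ∧ IntLE i b

/-- `s` is a block support for `x`. -/
def IsBlockSupport (k sB sX A : M) (x : Set M) (s : M) : Prop :=
  IsBlock s ∧ IsSupport k sB sX A x s

end Internal

end IntUltrapower

/-! The block supports of a class are closed under intersection, and finitely many intersections
lead to the least one.

Let blocks `s` and `t` support `f` and `f'`, and let `f = f'` on a basic set, given by a finite `w ⊇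
s ∪ t`, some `B_m` and some `G`. If neither block contains the other, convexity lets one lie to the
left: say `s` lies below some `j₀ ∈ t \ s`, and `t` above some `i₀ ∈ s \ t`. For `x`, `y` in the
basic set that agree on `s ∩ t`, let `z` follow `x` up to a cut `e` and `y` beyond it. With `e ∈ s ∩
t`, the equality `x(e) = y(e)` keeps `z` in the basic set, and `z` agrees with `x` on `s` and with
`y` on `t`, so `f(x) = f(z) = f'(z) = f'(y) = f(y)`. If `s ∩ t` is empty, cut at the maximum of `s`
and continue both `x` and `y` by one `q` with very large values; then `f(x) = f'(q) = f(y)`. This is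
`depends_on_cap_of_lt`, made symmetric in `depends_on_cap`.

So on the basic set `f` depends only on the restriction to `s ∩ t`, and `exists_funSupport`
redefines it elsewhere to have support `s ∩ t`. The new function must lie in `L_{ξ_∞}`: it is
defined inside a level `L_{ξ_n}` containing `f`, `B_m` and `G`. This uses that such a level really
satisfies `ZFC-` (`InnerZFCMinus.modelZFCMinus`) and that the notions involved are absolute.

Finally, in `exists_minimum_support`, start from one block support and intersect away each of its
points that some block support misses. The number of steps is finite only in the sense of `M`, so
the induction takes place in `M` (`fin_induction`) and applies only to definable properties; hence
the calculus of definability. -/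

namespace IntUltrapower

open FirstOrder FirstOrder.Language

/-! ### Definability with parameters, as a calculus of instances. -/

section Definability

variable {M : Type u} [setLang.Structure M]

/-- The `n`-ary predicate `P` on `M` is first-order definable with parameters. -/
class DP {n : ℕ} (P : (Fin n → M) → Prop) : Prop where
  out : (Set.univ : Set M).Definable setLang {v | P v}

/-- The `n`-ary function `t` on `M` has a graph that is first-order definable with parameters. -/
class Tm {n : ℕ} (t : (Fin n → M) → M) : Prop where
  out : (Set.univ : Set M).DefinableFun setLang t

variable {n : ℕ}

theorem DP.congr {P Q : (Fin n → M) → Prop} (h : DP P) (e : ∀ v, P v ↔ Q v) : DP Q := by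
  have : P = Q := funext fun v => propext (e v)
  exact this ▸ h

instance Tm.var (i : Fin n) : Tm (fun v : Fin n → M => v i) :=
  ⟨Set.DefinableFun.proj setLang⟩

instance (priority := 900) Tm.const (a : M) : Tm (fun _ : Fin n → M => a) :=
  ⟨setLang.definableFun_const _ (Set.mem_univ a)⟩

/-- Preimages of definable sets under definable maps are definable. Through the numbered variants
below, each notion is treated once for distinct variables and then for arbitrary definable terms. -/
theorem DP.subst {m : ℕ} {P : (Fin m → M) → Prop} (h : DP P) (F : Fin m → (Fin n → M) → M)
    (hF : ∀ i, Tm (F i)) : DP (fun v => P (fun i => F i v)) :=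
  ⟨Set.Definable.preimage_map (F := fun v i => F i v) (fun i => (hF i).out) h.out⟩

theorem DP.subst₁ {P : M → Prop} (h : DP fun v : Fin 1 → M => P (v 0))
    (a : (Fin n → M) → M) [ha : Tm a] : DP (fun v => P (a v)) :=
  h.subst ![a] (by simpa [Fin.forall_fin_succ] using ha)

theorem DP.subst₂ {P : M → M → Prop} (h : DP fun v : Fin 2 → M => P (v 0) (v 1))
    (a b : (Fin n → M) → M) [ha : Tm a] [hb : Tm b] : DP (fun v => P (a v) (b v)) :=
  h.subst ![a, b] (by simpa [Fin.forall_fin_succ] using ⟨ha, hb⟩)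

theorem DP.subst₃ {P : M → M → M → Prop} (h : DP fun v : Fin 3 → M => P (v 0) (v 1) (v 2))
    (a b c : (Fin n → M) → M) [ha : Tm a] [hb : Tm b] [hc : Tm c] :
    DP (fun v => P (a v) (b v) (c v)) :=
  h.subst ![a, b, c] (by simpa [Fin.forall_fin_succ] using ⟨ha, hb, hc⟩)

theorem DP.subst₄ {P : M → M → M → M → Prop}
    (h : DP fun v : Fin 4 → M => P (v 0) (v 1) (v 2) (v 3))
    (a b c d : (Fin n → M) → M) [ha : Tm a] [hb : Tm b] [hc : Tm c] [hd : Tm d] :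
    DP (fun v => P (a v) (b v) (c v) (d v)) :=
  h.subst ![a, b, c, d] (by simpa [Fin.forall_fin_succ] using ⟨ha, hb, hc, hd⟩)

theorem DP.subst₅ {P : M → M → M → M → M → Prop}
    (h : DP fun v : Fin 5 → M => P (v 0) (v 1) (v 2) (v 3) (v 4))
    (a b c d e : (Fin n → M) → M) [ha : Tm a] [hb : Tm b] [hc : Tm c] [hd : Tm d] [he : Tm e] :
    DP (fun v => P (a v) (b v) (c v) (d v) (e v)) :=
  h.subst ![a, b, c, d, e] (by simpa [Fin.forall_fin_succ] using ⟨ha, hb, hc, hd, he⟩)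

instance DP.and (P Q : (Fin n → M) → Prop) [hP : DP P] [hQ : DP Q] : DP (fun v => P v ∧ Q v) :=
  ⟨hP.out.inter hQ.out⟩

instance DP.or (P Q : (Fin n → M) → Prop) [hP : DP P] [hQ : DP Q] : DP (fun v => P v ∨ Q v) :=
  ⟨hP.out.union hQ.out⟩

instance DP.not (P : (Fin n → M) → Prop) [hP : DP P] : DP (fun v => ¬ P v) :=
  ⟨hP.out.compl⟩

instance DP.imp (P Q : (Fin n → M) → Prop) [hP : DP P] [hQ : DP Q] : DP (fun v => P v → Q v) :=
  DP.congr (P := fun v => ¬ P v ∨ Q v) inferInstance fun _ => imp_iff_not_or.symm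

instance DP.iff (P Q : (Fin n → M) → Prop) [hP : DP P] [hQ : DP Q] : DP (fun v => P v ↔ Q v) :=
  DP.congr (P := fun v => (P v → Q v) ∧ (Q v → P v)) inferInstance fun _ => iff_iff_implies_and_implies.symm

/-- A quantifier is a projection along the last coordinate. -/
instance DP.ex (P : (Fin n → M) → M → Prop)
    [h : DP (fun w : Fin (n + 1) → M => P (fun i => w i.castSucc) (w (Fin.last n)))] :
    DP (fun v => ∃ x, P v x) := by
  refine ⟨?_⟩
  convert! h.out.image_comp (Fin.castSucc : Fin n → Fin (n + 1)) using 1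
  ext v
  constructor
  · rintro ⟨x, hx⟩
    refine ⟨Fin.snoc v x, ?_, ?_⟩
    · simpa using hx
    · ext i; simp
  · rintro ⟨w, hw, rfl⟩
    exact ⟨_, hw⟩

instance DP.all (P : (Fin n → M) → M → Prop)
    [h : DP (fun w : Fin (n + 1) → M => P (fun i => w i.castSucc) (w (Fin.last n)))] :
    DP (fun v => ∀ x, P v x) :=
  DP.congr (P := fun v => ¬ ∃ x, ¬ P v x) inferInstance fun _ => by simp

instance DP.exUnique (P : (Fin n → M) → M → Prop)
    [h : DP (fun v => ∃ x, P v x ∧ ∀ y, P v y → y = x)] :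
    DP (fun v => ∃! x, P v x) := h

instance DP.eq (a b : (Fin n → M) → M) [ha : Tm a] [hb : Tm b] : DP (fun v => a v = b v) :=
  ⟨Set.DefinableFun.ofPred_eq ha.out hb.out⟩

instance DP.eps (a b : (Fin n → M) → M) [ha : Tm a] [hb : Tm b] : DP (fun v => a v ∈ₘ b v) := by
  refine DP.subst₂ (P := fun x y => x ∈ₘ y) ⟨?_⟩ a b
  refine Set.Definable.mono (Set.empty_definable_iff.2
    ⟨Relations.formula (L := setLang) SetRel.mem ![Term.var 0, Term.var 1], ?_⟩) (Set.empty_subset _)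
  ext v
  simp only [Set.mem_ofPred_eq, Eps]
  refine iff_of_eq (congrArg _ ?_)
  ext i
  fin_cases i <;> rfl

/-- A function is definable if its graph is. -/
theorem Tm.of_graph {t : (Fin n → M) → M}
    (h : DP (fun w : Fin (n + 1) → M => w (Fin.last n) = t (fun i => w i.castSucc))) : Tm t := by
  refine ⟨?_⟩
  have := h.out.preimage_comp (β := Option (Fin n))
    (fun i : Fin (n + 1) => Fin.lastCases (motive := fun _ => Option (Fin n)) none some i)
  unfold Set.DefinableFun
  convert! this using 1
  ext w
  simp [Function.tupleGraph, Function.comp_def, eq_comm]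

instance DP.emptySet (a : (Fin n → M) → M) [Tm a] : DP (fun v => IsEmptySet (a v)) :=
  DP.subst₁ (by unfold IsEmptySet; infer_instance) a

instance DP.upair (a b c : (Fin n → M) → M) [Tm a] [Tm b] [Tm c] :
    DP (fun v => IsUPair (a v) (b v) (c v)) :=
  DP.subst₃ (by unfold IsUPair; infer_instance) a b c

instance DP.opair (a b c : (Fin n → M) → M) [Tm a] [Tm b] [Tm c] :
    DP (fun v => IsOPair (a v) (b v) (c v)) :=
  DP.subst₃ (by unfold IsOPair; infer_instance) a b c

instance DP.sub (a b : (Fin n → M) → M) [Tm a] [Tm b] : DP (fun v => Sub (a v) (b v)) :=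
  DP.subst₂ (by unfold Sub; infer_instance) a b

instance DP.succ (a b : (Fin n → M) → M) [Tm a] [Tm b] : DP (fun v => IsSucc (a v) (b v)) :=
  DP.subst₂ (by unfold IsSucc; infer_instance) a b

instance DP.one (a : (Fin n → M) → M) [Tm a] : DP (fun v => IsOne (a v)) :=
  DP.subst₁ (by unfold IsOne; infer_instance) a

instance DP.two (a : (Fin n → M) → M) [Tm a] : DP (fun v => IsTwo (a v)) :=
  DP.subst₁ (by unfold IsTwo; infer_instance) a

instance DP.transSet (a : (Fin n → M) → M) [Tm a] : DP (fun v => IsTransSet (a v)) :=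
  DP.subst₁ (by unfold IsTransSet; infer_instance) a

instance DP.ord (a : (Fin n → M) → M) [Tm a] : DP (fun v => IsOrd (a v)) :=
  DP.subst₁ (by unfold IsOrd; infer_instance) a

instance DP.nat (a : (Fin n → M) → M) [Tm a] : DP (fun v => IsNat (a v)) :=
  DP.subst₁ (by unfold IsNat; infer_instance) a

instance DP.app (a b c : (Fin n → M) → M) [Tm a] [Tm b] [Tm c] :
    DP (fun v => App (a v) (b v) (c v)) :=
  DP.subst₃ (by unfold App; infer_instance) a b c

instance DP.injection (a b c : (Fin n → M) → M) [Tm a] [Tm b] [Tm c] :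
    DP (fun v => IsInjection (a v) (b v) (c v)) :=
  DP.subst₃ (by simp only [IsInjection, IsFun, els, Set.mem_ofPred_eq]; infer_instance) a b c

instance DP.bijection (a b c : (Fin n → M) → M) [Tm a] [Tm b] [Tm c] :
    DP (fun v => IsBijection (a v) (b v) (c v)) :=
  DP.subst₃ (by unfold IsBijection; infer_instance) a b c

instance DP.fin (a : (Fin n → M) → M) [Tm a] : DP (fun v => IsFin (a v)) :=
  DP.subst₁ (by unfold IsFin; infer_instance) a

instance DP.intNonneg (a b : (Fin n → M) → M) [Tm a] [Tm b] :
    DP (fun v => IsIntNonneg (a v) (b v)) :=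
  DP.subst₂ (by unfold IsIntNonneg; infer_instance) a b

instance DP.intNeg (a b : (Fin n → M) → M) [Tm a] [Tm b] : DP (fun v => IsIntNeg (a v) (b v)) :=
  DP.subst₂ (by unfold IsIntNeg; infer_instance) a b

instance DP.int (a : (Fin n → M) → M) [Tm a] : DP (fun v => IsInt (a v)) :=
  DP.subst₁ (by unfold IsInt; infer_instance) a

instance DP.intLT (a b : (Fin n → M) → M) [Tm a] [Tm b] : DP (fun v => IntLT (a v) (b v)) :=
  DP.subst₂ (by unfold IntLT; infer_instance) a b

instance DP.intLE (a b : (Fin n → M) → M) [Tm a] [Tm b] : DP (fun v => IntLE (a v) (b v)) :=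
  DP.subst₂ (by unfold IntLE; infer_instance) a b

instance DP.tuple (a b c : (Fin n → M) → M) [Tm a] [Tm b] [Tm c] :
    DP (fun v => IsTuple (a v) (b v) (c v)) :=
  DP.subst₃ (by simp only [IsTuple, IsFun, els, Set.mem_ofPred_eq]; infer_instance) a b c

/-- A plain conjunction is the form to which the definability instances apply. -/
theorem isDefFamily_iff (N F : M) : IsDefFamily N F ↔
    (∀ n i j R, IsNat n → i ∈ₘ n → j ∈ₘ n →
      (∀ s, s ∈ₘ R ↔ IsTuple N n s ∧ ∃ a b, App s i a ∧ App s j b ∧ a ∈ₘ b) → App F n R) ∧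
    (∀ n i j R, IsNat n → i ∈ₘ n → j ∈ₘ n →
      (∀ s, s ∈ₘ R ↔ IsTuple N n s ∧ ∃ a, App s i a ∧ App s j a) → App F n R) ∧
    (∀ n R R', IsNat n → App F n R →
      (∀ s, s ∈ₘ R' ↔ IsTuple N n s ∧ ¬ s ∈ₘ R) → App F n R') ∧
    (∀ n R₁ R₂ R', IsNat n → App F n R₁ → App F n R₂ →
      (∀ s, s ∈ₘ R' ↔ s ∈ₘ R₁ ∧ s ∈ₘ R₂) → App F n R') ∧
    (∀ n n' R R', IsNat n → IsSucc n' n → App F n' R →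
      (∀ s, s ∈ₘ R' ↔ IsTuple N n s ∧ ∃ t, t ∈ₘ R ∧ Sub s t) → App F n R') :=
  ⟨fun h => ⟨h.mem, h.eq, h.compl, h.inter, h.proj⟩,
    fun h => ⟨h.1, h.2.1, h.2.2.1, h.2.2.2.1, h.2.2.2.2⟩⟩

set_option synthInstance.maxHeartbeats 400000 in
set_option synthInstance.maxSize 4000 in
instance DP.defFamily (a b : (Fin n → M) → M) [Tm a] [Tm b] :
    DP (fun v => IsDefFamily (a v) (b v)) :=
  DP.subst₂ (by simp only [isDefFamily_iff]; infer_instance) a b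

instance DP.defRel (a b c : (Fin n → M) → M) [Tm a] [Tm b] [Tm c] :
    DP (fun v => IsDefRel (a v) (b v) (c v)) :=
  DP.subst₃ (by unfold IsDefRel; infer_instance) a b c

set_option synthInstance.maxHeartbeats 400000 in
set_option synthInstance.maxSize 4000 in
instance DP.isL (a b : (Fin n → M) → M) [Tm a] [Tm b] : DP (fun v => IsL (a v) (b v)) :=
  DP.subst₂ (by
    simp only [IsL, IsFun, els, DefSets, Set.mem_ofPred_eq, Set.mem_univ, true_and]
    infer_instance) a b

instance DP.inLInf (a b : (Fin n → M) → M) [Tm a] [Tm b] : DP (fun v => InLInf (a v) (b v)) :=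
  DP.subst₂ (by unfold InLInf; infer_instance) a b

instance DP.spaceX (a b : (Fin n → M) → M) [Tm a] [Tm b] : DP (fun v => b v ∈ SpaceX (a v)) :=
  DP.subst₂ (P := fun a b => b ∈ SpaceX a) (by
    simp only [SpaceX, IsFun, els, Set.mem_ofPred_eq]
    infer_instance) a b

instance DP.funSupport (a b c : (Fin n → M) → M) [Tm a] [Tm b] [Tm c] :
    DP (fun v => IsFunSupport (a v) (b v) (c v)) :=
  DP.subst₃ (by unfold IsFunSupport; infer_instance) a b c

set_option synthInstance.maxHeartbeats 400000 in
set_option synthInstance.maxSize 4000 in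
instance DP.funClass (a b c d : (Fin n → M) → M) [Tm a] [Tm b] [Tm c] [Tm d] :
    DP (fun v => d v ∈ FunClass (a v) (b v) (c v)) :=
  DP.subst₄ (P := fun a b c d => d ∈ FunClass a b c) (by
    simp only [FunClass, IsFun, els, Set.mem_ofPred_eq]
    infer_instance) a b c d

set_option synthInstance.maxHeartbeats 400000 in
set_option synthInstance.maxSize 4000 in
instance DP.basicSet (a b c d e f : (Fin n → M) → M) [ha : Tm a] [hb : Tm b] [hc : Tm c] [hd : Tm d]
    [he : Tm e] [hf : Tm f] :
    DP (fun v => f v ∈ BasicSet (a v) (b v) (c v) (d v) (e v)) := by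
  have : DP (fun v : Fin 6 → M => v 5 ∈ BasicSet (v 0) (v 1) (v 2) (v 3) (v 4)) := by
    simp only [BasicSet, Set.mem_ofPred_eq]
    infer_instance
  exact this.subst ![a, b, c, d, e, f]
    (by simpa [Fin.forall_fin_succ] using ⟨ha, hb, hc, hd, he, hf⟩)

set_option synthInstance.maxHeartbeats 400000 in
set_option synthInstance.maxSize 4000 in
instance DP.equivalent (a b c d e : (Fin n → M) → M) [Tm a] [Tm b] [Tm c] [Tm d] [Tm e] :
    DP (fun v => Equivalent (a v) (b v) (c v) (d v) (e v)) :=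
  DP.subst₅ (by
    simp only [Equivalent, HasMeasureOne, IsMeasurable, IsFun, els, Set.mem_ofPred_eq,
      Set.subset_def]
    infer_instance) a b c d e

theorem Tm.lift {n : ℕ} {a : (Fin n → M) → M} (ha : Tm a) :
    Tm (fun w : Fin (n + 1) → M => a fun i => w i.castSucc) :=
  ⟨Set.DefinableFun.comp (g := fun w i => w i.castSucc)
    (fun _ => Set.DefinableFun.proj setLang) ha.out⟩

theorem IsOrd.of_eps {a x : M} (ha : IsOrd a) (hx : x ∈ₘ a) : IsOrd x :=
  ⟨ha.2 x hx, fun y hy => ha.2 y (ha.1 x hx y hy)⟩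

theorem IsOrd.trans {a x y : M} (ha : IsOrd a) (hx : x ∈ₘ a) (hy : y ∈ₘ x) : y ∈ₘ a :=
  ha.1 x hx y hy

theorem IsNat.of_eps {n m : M} (hn : IsNat n) (hm : m ∈ₘ n) : IsNat m := by
  refine ⟨hn.1.of_eps hm, fun l hl => ?_⟩
  rcases hl with rfl | hl
  · exact hn.2 l (Or.inr hm)
  · exact hn.2 l (Or.inr (hn.1.trans hm hl))

theorem IntLT.isInt_right {z w : M} (h : IntLT z w) : IsInt w := by
  obtain ⟨n, m, ⟨_, h, _⟩ | ⟨_, h⟩ | ⟨_, h, _⟩⟩ := h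
  · exact ⟨m, Or.inl h⟩
  · exact ⟨m, Or.inl h⟩
  · exact ⟨m, Or.inr h⟩

end Definability

/-- The structure `M` is a model of `ZFC-`, as a class. -/
class ModelZFCMinus (M : Type u) [setLang.Structure M] : Prop where
  out : IsModelZFCMinus M

/-! ### Elementary set theory, ordinals and natural numbers of `M`. -/

section SetTheory

variable {M : Type u} [setLang.Structure M] [hM : ModelZFCMinus M]

theorem ext_eps {x y : M} (h : ∀ z, z ∈ₘ x ↔ z ∈ₘ y) : x = y := hM.out.extensionality x y h

theorem separation (P : M → Prop) [h : DP (fun v : Fin 1 → M => P (v 0))] (a : M) :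
    ∃ b, ∀ x, x ∈ₘ b ↔ x ∈ₘ a ∧ P x :=
  hM.out.separation {x | P x} h.out a

theorem replacement (R : M → M → Prop) [h : DP (fun v : Fin 2 → M => R (v 0) (v 1))] (a : M)
    (hR : ∀ x, x ∈ₘ a → ∀ y z, R x y → R x z → y = z) :
    ∃ b, ∀ y, y ∈ₘ b ↔ ∃ x, x ∈ₘ a ∧ R x y := by
  -- The axiom asks for a total function, so `a` is first cut down to the points that have a value.
  have : DP (fun v : Fin 1 → M => ∃ y, R (v 0) y) := by
    exact @DP.ex _ _ 1 (fun v y => R (v 0) y) h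
  obtain ⟨a', ha'⟩ := separation (fun x => ∃ y, R x y) a
  obtain ⟨b, hb⟩ := hM.out.replacement {p | R p.1 p.2} h.out a' (fun x hx => by
    obtain ⟨h1, y, hy⟩ := (ha' x).1 hx
    exact ⟨y, hy, fun z hz => hR x h1 z y hz hy⟩)
  refine ⟨b, fun y => (hb y).trans ⟨?_, ?_⟩⟩
  · rintro ⟨x, hx, h⟩
    exact ⟨x, ((ha' x).1 hx).1, h⟩
  · rintro ⟨x, hx, h⟩
    exact ⟨x, (ha' x).2 ⟨hx, y, h⟩, h⟩

variable (M) in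
theorem exists_emptySet : ∃ e : M, IsEmptySet e := by
  obtain ⟨w, ⟨e, _, he⟩, _⟩ := hM.out.infinity
  exact ⟨e, he⟩

variable (M) in
/-- The empty set of `M`. -/
noncomputable def zeroM : M := (exists_emptySet M).choose

theorem not_eps_zero (x : M) : ¬ x ∈ₘ zeroM M := (exists_emptySet M).choose_spec x

theorem isEmptySet_iff {e : M} : IsEmptySet e ↔ e = zeroM M := by
  constructor
  · intro h
    exact ext_eps fun z => iff_of_false (h z) (not_eps_zero z)
  · rintro rfl
    exact not_eps_zero

/-- The unordered pair `{a, b}` of `M`. -/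
noncomputable def upair (a b : M) : M := (hM.out.pairing a b).choose

@[simp] theorem eps_upair {a b z : M} : z ∈ₘ upair a b ↔ z = a ∨ z = b :=
  (hM.out.pairing a b).choose_spec z

theorem isUPair_iff {p a b : M} : IsUPair p a b ↔ p = upair a b := by
  constructor
  · intro h
    exact ext_eps fun z => by rw [h z, eps_upair]
  · rintro rfl
    exact fun z => eps_upair

/-- The ordered pair `⟨a, b⟩` of `M`. -/
noncomputable def opair (a b : M) : M := upair (upair a a) (upair a b)

theorem isOPair_iff {p a b : M} : IsOPair p a b ↔ p = opair a b := by
  simp [IsOPair, isUPair_iff, opair]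

theorem upair_self_inj {a b c : M} (h : upair a a = upair b c) : a = b ∧ a = c := by
  have hb : b ∈ₘ upair a a := by rw [h]; simp
  have hc : c ∈ₘ upair a a := by rw [h]; simp
  simp only [eps_upair, or_self] at hb hc
  exact ⟨hb.symm, hc.symm⟩

theorem upair_right_inj {a b c : M} (h : upair a b = upair a c) : b = c := by
  have hb : b ∈ₘ upair a c := by rw [← h]; simp
  have hc : c ∈ₘ upair a b := by rw [h]; simp
  simp only [eps_upair] at hb hc
  rcases hb with rfl | hb
  · rcases hc with hc | hc <;> exact hc.symm
  · exact hb

@[simp] theorem opair_inj {a b c d : M} : opair a b = opair c d ↔ a = c ∧ b = d := by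
  constructor
  · intro h
    have hac : a = c := by
      have : upair a a ∈ₘ opair c d := by rw [← h]; simp [opair]
      simp only [opair, eps_upair] at this
      rcases this with h | h
      · exact (upair_self_inj h).1
      · exact (upair_self_inj h).1
    subst hac
    exact ⟨rfl, upair_right_inj (upair_right_inj h)⟩
  · rintro ⟨rfl, rfl⟩
    rfl

theorem app_iff {f x y : M} : App f x y ↔ opair x y ∈ₘ f := by
  simp [App, isOPair_iff]

theorem exists_adjoin (a b : M) : ∃ c, ∀ z, z ∈ₘ c ↔ z ∈ₘ a ∨ z = b := by
  obtain ⟨c, hc⟩ := hM.out.union (upair a (upair b b))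
  refine ⟨c, fun z => (hc z).trans ?_⟩
  simp

/-- The set `a ∪ {b}`. -/
noncomputable def adjoin (a b : M) : M := (exists_adjoin a b).choose

@[simp] theorem eps_adjoin {a b z : M} : z ∈ₘ adjoin a b ↔ z ∈ₘ a ∨ z = b :=
  (exists_adjoin a b).choose_spec z

theorem exists_cup (a b : M) : ∃ c, ∀ z, z ∈ₘ c ↔ z ∈ₘ a ∨ z ∈ₘ b := by
  obtain ⟨c, hc⟩ := hM.out.union (upair a b)
  refine ⟨c, fun z => (hc z).trans ?_⟩
  simp

/-- The set `a ∪ b`. -/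
noncomputable def cup (a b : M) : M := (exists_cup a b).choose

@[simp] theorem eps_cup {a b z : M} : z ∈ₘ cup a b ↔ z ∈ₘ a ∨ z ∈ₘ b :=
  (exists_cup a b).choose_spec z

theorem exists_cap (a b : M) : ∃ c, ∀ z, z ∈ₘ c ↔ z ∈ₘ a ∧ z ∈ₘ b :=
  separation (fun z => z ∈ₘ b) a

/-- The set `a ∩ b`. -/
noncomputable def cap (a b : M) : M := (exists_cap a b).choose

@[simp] theorem eps_cap {a b z : M} : z ∈ₘ cap a b ↔ z ∈ₘ a ∧ z ∈ₘ b :=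
  (exists_cap a b).choose_spec z

/-- The successor `a ∪ {a}`. -/
noncomputable def succM (a : M) : M := adjoin a a

theorem isSucc_iff {b a : M} : IsSucc b a ↔ b = succM a := by
  constructor
  · intro h
    exact ext_eps fun z => by rw [h z, succM, eps_adjoin]
  · rintro rfl
    exact fun z => eps_adjoin

@[simp] theorem eps_succM {a z : M} : z ∈ₘ succM a ↔ z ∈ₘ a ∨ z = a := eps_adjoin

variable (M) in
/-- The ordinal `1` of `M`. -/
noncomputable def oneM : M := succM (zeroM M)

theorem isOne_iff {o : M} : IsOne o ↔ o = oneM M := by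
  simp [IsOne, isEmptySet_iff, isSucc_iff, oneM]

theorem isTwo_iff {o : M} : IsTwo o ↔ o = succM (oneM M) := by
  simp [IsTwo, isOne_iff, isSucc_iff]

theorem zero_ne_one : zeroM M ≠ oneM M := by
  intro h
  have : zeroM M ∈ₘ oneM M := by simp [oneM]
  rw [← h] at this
  exact not_eps_zero _ this

instance Tm.opair {n : ℕ} (a b : (Fin n → M) → M) [ha : Tm a] [hb : Tm b] :
    Tm (fun v => opair (a v) (b v)) := by
  have := ha.lift
  have := hb.lift
  exact Tm.of_graph (DP.congr (P := fun w : Fin (n + 1) → M => IsOPair (w (Fin.last n))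
    (a fun i => w i.castSucc) (b fun i => w i.castSucc)) inferInstance fun v => isOPair_iff)

instance Tm.adjoin {n : ℕ} (a b : (Fin n → M) → M) [ha : Tm a] [hb : Tm b] :
    Tm (fun v => adjoin (a v) (b v)) := by
  have := ha.lift
  have := hb.lift
  refine Tm.of_graph (DP.congr (P := fun w : Fin (n + 1) → M => ∀ z, z ∈ₘ w (Fin.last n) ↔
      z ∈ₘ (a fun i => w i.castSucc) ∨ z = (b fun i => w i.castSucc)) ?_ fun v => ?_)
  · exact (DP.subst₃ (P := fun x y z : M => ∀ u, u ∈ₘ x ↔ u ∈ₘ y ∨ u = z) inferInstance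
      (fun w : Fin (n + 1) → M => w (Fin.last n)) (fun w => a fun i => w i.castSucc)
      (fun w => b fun i => w i.castSucc))
  · constructor
    · intro h
      exact ext_eps fun z => by rw [h z, eps_adjoin]
    · intro h z
      rw [h, eps_adjoin]

/-! ### Ordinals -/

theorem eps_irrefl (x : M) : ¬ x ∈ₘ x := by
  intro h
  obtain ⟨y, hy, hy'⟩ := hM.out.foundation (upair x x) ⟨x, by simp⟩
  simp only [eps_upair, or_self] at hy hy'
  subst hy
  exact hy' y h rfl

/-- Foundation yields a minimal counterexample, provided the counterexamples below `a` form a set.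
As `M` may be ill-founded, this holds only for definable `P`. -/
theorem ord_induction (P : M → Prop) [DP (fun v : Fin 1 → M => P (v 0))]
    (h : ∀ a, IsOrd a → (∀ b, b ∈ₘ a → P b) → P a) (a : M) (ha : IsOrd a) : P a := by
  by_contra hP
  have key : ∀ b, IsOrd b → ¬ P b → ∃ c, c ∈ₘ b ∧ ¬ P c := fun b hb hPb => by
    by_contra! hc
    exact hPb (h b hb hc)
  obtain ⟨s, hs⟩ := separation (fun x => ¬ P x) a
  obtain ⟨c, hc, hPc⟩ := key a ha hP
  obtain ⟨y, hy, hmin⟩ := hM.out.foundation s ⟨c, (hs c).2 ⟨hc, hPc⟩⟩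
  obtain ⟨hya, hPy⟩ := (hs y).1 hy
  obtain ⟨z, hz, hPz⟩ := key y (ha.of_eps hya) hPy
  exact hmin z hz ((hs z).2 ⟨ha.trans hya hz, hPz⟩)

theorem ord_trichotomy {a b : M} (ha : IsOrd a) (hb : IsOrd b) : a ∈ₘ b ∨ a = b ∨ b ∈ₘ a := by
  -- Nested induction, on `a` for all `b` and then on `b`: if neither ordinal belongs to the other,
  -- they have the same elements.
  refine ord_induction (fun a => ∀ b, IsOrd b → a ∈ₘ b ∨ a = b ∨ b ∈ₘ a) ?_ a ha b hb
  clear hb ha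
  intro a ha iha b hb
  refine ord_induction (fun b => a ∈ₘ b ∨ a = b ∨ b ∈ₘ a) ?_ b hb
  intro b hb ihb
  by_cases h1 : a ∈ₘ b
  · exact Or.inl h1
  by_cases h2 : b ∈ₘ a
  · exact Or.inr (Or.inr h2)
  refine Or.inr (Or.inl (ext_eps fun z => ⟨fun hz => ?_, fun hz => ?_⟩))
  · rcases iha z hz b hb with h | rfl | h
    · exact h
    · exact absurd hz h2
    · exact absurd (ha.trans hz h) h2
  · rcases ihb z hz with h | rfl | h
    · exact absurd (hb.trans hz h) h1
    · exact absurd hz h1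
    · exact h

theorem IsOrd.succM {a : M} (ha : IsOrd a) : IsOrd (succM a) := by
  constructor
  · intro x hx y hy
    rw [eps_succM] at hx ⊢
    rcases hx with hx | rfl
    · exact Or.inl (ha.trans hx hy)
    · exact Or.inl hy
  · intro x hx
    rw [eps_succM] at hx
    rcases hx with hx | rfl
    · exact ha.2 x hx
    · exact ha.1

theorem isOrd_zero : IsOrd (zeroM M) :=
  ⟨fun x hx => absurd hx (not_eps_zero x), fun x hx => absurd hx (not_eps_zero x)⟩

/-! ### Natural numbers -/

theorem isNat_zero : IsNat (zeroM M) := by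
  refine ⟨isOrd_zero, fun m hm => Or.inl ?_⟩
  rcases hm with rfl | hm
  · exact not_eps_zero
  · exact absurd hm (not_eps_zero m)

theorem IsNat.succM {n : M} (hn : IsNat n) : IsNat (succM n) := by
  refine ⟨hn.1.succM, fun m hm => ?_⟩
  rcases hm with rfl | hm
  · exact Or.inr ⟨n, isSucc_iff.2 rfl⟩
  · exact hn.2 m (eps_succM.1 hm).symm

theorem IsNat.zero_or_succ {n : M} (hn : IsNat n) :
    n = zeroM M ∨ ∃ m, IsNat m ∧ n = IntUltrapower.succM m := by
  rcases hn.2 n (Or.inl rfl) with h | ⟨k, hk⟩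
  · exact Or.inl (isEmptySet_iff.1 h)
  · rw [isSucc_iff] at hk
    exact Or.inr ⟨k, hn.of_eps (by rw [hk]; simp), hk⟩

theorem nat_induction (P : M → Prop) [DP (fun v : Fin 1 → M => P (v 0))] (h0 : P (zeroM M))
    (hs : ∀ n, IsNat n → P n → P (succM n)) (n : M) (hn : IsNat n) : P n := by
  refine ord_induction (fun n => IsNat n → P n) ?_ n hn.1 hn
  intro a _ ih ha
  rcases ha.zero_or_succ with rfl | ⟨m, hm, rfl⟩
  · exact h0
  · exact hs m hm (ih m (by simp) hm)

theorem zero_eps_or_eq {n : M} (hn : IsOrd n) : n = zeroM M ∨ zeroM M ∈ₘ n := by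
  rcases ord_trichotomy isOrd_zero hn with h | h | h
  · exact Or.inr h
  · exact Or.inl h.symm
  · exact absurd h (not_eps_zero n)

end SetTheory

/-! ### Functions, finite sets, integers and blocks in the sense of `M`. -/

section FiniteSets

variable {M : Type u} [setLang.Structure M] [hM : ModelZFCMinus M]

/-! ### Functions and finite sets -/

theorem IsFun.dom {f x y : M} {d c : Set M} (h : IsFun f d c) (hy : App f x y) : x ∈ d := by
  obtain ⟨x', hx', y', _, he⟩ := h.1 _ (app_iff.1 hy)
  rw [isOPair_iff, opair_inj] at he
  exact he.1 ▸ hx'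

theorem IsFun.cod {f x y : M} {d c : Set M} (h : IsFun f d c) (hy : App f x y) : y ∈ c := by
  obtain ⟨x', hx', y', hy', he⟩ := h.1 _ (app_iff.1 hy)
  rw [isOPair_iff, opair_inj] at he
  exact he.2 ▸ hy'

theorem IsFun.unique {f x y z : M} {d c : Set M} (h : IsFun f d c) (hy : App f x y)
    (hz : App f x z) : y = z :=
  (h.2 x (h.dom hy)).unique hy hz

theorem exists_isFun (R : M → M → Prop) [h : DP (fun v : Fin 2 → M => R (v 0) (v 1))] (a : M)
    (c : Set M) (hR : ∀ x, x ∈ₘ a → ∃! y, R x y) (hc : ∀ x y, x ∈ₘ a → R x y → y ∈ c) :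
    ∃ f, IsFun f (els a) c ∧ ∀ x y, App f x y ↔ x ∈ₘ a ∧ R x y := by
  have hR' : ∀ {n : ℕ} (a b : (Fin n → M) → M) [Tm a] [Tm b], DP fun v => R (a v) (b v) :=
    fun a b _ _ => DP.subst₂ h a b
  obtain ⟨f, hf⟩ := replacement (fun x p => ∃ y, R x y ∧ p = opair x y) a (by
    rintro x hx _ _ ⟨y, hy, rfl⟩ ⟨z, hz, rfl⟩
    rw [(hR x hx).unique hy hz])
  have key : ∀ x y, App f x y ↔ x ∈ₘ a ∧ R x y := by
    intro x y
    rw [app_iff, hf]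
    constructor
    · rintro ⟨x', hx', y', hy', he⟩
      obtain ⟨rfl, rfl⟩ := opair_inj.1 he
      exact ⟨hx', hy'⟩
    · rintro ⟨hx, hy⟩
      exact ⟨x, hx, y, hy, rfl⟩
  refine ⟨f, ⟨fun p hp => ?_, fun x hx => ?_⟩, key⟩
  · obtain ⟨x, hx, y, hy, rfl⟩ := (hf p).1 hp
    exact ⟨x, hx, y, hc x y hx hy, isOPair_iff.2 rfl⟩
  · obtain ⟨y, hy, hu⟩ := hR x hx
    exact ⟨y, (key x y).2 ⟨hx, hy⟩, fun z hz => hu z ((key x z).1 hz).2⟩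

theorem isFin_zero : IsFin (zeroM M) := by
  refine ⟨zeroM M, zeroM M, isNat_zero, ⟨⟨⟨?_, ?_⟩, ?_⟩, ?_⟩⟩
  · exact fun p hp => absurd hp (not_eps_zero p)
  · exact fun p hp => absurd hp (not_eps_zero p)
  · exact fun x y v hx => absurd (app_iff.1 hx) (not_eps_zero _)
  · exact fun p hp => absurd hp (not_eps_zero p)

theorem adjoin_of_eps {s i : M} (hi : i ∈ₘ s) : adjoin s i = s := ext_eps fun z => by
  rw [eps_adjoin]
  exact or_iff_left_of_imp fun h => h ▸ hi

theorem IsFin.adjoin {s : M} (hs : IsFin s) (i : M) : IsFin (adjoin s i) := by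
  by_cases hi : i ∈ₘ s
  · rwa [adjoin_of_eps hi]
  obtain ⟨n, f, hn, ⟨⟨hf, hinj⟩, hsurj⟩⟩ := hs
  -- The enumeration `f` of length `n` is extended by `n ↦ i`.
  have key : ∀ x y, App (IntUltrapower.adjoin f (opair n i)) x y ↔ App f x y ∨ x = n ∧ y = i := by
    intro x y
    simp [app_iff]
  refine ⟨IntUltrapower.succM n, IntUltrapower.adjoin f (opair n i), hn.succM,
    ⟨⟨⟨fun p hp => ?_, fun x hx => ?_⟩, fun x y v hx hy => ?_⟩, fun v hv => ?_⟩⟩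
  · rw [eps_adjoin] at hp
    rcases hp with hp | rfl
    · obtain ⟨x, hx, y, hy, h⟩ := hf.1 p hp
      exact ⟨x, eps_succM.2 (Or.inl hx), y, eps_adjoin.2 (Or.inl hy), h⟩
    · exact ⟨n, eps_succM.2 (Or.inr rfl), i, eps_adjoin.2 (Or.inr rfl), isOPair_iff.2 rfl⟩
  · rcases eps_succM.1 hx with hx | rfl
    · obtain ⟨y, hy, hu⟩ := hf.2 x hx
      refine ⟨y, (key x y).2 (Or.inl hy), fun z hz => ?_⟩
      rcases (key x z).1 hz with h | ⟨rfl, rfl⟩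
      · exact hu z h
      · exact absurd hx (eps_irrefl x)
    · refine ⟨i, (key _ _).2 (Or.inr ⟨rfl, rfl⟩), fun z hz => ?_⟩
      rcases (key x z).1 hz with h | h
      · exact absurd (hf.dom h) (eps_irrefl x)
      · exact h.2
  · rcases (key _ _).1 hx with hx | ⟨hx, hx'⟩ <;> rcases (key _ _).1 hy with hy | ⟨hy, hy'⟩
    · exact hinj x y v hx hy
    · exact absurd (hy' ▸ hf.cod hx) hi
    · exact absurd (hx' ▸ hf.cod hy) hi
    · exact hx.trans hy.symm
  · rcases eps_adjoin.1 hv with hv | rfl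
    · obtain ⟨x, hx⟩ := hsurj v hv
      exact ⟨x, (key _ _).2 (Or.inl hx)⟩
    · exact ⟨n, (key _ _).2 (Or.inr ⟨rfl, rfl⟩)⟩

/-- Along an enumeration of `s` of length `n`, induction in `M` on `m ≤ n` reaches the set of the
first `m` values. Seen from outside, `s` may be infinite. -/
theorem fin_induction (P : M → Prop) [h : DP (fun v : Fin 1 → M => P (v 0))] {s : M} (hs : IsFin s)
    (h0 : P (zeroM M)) (ha : ∀ c i, Sub c s → i ∈ₘ s → P c → P (adjoin c i)) : P s := by
  have hP : ∀ {n : ℕ} (a : (Fin n → M) → M) [Tm a], DP fun v => P (a v) :=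
    fun a _ => DP.subst₁ h a
  obtain ⟨n, f, hn, ⟨⟨hf, hinj⟩, hsurj⟩⟩ := hs
  have := nat_induction (fun m => (m = n ∨ m ∈ₘ n) →
    ∀ c, (∀ z, z ∈ₘ c ↔ ∃ j, j ∈ₘ m ∧ App f j z) → P c) (by
      intro _ c hc
      convert! h0
      exact isEmptySet_iff.1 fun z hz => by
        obtain ⟨j, hj, _⟩ := (hc z).1 hz
        exact not_eps_zero j hj) (by
      intro m hm ih hmn c hc
      have hmn' : m ∈ₘ n := by
        rcases hmn with rfl | h
        · simp
        · exact hn.1.trans h (by simp)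
      obtain ⟨i, hi⟩ := (hf.2 m hmn').exists
      obtain ⟨c', hc'⟩ := separation (fun z => ∃ j, j ∈ₘ m ∧ App f j z) s
      have e : c = adjoin c' i := ext_eps fun z => by
        rw [hc, eps_adjoin, hc']
        constructor
        · rintro ⟨j, hj, hz⟩
          rcases eps_succM.1 hj with hj | rfl
          · exact Or.inl ⟨hf.cod hz, j, hj, hz⟩
          · exact Or.inr (hf.unique hz hi)
        · rintro (⟨_, j, hj, hz⟩ | rfl)
          · exact ⟨j, eps_succM.2 (Or.inl hj), hz⟩
          · exact ⟨m, by simp, hi⟩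
      rw [e]
      refine ha c' i (fun z hz => ((hc' z).1 hz).1) (hf.cod hi) (ih (Or.inr hmn') c' fun z => ?_)
      rw [hc']
      exact and_iff_right_of_imp fun ⟨j, _, hz⟩ => hf.cod hz) n hn (Or.inl rfl) s
  refine this fun z => ⟨fun hz => ?_, fun ⟨j, _, hz⟩ => hf.cod hz⟩
  obtain ⟨j, hj⟩ := hsurj z hz
  exact ⟨j, hf.dom hj, hj⟩

theorem eq_zero_of_sub {d : M} (hd : Sub d (zeroM M)) : d = zeroM M :=
  isEmptySet_iff.1 fun z hz => not_eps_zero z (hd z hz)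

theorem IsFin.subset {s : M} (hs : IsFin s) {d : M} (hd : Sub d s) : IsFin d := by
  refine fin_induction (fun s => ∀ d, Sub d s → IsFin d) hs ?_ ?_ d hd
  · intro d hd
    rw [eq_zero_of_sub hd]
    exact isFin_zero
  · intro c i _ _ ih d hd
    by_cases hi : i ∈ₘ d
    · obtain ⟨d', hd'⟩ := separation (fun z => z ≠ i) d
      have : d = IntUltrapower.adjoin d' i := ext_eps fun z => by
        rw [eps_adjoin, hd']
        by_cases h : z = i <;> simp [h, hi]
      rw [this]
      refine (ih d' fun z hz => ?_).adjoin i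
      obtain ⟨h1, h2⟩ := (hd' z).1 hz
      exact (eps_adjoin.1 (hd z h1)).resolve_right h2
    · exact ih d fun z hz => (eps_adjoin.1 (hd z hz)).resolve_right fun h => hi (h ▸ hz)

theorem IsFin.cup {s t : M} (hs : IsFin s) (ht : IsFin t) : IsFin (cup s t) := by
  have := fin_induction (fun t => ∃ c, IsFin c ∧ ∀ z, z ∈ₘ c ↔ z ∈ₘ s ∨ z ∈ₘ t) ht
    ⟨s, hs, fun z => by simp [not_eps_zero]⟩ (by
      rintro t i _ _ ⟨c, hc, h⟩
      exact ⟨_, hc.adjoin i, fun z => by rw [eps_adjoin, h, eps_adjoin, or_assoc]⟩)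
  obtain ⟨c, hc, h⟩ := this
  convert! hc
  exact ext_eps fun z => by rw [h, eps_cup]

theorem IsNat.isFin {n : M} (hn : IsNat n) : IsFin n :=
  nat_induction (fun n => IsFin n) isFin_zero (fun n _ h => h.adjoin n) n hn

/-! ### The integers -/

theorem isIntNonneg_iff {z n : M} : IsIntNonneg z n ↔ IsNat n ∧ z = opair (zeroM M) n := by
  simp [IsIntNonneg, isEmptySet_iff, isOPair_iff]

theorem isIntNeg_iff {z n : M} : IsIntNeg z n ↔ IsNat n ∧ z = opair (oneM M) n := by
  simp [IsIntNeg, isOne_iff, isOPair_iff]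

theorem IsInt.cases {z : M} (hz : IsInt z) :
    (∃ n, IsNat n ∧ z = opair (zeroM M) n) ∨ ∃ n, IsNat n ∧ z = opair (oneM M) n := by
  obtain ⟨n, h | h⟩ := hz
  · exact Or.inl ⟨n, isIntNonneg_iff.1 h⟩
  · exact Or.inr ⟨n, isIntNeg_iff.1 h⟩

theorem intLT_iff {z w : M} : IntLT z w ↔ ∃ n m, IsNat n ∧ IsNat m ∧
    ((z = opair (zeroM M) n ∧ w = opair (zeroM M) m ∧ n ∈ₘ m) ∨
      (z = opair (oneM M) n ∧ w = opair (zeroM M) m) ∨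
      (z = opair (oneM M) n ∧ w = opair (oneM M) m ∧ m ∈ₘ n)) := by
  simp only [IntLT, isIntNonneg_iff, isIntNeg_iff]
  refine exists_congr fun n => exists_congr fun m => ?_
  tauto

theorem IntLT.irrefl {z : M} : ¬ IntLT z z := by
  rw [intLT_iff]
  rintro ⟨n, m, _, _, ⟨rfl, h, h'⟩ | ⟨rfl, h⟩ | ⟨rfl, h, h'⟩⟩ <;> rw [opair_inj] at h
  · exact eps_irrefl n (by rwa [← h.2] at h')
  · exact zero_ne_one h.1.symm
  · exact eps_irrefl n (by rwa [← h.2] at h')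

theorem IntLT.trans {x y z : M} (hxy : IntLT x y) (hyz : IntLT y z) : IntLT x z := by
  rw [intLT_iff] at *
  obtain ⟨n, m, hn, hm, h⟩ := hxy
  obtain ⟨m', l, hm', hl, h'⟩ := hyz
  refine ⟨n, l, hn, hl, ?_⟩
  rcases h with ⟨rfl, rfl, h⟩ | ⟨rfl, rfl⟩ | ⟨rfl, rfl, h⟩ <;>
  rcases h' with ⟨e, rfl, h'⟩ | ⟨e, rfl⟩ | ⟨e, rfl, h'⟩ <;>
  simp only [opair_inj, zero_ne_one, zero_ne_one.symm, false_and, true_and] at e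
  · subst e
    exact Or.inl ⟨rfl, rfl, hl.1.trans h' h⟩
  · exact Or.inr (Or.inl ⟨rfl, rfl⟩)
  · exact Or.inr (Or.inl ⟨rfl, rfl⟩)
  · subst e
    exact Or.inr (Or.inr ⟨rfl, rfl, hn.1.trans h h'⟩)

theorem IntLT.asymm {x y : M} (hxy : IntLT x y) : ¬ IntLT y x := fun h => (hxy.trans h).irrefl

theorem int_trichotomy {x y : M} (hx : IsInt x) (hy : IsInt y) :
    IntLT x y ∨ x = y ∨ IntLT y x := by
  simp only [intLT_iff]
  rcases hx.cases with ⟨n, hn, rfl⟩ | ⟨n, hn, rfl⟩ <;>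
  rcases hy.cases with ⟨m, hm, rfl⟩ | ⟨m, hm, rfl⟩
  · rcases ord_trichotomy hn.1 hm.1 with h | rfl | h
    · exact Or.inl ⟨n, m, hn, hm, Or.inl ⟨rfl, rfl, h⟩⟩
    · exact Or.inr (Or.inl rfl)
    · exact Or.inr (Or.inr ⟨m, n, hm, hn, Or.inl ⟨rfl, rfl, h⟩⟩)
  · exact Or.inr (Or.inr ⟨m, n, hm, hn, Or.inr (Or.inl ⟨rfl, rfl⟩)⟩)
  · exact Or.inl ⟨n, m, hn, hm, Or.inr (Or.inl ⟨rfl, rfl⟩)⟩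
  · rcases ord_trichotomy hn.1 hm.1 with h | rfl | h
    · exact Or.inr (Or.inr ⟨m, n, hm, hn, Or.inr (Or.inr ⟨rfl, rfl, h⟩)⟩)
    · exact Or.inr (Or.inl rfl)
    · exact Or.inl ⟨n, m, hn, hm, Or.inr (Or.inr ⟨rfl, rfl, h⟩)⟩

theorem intLE_of_not_lt {x y : M} (hx : IsInt x) (hy : IsInt y) (h : ¬ IntLT x y) :
    IntLE y x := by
  rcases int_trichotomy hx hy with h' | rfl | h'
  · exact absurd h' h
  · exact Or.inl rfl
  · exact Or.inr h'

theorem IntLE.not_lt {x y : M} (h : IntLE y x) : ¬ IntLT x y := by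
  rcases h with rfl | h
  · exact IntLT.irrefl
  · exact h.asymm

theorem IntLE.trans_lt {x y z : M} (h : IntLE x y) (h' : IntLT y z) : IntLT x z := by
  rcases h with rfl | h
  · exact h'
  · exact h.trans h'

theorem IntLT.trans_le {x y z : M} (h : IntLT x y) (h' : IntLE y z) : IntLT x z := by
  rcases h' with rfl | h'
  · exact h
  · exact h.trans h'

theorem IntLE.trans {x y z : M} (h : IntLE x y) (h' : IntLE y z) : IntLE x z := by
  rcases h with rfl | h
  · exact h'
  · exact Or.inr (h.trans_le h')

/-- A finite nonempty set of integers has a least and a greatest element. -/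
theorem IsFin.exists_min_max {s : M} (hs : IsFin s) (hi : ∀ i, i ∈ₘ s → IsInt i)
    (hne : ∃ i, i ∈ₘ s) : (∃ a, a ∈ₘ s ∧ ∀ i, i ∈ₘ s → IntLE a i) ∧
      ∃ b, b ∈ₘ s ∧ ∀ i, i ∈ₘ s → IntLE i b := by
  have := fin_induction (fun s => (∀ i, i ∈ₘ s → IsInt i) → (∃ i, i ∈ₘ s) →
    (∃ a, a ∈ₘ s ∧ ∀ i, i ∈ₘ s → IntLE a i) ∧ ∃ b, b ∈ₘ s ∧ ∀ i, i ∈ₘ s → IntLE i b) hs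
    (fun _ ⟨i, hi⟩ => absurd hi (not_eps_zero i)) ?_
  · exact this hi hne
  intro c j hc _ ih hint _
  have hj : IsInt j := hint j (by simp)
  by_cases hce : ∃ i, i ∈ₘ c
  · obtain ⟨⟨a, ha, ha'⟩, b, hb, hb'⟩ := ih (fun i h => hint i (by simp [h])) hce
    have hai : IsInt a := hint a (by simp [ha])
    have hbi : IsInt b := hint b (by simp [hb])
    constructor
    · by_cases h : IntLT a j
      · refine ⟨a, by simp [ha], fun i hi => ?_⟩
        rcases eps_adjoin.1 hi with hi | rfl
        · exact ha' i hi
        · exact Or.inr h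
      · have h := intLE_of_not_lt hai hj h
        refine ⟨j, by simp, fun i hi => ?_⟩
        rcases eps_adjoin.1 hi with hi | rfl
        · exact h.trans (ha' i hi)
        · exact Or.inl rfl
    · by_cases h : IntLT b j
      · refine ⟨j, by simp, fun i hi => ?_⟩
        rcases eps_adjoin.1 hi with hi | rfl
        · exact (hb' i hi).trans (Or.inr h)
        · exact Or.inl rfl
      · have h := intLE_of_not_lt hbi hj h
        refine ⟨b, by simp [hb], fun i hi => ?_⟩
        rcases eps_adjoin.1 hi with hi | rfl
        · exact hb' i hi
        · exact h
  · have : ∀ i, i ∈ₘ IntUltrapower.adjoin c j → i = j := fun i hi =>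
      (eps_adjoin.1 hi).resolve_left fun h => hce ⟨i, h⟩
    exact ⟨⟨j, by simp, fun i hi => Or.inl (this i hi).symm⟩, j, by simp,
      fun i hi => Or.inl (this i hi)⟩

/-- Finite sets of integers satisfy induction by adjoining larger and larger elements. -/
theorem fin_int_induction (P : M → Prop) [h : DP (fun v : Fin 1 → M => P (v 0))] {s : M}
    (hs : IsFin s) (hi : ∀ i, i ∈ₘ s → IsInt i) (h0 : P (zeroM M))
    (ha : ∀ c i, Sub c s → i ∈ₘ s → (∀ j, j ∈ₘ c → IntLT j i) → P c → P (adjoin c i)) : P s := by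
  have hP : ∀ {n : ℕ} (a : (Fin n → M) → M) [Tm a], DP fun v => P (a v) :=
    fun a _ => DP.subst₁ h a
  -- Consider the initial segments of `s`. Below the least `i` whose segment fails, the segment is
  -- empty or ends at a smaller point, so it satisfies `P`.
  have key : ∀ i, i ∈ₘ s → ∀ c, (∀ j, j ∈ₘ c ↔ j ∈ₘ s ∧ IntLE j i) → P c := by
    by_contra! hbad
    obtain ⟨d, hd⟩ := separation
      (fun i => ∃ c, (∀ j, j ∈ₘ c ↔ j ∈ₘ s ∧ IntLE j i) ∧ ¬ P c) s
    have hds : Sub d s := fun z hz => ((hd z).1 hz).1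
    obtain ⟨i₁, h1, h2⟩ := hbad
    obtain ⟨⟨i, hid, hmin⟩, _⟩ := (hs.subset hds).exists_min_max (fun i h => hi i (hds i h))
      ⟨i₁, (hd i₁).2 ⟨h1, h2⟩⟩
    obtain ⟨his, c, hc, hPc⟩ := (hd i).1 hid
    obtain ⟨c', hc'⟩ := separation (fun j => IntLT j i) s
    have hcs : Sub c' s := fun z hz => ((hc' z).1 hz).1
    have e : c = adjoin c' i := ext_eps fun z => by
      rw [hc, eps_adjoin, hc', IntLE]
      constructor
      · rintro ⟨h1, rfl | h2⟩
        · exact Or.inr rfl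
        · exact Or.inl ⟨h1, h2⟩
      · rintro (⟨h1, h2⟩ | rfl)
        · exact ⟨h1, Or.inr h2⟩
        · exact ⟨his, Or.inl rfl⟩
    refine hPc (e ▸ ha c' i hcs his (fun j hj => ((hc' j).1 hj).2) ?_)
    by_cases hne : ∃ j, j ∈ₘ c'
    · obtain ⟨_, b, hb, hmax⟩ := (hs.subset hcs).exists_min_max (fun i h => hi i (hcs i h)) hne
      obtain ⟨hbs, hbi⟩ := (hc' b).1 hb
      by_contra hPc'
      have hbd : b ∈ₘ d := (hd b).2 ⟨hbs, c', fun j =>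
        ⟨fun hj => ⟨hcs j hj, hmax j hj⟩, fun hj => (hc' j).2 ⟨hj.1, hj.2.trans_lt hbi⟩⟩, hPc'⟩
      exact (hmin b hbd).not_lt hbi
    · have : c' = zeroM M := isEmptySet_iff.1 fun z hz => hne ⟨z, hz⟩
      rwa [this]
  by_cases hne : ∃ j, j ∈ₘ s
  · obtain ⟨_, b, hb, hmax⟩ := hs.exists_min_max hi hne
    exact key b hb s fun j => ⟨fun hj => ⟨hj, hmax j hj⟩, And.left⟩
  · have : s = zeroM M := isEmptySet_iff.1 fun z hz => hne ⟨z, hz⟩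
    rwa [this]

/-! ### Blocks -/

theorem exists_isFin_image {n o : M} (hn : IsNat n) :
    ∃ d, IsFin d ∧ ∀ i, i ∈ₘ d ↔ ∃ p, p ∈ₘ n ∧ i = opair o p := by
  refine fin_induction (fun n => ∃ d, IsFin d ∧ ∀ i, i ∈ₘ d ↔ ∃ p, p ∈ₘ n ∧ i = opair o p) hn.isFin
    ⟨zeroM M, isFin_zero, by simp [not_eps_zero]⟩ ?_
  rintro c p _ _ ⟨d, hd, h⟩
  refine ⟨adjoin d (opair o p), hd.adjoin _, fun i => ?_⟩
  rw [eps_adjoin, h]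
  constructor
  · rintro (⟨q, hq, rfl⟩ | rfl)
    · exact ⟨q, by simp [hq], rfl⟩
    · exact ⟨p, by simp, rfl⟩
  · rintro ⟨q, hq, rfl⟩
    rcases eps_adjoin.1 hq with hq | rfl
    · exact Or.inl ⟨q, hq, rfl⟩
    · exact Or.inr rfl

/-- Every interval of integers is a finite set. -/
theorem exists_isFin_interval {a b : M} (ha : IsInt a) (hb : IsInt b) :
    ∃ s, IsFin s ∧ ∀ i, i ∈ₘ s ↔ IsInt i ∧ IntLE a i ∧ IntLE i b := by
  have hsnd : ∀ z : M, IsInt z → ∃ o n, IsNat n ∧ z = opair o n := fun z hz => by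
    rcases hz.cases with ⟨n, hn, rfl⟩ | ⟨n, hn, rfl⟩ <;> exact ⟨_, n, hn, rfl⟩
  obtain ⟨o, n, hn, rfl⟩ := hsnd a ha
  obtain ⟨o', m, hm, rfl⟩ := hsnd b hb
  -- Whatever the signs of the endpoints, a negative integer strictly above `a` has code below `n`,
  -- and a nonnegative one strictly below `b` has code below `m`. So the two images and the
  -- endpoints form a finite superset.
  obtain ⟨d, hd, hd'⟩ := exists_isFin_image (o := oneM M) hn
  obtain ⟨e, he, he'⟩ := exists_isFin_image (o := zeroM M) hm
  have hfin := ((hd.cup he).adjoin (opair o n)).adjoin (opair o' m)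
  obtain ⟨s, hs⟩ := separation (fun i => IsInt i ∧ IntLE (opair o n) i ∧ IntLE i (opair o' m))
    (adjoin (adjoin (cup d e) (opair o n)) (opair o' m))
  refine ⟨s, hfin.subset fun i hi => ((hs i).1 hi).1, fun i => (hs i).trans
    (and_iff_right_of_imp ?_)⟩
  rintro ⟨hi, h1, h2⟩
  simp only [eps_adjoin, eps_cup, hd', he']
  rcases h1 with rfl | h1
  · simp
  rcases h2 with rfl | h2
  · simp
  rw [intLT_iff] at h1 h2
  rcases hi.cases with ⟨p, hp, rfl⟩ | ⟨p, hp, rfl⟩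
  · obtain ⟨x, y, _, _, h⟩ := h2
    simp only [opair_inj, zero_ne_one, false_and, true_and, or_false] at h
    obtain ⟨rfl, ⟨_, rfl⟩, h⟩ := h
    exact Or.inl (Or.inl (Or.inr ⟨p, h, rfl⟩))
  · obtain ⟨x, y, _, _, h⟩ := h1
    simp only [opair_inj, zero_ne_one.symm, false_and, true_and, and_false, false_or] at h
    obtain ⟨⟨_, rfl⟩, rfl, h⟩ := h
    exact Or.inl (Or.inl (Or.inl ⟨p, h, rfl⟩))

/-- `s` is a finite convex set of integers. -/
def FinConvex (s : M) : Prop :=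
  IsFin s ∧ (∀ i, i ∈ₘ s → IsInt i) ∧
    ∀ i j l, i ∈ₘ s → j ∈ₘ s → IntLT i l → IntLT l j → l ∈ₘ s

instance DP.finConvex {n : ℕ} (a : (Fin n → M) → M) [Tm a] : DP (fun v => FinConvex (a v)) :=
  DP.subst₁ (by unfold FinConvex; infer_instance) a

/-- The endpoints are the minimum and the maximum. Convexity is preferred to endpoints because it
passes directly to intersections, empty ones included. -/
theorem isBlock_iff {s : M} : IsBlock s ↔ FinConvex s := by
  constructor
  · rintro (h | ⟨a, b, ha, hb, _, h⟩)
    · have : s = zeroM M := isEmptySet_iff.1 h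
      subst this
      exact ⟨isFin_zero, fun i hi => absurd hi (h i), fun i _ _ hi => absurd hi (h i)⟩
    · obtain ⟨t, ht, h'⟩ := exists_isFin_interval ha hb
      have : s = t := ext_eps fun z => by rw [h, h']
      subst this
      exact ⟨ht, fun i hi => ((h i).1 hi).1, fun i j l hi hj hil hlj => (h l).2 ⟨hil.isInt_right,
        ((h i).1 hi).2.1.trans (Or.inr hil), IntLE.trans (Or.inr hlj) ((h j).1 hj).2.2⟩⟩
  · rintro ⟨h1, h2, h3⟩
    by_cases hne : ∃ j, j ∈ₘ s
    · obtain ⟨⟨a, ha, ha'⟩, b, hb, hb'⟩ := h1.exists_min_max h2 hne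
      refine Or.inr ⟨a, b, h2 a ha, h2 b hb, ha' b hb, fun i => ⟨fun hi => ⟨h2 i hi, ha' i hi,
        hb' i hi⟩, ?_⟩⟩
      rintro ⟨_, rfl | h, h'⟩
      · exact ha
      · rcases h' with rfl | h'
        · exact hb
        · exact h3 a b i ha hb h h'
    · exact Or.inl fun z hz => hne ⟨z, hz⟩

theorem FinConvex.cap {s t : M} (hs : FinConvex s) (ht : FinConvex t) : FinConvex (cap s t) := by
  refine ⟨hs.1.subset fun z hz => (eps_cap.1 hz).1, fun i hi => hs.2.1 i (eps_cap.1 hi).1,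
    fun i j l hi hj hil hlj => ?_⟩
  rw [eps_cap] at *
  exact ⟨hs.2.2 i j l hi.1 hj.1 hil hlj, ht.2.2 i j l hi.2 hj.2 hil hlj⟩

/-- Every finite set of integers is contained in a finite convex one. -/
theorem exists_finConvex {s : M} (hs : IsFin s) (hi : ∀ i, i ∈ₘ s → IsInt i) :
    ∃ t, Sub s t ∧ FinConvex t := by
  by_cases hne : ∃ j, j ∈ₘ s
  · obtain ⟨⟨a, ha, ha'⟩, b, hb, hb'⟩ := hs.exists_min_max hi hne
    obtain ⟨t, _, ht'⟩ := exists_isFin_interval (hi a ha) (hi b hb)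
    exact ⟨t, fun i h => (ht' i).2 ⟨hi i h, ha' i h, hb' i h⟩,
      isBlock_iff.1 (Or.inr ⟨a, b, hi a ha, hi b hb, ha' b hb, ht'⟩)⟩
  · exact ⟨s, fun _ h => h, isBlock_iff.1 (Or.inl fun z hz => hne ⟨z, hz⟩)⟩

end FiniteSets

/-! ### Transitivity and monotonicity of the constructible hierarchy. -/

section Constructible

variable {M : Type u} [setLang.Structure M] [hM : ModelZFCMinus M]

/-! ### The constructible hierarchy -/

theorem isTuple_zero (N : M) : IsTuple N (zeroM M) (zeroM M) :=
  ⟨fun p hp => absurd hp (not_eps_zero p), fun x hx => absurd hx (not_eps_zero x)⟩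

/-- If there is no definability family over `N`, then every set is definable over `N`. -/
theorem els_mem_defSets_of_not_exists {N : M} (h : ¬ ∃ F, IsDefFamily N F) (z : M) :
    els z ∈ DefSets N := by
  -- `R` consists of the 1-tuples from `z`. It counts as definable because the quantifier over
  -- families is vacuous.
  obtain ⟨R, hR⟩ := replacement
    (fun x t => IsUPair t (opair (zeroM M) x) (opair (zeroM M) x)) z (by
      intro x _ t t' ht ht'
      rw [isUPair_iff] at ht ht'
      rw [ht, ht'])
  refine ⟨zeroM M, oneM M, zeroM M, R, isNat_zero, isSucc_iff.2 rfl, isTuple_zero N,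
    fun F hF => absurd ⟨F, hF⟩ h, fun x => ⟨fun hx => ?_, ?_⟩⟩
  · refine ⟨upair (opair (zeroM M) x) (opair (zeroM M) x), (hR _).2 ⟨x, hx, isUPair_iff.2 rfl⟩,
      fun p hp => absurd hp (not_eps_zero p), ?_⟩
    simp [app_iff]
  · rintro ⟨t, ht, -, hx⟩
    obtain ⟨y, hy, hyt⟩ := (hR t).1 ht
    rw [app_iff, hyt] at hx
    simp only [opair_inj, true_and, or_self] at hx
    exact hx ▸ hy

/-- A definability family may be thinned out to sets of tuples. -/
theorem IsDefFamily.restrict {N F : M} (h : IsDefFamily N F) :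
    ∃ F', IsDefFamily N F' ∧ ∀ n R, App F' n R → ∀ t, t ∈ₘ R → IsTuple N n t := by
  -- Each closure condition yields a set of tuples from sets of tuples, so all of them survive the
  -- cut.
  obtain ⟨F', hF'⟩ := separation
    (fun p => ∀ n R, IsOPair p n R → ∀ t, t ∈ₘ R → IsTuple N n t) F
  have key : ∀ n R, App F' n R ↔ App F n R ∧ ∀ t, t ∈ₘ R → IsTuple N n t := by
    intro n R
    rw [app_iff, app_iff, hF']
    refine and_congr_right fun _ => ⟨fun h => h n R (isOPair_iff.2 rfl), ?_⟩
    rintro h n' R' he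
    obtain ⟨rfl, rfl⟩ := opair_inj.1 (isOPair_iff.1 he)
    exact h
  refine ⟨F', ⟨?_, ?_, ?_, ?_, ?_⟩, fun n R hR => ((key n R).1 hR).2⟩ <;> simp only [key]
  · exact fun n i j R hn hi hj hR => ⟨h.mem n i j R hn hi hj hR, fun t ht => ((hR t).1 ht).1⟩
  · exact fun n i j R hn hi hj hR => ⟨h.eq n i j R hn hi hj hR, fun t ht => ((hR t).1 ht).1⟩
  · exact fun n R R' hn hR hR' => ⟨h.compl n R R' hn hR.1 hR', fun t ht => ((hR' t).1 ht).1⟩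
  · exact fun n R₁ R₂ R' hn h₁ h₂ hR' => ⟨h.inter n R₁ R₂ R' hn h₁.1 h₂.1 hR',
      fun t ht => h₁.2 t ((hR' t).1 ht).1⟩
  · exact fun n n' R R' hn hn' hR hR' => ⟨h.proj n n' R R' hn hn' hR.1 hR',
      fun t ht => ((hR' t).1 ht).1⟩

theorem sub_of_mem_defSets {N F z : M} (h : IsDefFamily N F) (hz : els z ∈ DefSets N) :
    Sub z N := by
  obtain ⟨F', hF', htup⟩ := h.restrict
  obtain ⟨n, n', s, R, _, hn', _, hR, hP⟩ := hz
  intro x hx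
  obtain ⟨t, ht, -, htx⟩ := (hP x).1 hx
  exact (htup n' R (hR F' hF') t ht).cod htx

/-- The levels of the constructible hierarchy are transitive. -/
theorem IsL.transitive {a N : M} (h : IsL a N) : IsTransSet N := by
  obtain ⟨ha, f, a', ha', hf, hrec, hN⟩ := h
  rw [isSucc_iff] at ha'
  subst ha'
  intro z hz y hy
  obtain ⟨c, w, hc, hw, hzw⟩ := (hrec a N hN z).1 hz
  -- Without a definability family over `w` every set would be definable over `w`, and `N ∈ N` would
  -- follow.
  have hF : ∃ F, IsDefFamily w F := by
    by_contra hF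
    exact eps_irrefl N ((hrec a N hN N).2 ⟨c, w, hc, hw, els_mem_defSets_of_not_exists hF N⟩)
  obtain ⟨F, hF⟩ := hF
  obtain ⟨d, w', hd, hw', hyw⟩ := (hrec c w hw y).1 (sub_of_mem_defSets hF hzw y hy)
  exact (hrec a N hN y).2 ⟨d, w', ha.trans hc hd, hw', hyw⟩

/-- The constructible hierarchy is increasing. -/
theorem IsL.mono {a b N N' : M} (h : IsL a N) (h' : IsL b N') (hab : a = b ∨ a ∈ₘ b) :
    Sub N N' := by
  obtain ⟨ha, f, a', ha', hf, hrec, hN⟩ := h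
  obtain ⟨hb, f', b', hb', hf', hrec', hN'⟩ := h'
  rw [isSucc_iff] at ha' hb'
  subst ha' hb'
  have hsub : ∀ c, c ∈ₘ a → c ∈ₘ b := fun c hc => by
    rcases hab with rfl | h
    · exact hc
    · exact hb.trans h hc
  -- The two levels come with different recursions `f` and `f'`; these agree below `a`.
  have key : ∀ c, IsOrd c → c ∈ₘ a → ∀ v v', App f c v → App f' c v' → v = v' := by
    refine ord_induction (fun c => c ∈ₘ a → ∀ v v', App f c v → App f' c v' → v = v') ?_
    intro c _ ih hca v v' hv hv'
    refine ext_eps fun z => ?_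
    rw [hrec c v hv, hrec' c v' hv']
    constructor
    · rintro ⟨d, w, hd, hw, hz⟩
      have hda := ha.trans hca hd
      obtain ⟨w', hw'⟩ := (hf'.2 d (eps_succM.2 (Or.inl (hsub d hda)))).exists
      exact ⟨d, w', hd, hw', ih d hd hda w w' hw hw' ▸ hz⟩
    · rintro ⟨d, w', hd, hw', hz⟩
      have hda := ha.trans hca hd
      obtain ⟨w, hw⟩ := (hf.2 d (eps_succM.2 (Or.inl hda))).exists
      exact ⟨d, w, hd, hw, ih d hd hda w w' hw hw' ▸ hz⟩
  intro z hz
  obtain ⟨c, w, hc, hw, hzw⟩ := (hrec a N hN z).1 hz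
  obtain ⟨w', hw'⟩ := (hf'.2 c (eps_succM.2 (Or.inl (hsub c hc)))).exists
  exact (hrec' b N' hN' z).2 ⟨c, w', hsub c hc, hw',
    key c (ha.of_eps hc) hc w w' hw hw' ▸ hzw⟩

end Constructible

/-! ### Sets that `M` takes for models of `ZFC-` are models of `ZFC-`. -/

section InnerModels

variable {M : Type u} [setLang.Structure M]

/-- The set `N` of `M`, as a type. -/
abbrev Inner (N : M) : Type u := {x : M // x ∈ₘ N}

instance innerStructure (N : M) : setLang.Structure (Inner N) where
  funMap := fun f => nomatch f
  RelMap := fun {_} r => match r with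
    | SetRel.mem => fun v => (v 0).1 ∈ₘ (v 1).1

theorem inner_eps {N : M} {x y : Inner N} : x ∈ₘ y ↔ x.1 ∈ₘ y.1 := Iff.rfl

variable [hM : ModelZFCMinus M]

/-! ### Numerals and tuples -/

variable (M) in
/-- The numeral `n` in `M`. -/
noncomputable def num : ℕ → M
  | 0 => zeroM M
  | n + 1 => succM (num n)

theorem isNat_num (n : ℕ) : IsNat (num M n) := by
  induction n with
  | zero => exact isNat_zero
  | succ n ih => exact ih.succM

theorem eps_num {n : ℕ} {z : M} : z ∈ₘ num M n ↔ ∃ i : Fin n, z = num M i := by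
  induction n with
  | zero => simp [num, not_eps_zero]
  | succ n ih => simp [num, ih, Fin.exists_fin_succ']

theorem num_injective : Function.Injective (num M) := by
  have key : ∀ i j : ℕ, i < j → num M i ≠ num M j := fun i j h e =>
    eps_irrefl (num M i) (by
      conv => rhs; rw [e]
      exact eps_num.2 ⟨⟨i, h⟩, rfl⟩)
  intro i j h
  rcases lt_trichotomy i j with h' | h' | h'
  · exact absurd h (key i j h')
  · exact h'
  · exact absurd h.symm (key j i h')

theorem exists_tup {n : ℕ} (v : Fin n → M) :
    ∃ s, ∀ p, p ∈ₘ s ↔ ∃ i : Fin n, p = opair (num M i) (v i) := by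
  induction n with
  | zero => exact ⟨zeroM M, fun p => by simp [not_eps_zero]⟩
  | succ n ih =>
    obtain ⟨s, hs⟩ := ih (fun i => v i.castSucc)
    refine ⟨adjoin s (opair (num M n) (v (Fin.last n))), fun p => ?_⟩
    rw [eps_adjoin, hs, Fin.exists_fin_succ']
    simp

/-- The tuple of `M` with the entries `v 0, …, v (n - 1)`. -/
noncomputable def tup {n : ℕ} (v : Fin n → M) : M := (exists_tup v).choose

theorem eps_tup {n : ℕ} {v : Fin n → M} {p : M} :
    p ∈ₘ tup v ↔ ∃ i : Fin n, p = opair (num M i) (v i) := (exists_tup v).choose_spec p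

theorem app_tup {n : ℕ} {v : Fin n → M} {i : Fin n} {y : M} :
    App (tup v) (num M i) y ↔ y = v i := by
  rw [app_iff, eps_tup]
  constructor
  · rintro ⟨j, hj⟩
    obtain ⟨h1, rfl⟩ := opair_inj.1 hj
    rw [Fin.ext (num_injective h1)]
  · rintro rfl
    exact ⟨i, rfl⟩

theorem sub_tup_iff {n k : ℕ} {v : Fin n → M} {w : Fin (n + k) → M} :
    Sub (tup v) (tup w) ↔ ∀ i, w (Fin.castAdd k i) = v i := by
  constructor
  · intro h i
    have := h _ (eps_tup.2 ⟨i, rfl⟩)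
    exact (app_tup (i := Fin.castAdd k i).1 (app_iff.2 this)).symm
  · intro h p hp
    obtain ⟨i, rfl⟩ := eps_tup.1 hp
    exact eps_tup.2 ⟨Fin.castAdd k i, by rw [h]; rfl⟩

theorem tup_injective {n : ℕ} : Function.Injective (tup : (Fin n → M) → M) := by
  intro v w h
  ext i
  exact app_tup.1 (h ▸ app_tup.2 rfl)

/-- The entries of a tuple over `N`, as a tuple over `M`. -/
noncomputable abbrev innerTup {N : M} {n : ℕ} (v : Fin n → Inner N) : M := tup fun i => (v i).1

theorem innerTup_injective {N : M} {n : ℕ} {v w : Fin n → Inner N} (h : innerTup v = innerTup w) :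
    v = w := by
  ext i
  exact congrFun (tup_injective h) i

/-- A standard numeral has only standard elements, so a tuple of that length is given by finitely
many entries even from outside `M`. -/
theorem isTuple_iff {N s : M} {n : ℕ} :
    IsTuple N (num M n) s ↔ ∃ v : Fin n → Inner N, s = innerTup v := by
  constructor
  · intro h
    choose v hv using fun i : Fin n => (h.2 (num M i) (eps_num.2 ⟨i, rfl⟩)).exists
    refine ⟨fun i => ⟨v i, h.cod (hv i)⟩, ext_eps fun p => ?_⟩
    rw [eps_tup]
    constructor
    · intro hp
      obtain ⟨x, hx, y, hy, hxy⟩ := h.1 p hp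
      rw [isOPair_iff] at hxy
      obtain ⟨i, rfl⟩ := eps_num.1 hx
      refine ⟨i, ?_⟩
      exact hxy.trans (congrArg _ (h.unique (app_iff.2 (hxy ▸ hp)) (hv i)))
    · rintro ⟨i, rfl⟩
      exact app_iff.1 (hv i)
  · rintro ⟨v, rfl⟩
    refine ⟨fun p hp => ?_, fun x hx => ?_⟩
    · obtain ⟨i, rfl⟩ := eps_tup.1 hp
      exact ⟨_, eps_num.2 ⟨i, rfl⟩, _, (v i).2, isOPair_iff.2 rfl⟩
    · obtain ⟨i, rfl⟩ := eps_num.1 hx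
      exact ⟨v i, app_tup.2 rfl, fun y hy => app_tup.1 hy⟩

theorem exists_tuples (N : M) (n : ℕ) : ∃ T, ∀ s, s ∈ₘ T ↔ IsTuple N (num M n) s := by
  induction n with
  | zero =>
    refine ⟨upair (zeroM M) (zeroM M), fun s => ?_⟩
    rw [isTuple_iff, eps_upair, or_self]
    have : ∀ v : Fin 0 → Inner N, innerTup v = zeroM M := fun v =>
      isEmptySet_iff.1 fun p hp => (eps_tup.1 hp).choose.elim0
    simp [this]
  | succ n ih =>
    obtain ⟨T, hT⟩ := ih
    -- `N ^ (n + 1)` is the union over `a ∈ N` of the sets of extensions by `⟨n, a⟩`; two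
    -- replacements and a union avoid the power set.
    have hex : ∀ a, ∃ D, ∀ z, z ∈ₘ D ↔ ∃ s, s ∈ₘ T ∧ z = adjoin s (opair (num M n) a) :=
      fun a => replacement (fun s z => z = adjoin s (opair (num M n) a)) T
        fun s _ y z hy hz => hy.trans hz.symm
    obtain ⟨U, hU⟩ := replacement
      (fun a D => ∀ z, z ∈ₘ D ↔ ∃ s, s ∈ₘ T ∧ z = adjoin s (opair (num M n) a)) N
      (fun a _ D D' h h' => ext_eps fun z => by rw [h, h'])
    obtain ⟨V, hV⟩ := hM.out.union U
    refine ⟨V, fun s => ?_⟩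
    have e : s ∈ₘ V ↔ ∃ a, a ∈ₘ N ∧ ∃ t, t ∈ₘ T ∧ s = adjoin t (opair (num M n) a) := by
      rw [hV]
      constructor
      · rintro ⟨D, hD, hs⟩
        obtain ⟨a, ha, h⟩ := (hU D).1 hD
        exact ⟨a, ha, (h s).1 hs⟩
      · rintro ⟨a, ha, h⟩
        obtain ⟨D, hD⟩ := hex a
        exact ⟨D, (hU D).2 ⟨a, ha, hD⟩, (hD s).2 h⟩
    have key : ∀ (v : Fin n → Inner N) (a : Inner N),
        innerTup (Fin.snoc v a : Fin (n + 1) → Inner N)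
          = adjoin (innerTup v) (opair (num M n) a.1) := by
      intro v a
      refine ext_eps fun p => ?_
      rw [eps_adjoin, eps_tup, eps_tup, Fin.exists_fin_succ']
      simp
    rw [e, isTuple_iff]
    constructor
    · rintro ⟨a, ha, t, ht, rfl⟩
      obtain ⟨v, rfl⟩ := isTuple_iff.1 ((hT t).1 ht)
      exact ⟨Fin.snoc v ⟨a, ha⟩, (key v ⟨a, ha⟩).symm⟩
    · rintro ⟨v, rfl⟩
      refine ⟨v (Fin.last n), (v (Fin.last n)).2, innerTup (fun i => v i.castSucc),
        (hT _).2 (isTuple_iff.2 ⟨_, rfl⟩), ?_⟩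
      rw [← key]
      congr 1
      ext i
      rw [← Fin.init_def, Fin.snoc_init_self]

/-! ### First-order definability over `N` and definability over `N` in the sense of `M` -/

/-- The relation `S` on `N` is definable over `N` in the sense of `M`. -/
def Rep {N : M} {n : ℕ} (S : Set (Fin n → Inner N)) : Prop :=
  ∃ R, IsDefRel N (num M n) R ∧ ∀ s, s ∈ₘ R ↔ ∃ v ∈ S, s = innerTup v

variable {N : M} {n : ℕ}

theorem Rep.mem (i j : Fin n) : Rep {v : Fin n → Inner N | (v i).1 ∈ₘ (v j).1} := by
  obtain ⟨T, hT⟩ := exists_tuples N n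
  obtain ⟨R, hR⟩ := separation
    (fun s => ∃ a b, App s (num M i) a ∧ App s (num M j) b ∧ a ∈ₘ b) T
  simp only [hT] at hR
  refine ⟨R, fun F hF => hF.mem _ (num M i) (num M j) R (isNat_num n) (eps_num.2 ⟨i, rfl⟩)
    (eps_num.2 ⟨j, rfl⟩) hR, fun s => ?_⟩
  rw [hR, isTuple_iff]
  constructor
  · rintro ⟨⟨v, rfl⟩, a, b, ha, hb, hab⟩
    rw [app_tup] at ha hb
    exact ⟨v, by rwa [ha, hb] at hab, rfl⟩
  · rintro ⟨v, hv, rfl⟩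
    exact ⟨⟨v, rfl⟩, _, _, app_tup.2 rfl, app_tup.2 rfl, hv⟩

theorem Rep.eq (i j : Fin n) : Rep {v : Fin n → Inner N | v i = v j} := by
  obtain ⟨T, hT⟩ := exists_tuples N n
  obtain ⟨R, hR⟩ := separation (fun s => ∃ a, App s (num M i) a ∧ App s (num M j) a) T
  simp only [hT] at hR
  refine ⟨R, fun F hF => hF.eq _ (num M i) (num M j) R (isNat_num n) (eps_num.2 ⟨i, rfl⟩)
    (eps_num.2 ⟨j, rfl⟩) hR, fun s => ?_⟩
  rw [hR, isTuple_iff]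
  constructor
  · rintro ⟨⟨v, rfl⟩, a, ha, hb⟩
    rw [app_tup] at ha hb
    exact ⟨v, Subtype.ext (ha.symm.trans hb), rfl⟩
  · rintro ⟨v, hv, rfl⟩
    exact ⟨⟨v, rfl⟩, _, app_tup.2 rfl, app_tup.2 (congrArg Subtype.val hv)⟩

theorem Rep.compl {S : Set (Fin n → Inner N)} (h : Rep S) : Rep Sᶜ := by
  obtain ⟨T, hT⟩ := exists_tuples N n
  obtain ⟨R, hRF, hR⟩ := h
  obtain ⟨R', hR'⟩ := separation (fun s => ¬ s ∈ₘ R) T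
  simp only [hT] at hR'
  refine ⟨R', fun F hF => hF.compl _ R R' (isNat_num n) (hRF F hF) hR', fun s => ?_⟩
  rw [hR', isTuple_iff, hR]
  constructor
  · rintro ⟨⟨v, rfl⟩, h⟩
    exact ⟨v, fun hv => h ⟨v, hv, rfl⟩, rfl⟩
  · rintro ⟨v, hv, rfl⟩
    refine ⟨⟨v, rfl⟩, ?_⟩
    rintro ⟨w, hw, e⟩
    exact hv (innerTup_injective e ▸ hw)

theorem Rep.inter {S S' : Set (Fin n → Inner N)} (h : Rep S) (h' : Rep S') : Rep (S ∩ S') := by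
  obtain ⟨R, hRF, hR⟩ := h
  obtain ⟨R', hRF', hR'⟩ := h'
  obtain ⟨R'', hR''⟩ := exists_cap R R'
  refine ⟨R'', fun F hF => hF.inter _ R R' R'' (isNat_num n) (hRF F hF) (hRF' F hF) hR'',
    fun s => ?_⟩
  rw [hR'', hR, hR']
  constructor
  · rintro ⟨⟨v, hv, rfl⟩, w, hw, e⟩
    exact ⟨v, ⟨hv, innerTup_injective e ▸ hw⟩, rfl⟩
  · rintro ⟨v, hv, rfl⟩
    exact ⟨⟨v, hv.1, rfl⟩, v, hv.2, rfl⟩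

theorem Rep.proj {S : Set (Fin (n + 1) → Inner N)} (h : Rep S) :
    Rep {v : Fin n → Inner N | ∃ a, (Fin.snoc v a : Fin (n + 1) → Inner N) ∈ S} := by
  obtain ⟨T, hT⟩ := exists_tuples N n
  obtain ⟨R, hRF, hR⟩ := h
  obtain ⟨R', hR'⟩ := separation (fun s => ∃ t, t ∈ₘ R ∧ Sub s t) T
  simp only [hT] at hR'
  refine ⟨R', fun F hF => hF.proj _ _ R R' (isNat_num n) (isSucc_iff.2 rfl) (hRF F hF) hR',
    fun s => ?_⟩
  rw [hR', isTuple_iff]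
  constructor
  · rintro ⟨⟨v, rfl⟩, t, ht, hst⟩
    obtain ⟨w, hw, rfl⟩ := (hR t).1 ht
    refine ⟨v, ⟨w (Fin.last n), ?_⟩, rfl⟩
    convert! hw
    rw [← Fin.snoc_init_self w]
    congr 1
    · ext i
      exact ((sub_tup_iff (k := 1)).1 hst i).symm
    · simp
  · rintro ⟨v, ⟨a, ha⟩, rfl⟩
    refine ⟨⟨v, rfl⟩, _, (hR _).2 ⟨_, ha, rfl⟩, (sub_tup_iff (k := 1)).2 fun i => ?_⟩
    exact congrArg Subtype.val (Fin.snoc_castSucc (α := fun _ => Inner N) a v i)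

/-- For `n = 0` there is no variable to equate, so an extra one is added and projected away; as `N`
is nonempty, this gives the full set, whose complement is taken. -/
theorem Rep.empty [hne : Nonempty (Inner N)] : Rep (∅ : Set (Fin n → Inner N)) := by
  have := (Rep.eq (N := N) (Fin.last n) (Fin.last n)).proj.compl
  convert! this
  simp

/-- The closure conditions on definability families mirror the logical operations. Only this
direction is needed: standard formulas are among the formulas of `M`. -/
theorem Rep.realize [hne : Nonempty (Inner N)] {n : ℕ} (φ : setLang.BoundedFormula Empty n) :
    Rep {v : Fin n → Inner N | φ.Realize default v} := by
  -- There are no function symbols, so every term is a variable.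
  have hvar : ∀ {n : ℕ} (t : setLang.Term (Empty ⊕ Fin n)), ∃ i : Fin n,
      ∀ v : Fin n → Inner N, t.realize (Sum.elim default v) = v i := by
    intro n t
    cases t with
    | var x =>
      rcases x with x | i
      · exact x.elim
      · exact ⟨i, fun v => rfl⟩
    | func f _ => exact nomatch f
  induction φ with
  | falsum => exact Rep.empty
  | equal t₁ t₂ =>
    obtain ⟨i, hi⟩ := hvar t₁
    obtain ⟨j, hj⟩ := hvar t₂
    convert! Rep.eq (N := N) i j using 1
    ext v
    simp [BoundedFormula.Realize, hi, hj]
  | rel r ts =>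
    cases r with
    | mem =>
      obtain ⟨i, hi⟩ := hvar (ts 0)
      obtain ⟨j, hj⟩ := hvar (ts 1)
      convert! Rep.mem (N := N) i j using 1
      ext v
      simp only [Set.mem_ofPred_eq, BoundedFormula.Realize, ← hi, ← hj]
      rfl
  | imp φ ψ ihφ ihψ =>
    convert! (ihφ.inter ihψ.compl).compl using 1
    ext v
    simp [BoundedFormula.Realize]
  | all φ ih =>
    convert! ih.compl.proj.compl using 1
    ext v
    simp [BoundedFormula.Realize]

theorem exists_rep_of_definable [hne : Nonempty (Inner N)] {k : ℕ} {S : Set (Fin k → Inner N)}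
    (hS : (Set.univ : Set (Inner N)).Definable setLang S) :
    ∃ (m : ℕ) (p : Fin m → Inner N) (S' : Set (Fin (m + k) → Inner N)), Rep S' ∧
      ∀ v, v ∈ S ↔ Fin.append p v ∈ S' := by
  obtain ⟨A, -, hA⟩ := Set.definable_iff_finitely_definable.1 hS
  obtain ⟨φ, rfl⟩ := Set.definable_iff_exists_formula_sum.1 hA
  let e := A.equivFin
  -- Parameters precede the free variables, as in `DefSets` and `DefRels`, where the parameter tuple
  -- is an initial part.
  let g : (A : Set (Inner N)) ⊕ Fin k → Empty ⊕ Fin (A.card + k) :=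
    Sum.elim (fun a => Sum.inr (Fin.castAdd k (e a))) (fun i => Sum.inr (Fin.natAdd A.card i))
  refine ⟨A.card, fun i => (e.symm i).1, _, Rep.realize (BoundedFormula.relabel g φ), fun v => ?_⟩
  simp only [Set.mem_ofPred_eq, BoundedFormula.realize_relabel, Formula.Realize]
  refine iff_of_eq (congrArg₂ _ ?_ (Subsingleton.elim _ _))
  ext x
  rcases x with a | i
  · simp [g]
  · simp [g]

theorem mem_defSets_of_definable [hne : Nonempty (Inner N)] {P : Set (Inner N)}
    (hP : (Set.univ : Set (Inner N)).Definable₁ setLang P) : Subtype.val '' P ∈ DefSets N := by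
  obtain ⟨m, p, S, ⟨R, hRF, hR⟩, hS⟩ := exists_rep_of_definable hP
  refine ⟨num M m, num M (m + 1), innerTup p, R, isNat_num m, isSucc_iff.2 rfl,
    isTuple_iff.2 ⟨p, rfl⟩, hRF, fun x => ?_⟩
  constructor
  · rintro ⟨x, hx, rfl⟩
    have := (hS fun _ => x).1 hx
    refine ⟨_, (hR _).2 ⟨_, this, rfl⟩, sub_tup_iff.2 fun i => by simp, ?_⟩
    refine (app_tup (i := Fin.natAdd m (0 : Fin 1))).2 ?_
    simp
  · rintro ⟨t, ht, hpt, hx⟩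
    obtain ⟨w, hw, rfl⟩ := (hR t).1 ht
    have hx' := (app_tup (i := Fin.natAdd m (0 : Fin 1))).1 hx
    refine ⟨w (Fin.natAdd m 0), ?_, hx'.symm⟩
    have : Fin.append p (fun _ => w (Fin.natAdd m 0)) = w := by
      ext i
      refine Fin.addCases (fun i => ?_) (fun i => ?_) i
      · rw [Fin.append_left]
        exact (sub_tup_iff.1 hpt i).symm
      · rw [Fin.append_right, Subsingleton.elim i 0]
    exact (hS fun _ => w (Fin.natAdd m 0)).2 (this.symm ▸ hw)

theorem mem_defRels_of_definable [hne : Nonempty (Inner N)] {P : Set (Inner N × Inner N)}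
    (hP : (Set.univ : Set (Inner N)).Definable₂ setLang P) :
    Prod.map Subtype.val Subtype.val '' P ∈ DefRels N := by
  obtain ⟨m, p, S, ⟨R, hRF, hR⟩, hS⟩ := exists_rep_of_definable hP
  refine ⟨num M m, num M (m + 1), num M (m + 2), innerTup p, R, isNat_num m, isSucc_iff.2 rfl,
    isSucc_iff.2 rfl, isTuple_iff.2 ⟨p, rfl⟩, hRF, fun x y => ?_⟩
  constructor
  · rintro ⟨⟨x, y⟩, hxy, he⟩
    obtain ⟨rfl, rfl⟩ := Prod.mk.inj he
    have := (hS ![x, y]).1 hxy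
    refine ⟨_, (hR _).2 ⟨_, this, rfl⟩, sub_tup_iff.2 fun i => by simp, ?_, ?_⟩
    · refine (app_tup (i := Fin.natAdd m (0 : Fin 2))).2 ?_
      simp
    · refine (app_tup (i := Fin.natAdd m (1 : Fin 2))).2 ?_
      simp
  · rintro ⟨t, ht, hpt, hx, hy⟩
    obtain ⟨w, hw, rfl⟩ := (hR t).1 ht
    have hx' := (app_tup (i := Fin.natAdd m (0 : Fin 2))).1 hx
    have hy' := (app_tup (i := Fin.natAdd m (1 : Fin 2))).1 hy
    refine ⟨(w (Fin.natAdd m 0), w (Fin.natAdd m 1)), ?_, Prod.ext hx'.symm hy'.symm⟩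
    have : Fin.append p ![w (Fin.natAdd m 0), w (Fin.natAdd m 1)] = w := by
      ext i
      refine Fin.addCases (fun i => ?_) (fun i => ?_) i
      · rw [Fin.append_left]
        exact (sub_tup_iff.1 hpt i).symm
      · rw [Fin.append_right]
        fin_cases i <;> rfl
    exact (hS ![w (Fin.natAdd m 0), w (Fin.natAdd m 1)]).2 (this.symm ▸ hw)

/-- If `M` thinks that `N` is a model of `ZFC-`, then so it is. -/
theorem InnerZFCMinus.modelZFCMinus (h : InnerZFCMinus N) : ModelZFCMinus (Inner N) := by
  have : Nonempty (Inner N) := ⟨h.infinity.choose⟩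
  exact ⟨⟨h.extensionality, h.foundation, h.pairing, h.union, h.infinity,
    fun P hP => h.separation P (mem_defSets_of_definable hP),
    fun R hR => h.replacement R (mem_defRels_of_definable hR), h.choice⟩⟩

end InnerModels

/-! ### Spread-out functions and transitive inner models. -/

section Spread

variable {M : Type u} [setLang.Structure M]

/-- On the set `w` of integers, `x` takes values in `B` and is increasing and spread by `G`. -/
def Spread (B w G x : M) : Prop :=
  (∀ i v, i ∈ₘ w → App x i v → v ∈ₘ B ∧ ∀ e g, IsEmptySet e → App G e g → g ∈ₘ v) ∧
    ∀ i j v u, i ∈ₘ w → j ∈ₘ w → IntLT i j → App x i v → App x j u →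
      v ∈ₘ u ∧ ∀ g, App G v g → g ∈ₘ u

/-- The functions `x` and `y` agree on the set `s`. -/
def Agree (s x y : M) : Prop := ∀ i, i ∈ₘ s → ∀ v, App x i v ↔ App y i v

instance DP.spread {n : ℕ} (a b c d : (Fin n → M) → M) [Tm a] [Tm b] [Tm c] [Tm d] :
    DP (fun v => Spread (a v) (b v) (c v) (d v)) :=
  DP.subst₄ (by unfold Spread; infer_instance) a b c d

instance DP.agree {n : ℕ} (a b c : (Fin n → M) → M) [Tm a] [Tm b] [Tm c] :
    DP (fun v => Agree (a v) (b v) (c v)) :=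
  DP.subst₃ (by unfold Agree; infer_instance) a b c

theorem Agree.symm {s x y : M} (h : Agree s x y) : Agree s y x :=
  fun i hi v => (h i hi v).symm

theorem Agree.trans {s x y z : M} (h : Agree s x y) (h' : Agree s y z) : Agree s x z :=
  fun i hi v => (h i hi v).trans (h' i hi v)

theorem Agree.mono {s t x y : M} (h : Agree s x y) (hst : Sub t s) : Agree t x y :=
  fun i hi => h i (hst i hi)

/-- `N` is a transitive model of `ZFC-`. -/
class InnerModel (N : M) : Prop where
  trans : IsTransSet N
  zfc : ModelZFCMinus (Inner N)

attribute [instance] InnerModel.zfc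

variable {N : M} [hN : InnerModel N]

theorem inner_forall {a : Inner N} {P : M → Prop} :
    (∀ x : Inner N, x ∈ₘ a → P x.1) ↔ ∀ x, x ∈ₘ a.1 → P x :=
  ⟨fun h x hx => h ⟨x, hN.trans _ a.2 x hx⟩ hx, fun h x hx => h x.1 hx⟩

theorem inner_isTransSet {a : Inner N} : IsTransSet a ↔ IsTransSet a.1 :=
  ⟨fun h x hx z hz => h ⟨x, hN.trans _ a.2 x hx⟩ hx
    ⟨z, hN.trans _ (hN.trans _ a.2 x hx) z hz⟩ hz, fun h x hx z hz => h x.1 hx z.1 hz⟩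

theorem inner_isOrd {a : Inner N} : IsOrd a ↔ IsOrd a.1 := by
  unfold IsOrd
  rw [inner_isTransSet, ← inner_forall]
  simp only [inner_isTransSet]

theorem IsInaccessible.isOrd {k : M} (hk : IsInaccessible k) : IsOrd k := hk.cardinal.1

/-- `N` is one of the levels `L_{ξ_n}`. -/
def Level (sX N : M) : Prop := ∃ n x, IsNat n ∧ App sX n x ∧ IsL x N

theorem inLInf_iff {sX y : M} : InLInf sX y ↔ ∃ N, Level sX N ∧ y ∈ₘ N := by
  constructor
  · rintro ⟨n, x, N, hn, hx, hN, hy⟩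
    exact ⟨N, ⟨n, x, hn, hx, hN⟩, hy⟩
  · rintro ⟨N, ⟨n, x, hn, hx, hN⟩, hy⟩
    exact ⟨n, x, N, hn, hx, hN, hy⟩

theorem space_total {k x i : M} (hx : x ∈ SpaceX k) (hi : IsInt i) : ∃ v, App x i v :=
  (hx.2 i hi).exists

end Spread

/-! ### Absoluteness between `M` and a transitive inner model. -/

section Absoluteness

variable {M : Type u} [setLang.Structure M] [hM : ModelZFCMinus M]

theorem opair_mem_transSet {N a b : M} (hN : IsTransSet N) (h : opair a b ∈ₘ N) :
    a ∈ₘ N ∧ b ∈ₘ N := by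
  have h' : upair a b ∈ₘ N := hN _ h _ (by simp [opair])
  exact ⟨hN _ h' _ (by simp), hN _ h' _ (by simp)⟩

theorem app_mem_transSet {N f x y : M} (hN : IsTransSet N) (hf : f ∈ₘ N) (h : App f x y) :
    x ∈ₘ N ∧ y ∈ₘ N :=
  opair_mem_transSet hN (hN f hf _ (app_iff.1 h))

variable {N : M} [hN : InnerModel N]

theorem ext_inner {x : Inner N} {y : M} (h : ∀ z : Inner N, z ∈ₘ x ↔ z.1 ∈ₘ y)
    (hy : Sub y N) : x.1 = y :=
  ext_eps fun z => ⟨fun hz => (h ⟨z, hN.trans _ x.2 z hz⟩).1 hz,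
    fun hz => (h ⟨z, hy z hz⟩).2 hz⟩

@[simp] theorem coe_zero : (zeroM (Inner N)).1 = zeroM M :=
  ext_inner (fun z => iff_of_false (not_eps_zero z) (not_eps_zero z.1))
    fun z hz => absurd hz (not_eps_zero z)

@[simp] theorem coe_upair (a b : Inner N) : (upair a b).1 = upair a.1 b.1 :=
  ext_inner (fun z => by simp [Subtype.ext_iff]) fun z hz => by
    rcases eps_upair.1 hz with rfl | rfl
    · exact a.2
    · exact b.2

@[simp] theorem coe_opair (a b : Inner N) : (opair a b).1 = opair a.1 b.1 := by simp [opair]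

@[simp] theorem coe_adjoin (a b : Inner N) : (adjoin a b).1 = adjoin a.1 b.1 :=
  ext_inner (fun z => by simp [Subtype.ext_iff, inner_eps]) fun z hz => by
    rcases eps_adjoin.1 hz with h | rfl
    · exact hN.trans _ a.2 z h
    · exact b.2

@[simp] theorem coe_succM (a : Inner N) : (succM a).1 = succM a.1 := coe_adjoin a a

@[simp] theorem coe_one : (oneM (Inner N)).1 = oneM M := by simp [oneM]

theorem inner_isEmptySet {a : Inner N} : IsEmptySet a ↔ IsEmptySet a.1 := by
  rw [isEmptySet_iff, isEmptySet_iff, Subtype.ext_iff, coe_zero]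

theorem inner_app {f x y : Inner N} : App f x y ↔ App f.1 x.1 y.1 := by
  rw [app_iff, app_iff, inner_eps, coe_opair]

/-- The only quantifier not bounded outright asks for a predecessor, which is an element of its
successor and hence of `N`. -/
theorem inner_isNat {n : Inner N} : IsNat n ↔ IsNat n.1 := by
  unfold IsNat
  rw [inner_isOrd]
  refine and_congr_right fun _ => ?_
  have key : ∀ m : Inner N, (IsEmptySet m ∨ ∃ k, IsSucc m k) ↔
      (IsEmptySet m.1 ∨ ∃ k, IsSucc m.1 k) := by
    intro m
    rw [inner_isEmptySet]
    refine or_congr_right ⟨?_, ?_⟩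
    · rintro ⟨k, hk⟩
      rw [isSucc_iff] at hk
      exact ⟨k.1, isSucc_iff.2 (by rw [hk, coe_succM])⟩
    · rintro ⟨k, hk⟩
      rw [isSucc_iff] at hk
      have hkN : k ∈ₘ N := hN.trans _ m.2 k (by rw [hk]; simp)
      exact ⟨⟨k, hkN⟩, isSucc_iff.2 (Subtype.ext (by rw [hk, coe_succM]))⟩
  constructor
  · rintro h m (rfl | hm)
    · exact (key n).1 (h n (Or.inl rfl))
    · exact (key ⟨m, hN.trans _ n.2 m hm⟩).1 (h _ (Or.inr hm))
  · rintro h m (rfl | hm)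
    · exact (key m).2 (h m.1 (Or.inl rfl))
    · exact (key m).2 (h m.1 (Or.inr hm))

theorem inner_intLT {z w : Inner N} : IntLT z w ↔ IntLT z.1 w.1 := by
  rw [intLT_iff, intLT_iff]
  constructor
  · rintro ⟨n, m, hn, hm, h⟩
    refine ⟨n.1, m.1, inner_isNat.1 hn, inner_isNat.1 hm, ?_⟩
    simpa [Subtype.ext_iff, inner_eps] using h
  · rintro ⟨n, m, hn, hm, h⟩
    have key : ∀ (o n : M) (z : Inner N), z.1 = opair o n → n ∈ₘ N := fun o n z hz =>
      (opair_mem_transSet hN.trans (hz ▸ z.2)).2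
    have hnN : n ∈ₘ N := by
      rcases h with h | h | h <;> exact key _ n z h.1
    have hmN : m ∈ₘ N := by
      rcases h with h | h | h
      · exact key _ m w h.2.1
      · exact key _ m w h.2
      · exact key _ m w h.2.1
    refine ⟨⟨n, hnN⟩, ⟨m, hmN⟩, inner_isNat.2 hn, inner_isNat.2 hm, ?_⟩
    simpa [Subtype.ext_iff, inner_eps] using h

theorem inner_agree {s x y : Inner N} : Agree s x y ↔ Agree s.1 x.1 y.1 := by
  constructor
  · intro h i hi v
    constructor
    · intro hv
      have := app_mem_transSet hN.trans x.2 hv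
      exact inner_app.1 ((h ⟨i, this.1⟩ hi ⟨v, this.2⟩).1 (inner_app.2 hv))
    · intro hv
      have := app_mem_transSet hN.trans y.2 hv
      exact inner_app.1 ((h ⟨i, this.1⟩ hi ⟨v, this.2⟩).2 (inner_app.2 hv))
  · intro h i hi v
    rw [inner_app, inner_app]
    exact h i.1 hi v.1

/-- Every object quantified over is an argument or a value of `x` or `G`, so it lies in `N` by
transitivity. -/
theorem inner_spread {B w G x : Inner N} : Spread B w G x ↔ Spread B.1 w.1 G.1 x.1 := by
  constructor
  · rintro ⟨h1, h2⟩
    refine ⟨fun i v hi hv => ?_, fun i j v u hi hj hij hv hu => ?_⟩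
    · have hm := app_mem_transSet hN.trans x.2 hv
      obtain ⟨h3, h4⟩ := h1 ⟨i, hm.1⟩ ⟨v, hm.2⟩ hi (inner_app.2 hv)
      refine ⟨h3, fun e g he hg => ?_⟩
      have hm' := app_mem_transSet hN.trans G.2 hg
      exact h4 ⟨e, hm'.1⟩ ⟨g, hm'.2⟩ (inner_isEmptySet.2 he) (inner_app.2 hg)
    · have hm := app_mem_transSet hN.trans x.2 hv
      have hm' := app_mem_transSet hN.trans x.2 hu
      obtain ⟨h3, h4⟩ := h2 ⟨i, hm.1⟩ ⟨j, hm'.1⟩ ⟨v, hm.2⟩ ⟨u, hm'.2⟩ hi hj (inner_intLT.2 hij)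
        (inner_app.2 hv) (inner_app.2 hu)
      refine ⟨h3, fun g hg => ?_⟩
      have hm'' := app_mem_transSet hN.trans G.2 hg
      exact h4 ⟨g, hm''.2⟩ (inner_app.2 hg)
  · rintro ⟨h1, h2⟩
    refine ⟨fun i v hi hv => ?_, fun i j v u hi hj hij hv hu => ?_⟩
    · obtain ⟨h3, h4⟩ := h1 i.1 v.1 hi (inner_app.1 hv)
      exact ⟨h3, fun e g he hg => h4 e.1 g.1 (inner_isEmptySet.1 he) (inner_app.1 hg)⟩
    · obtain ⟨h3, h4⟩ := h2 i.1 j.1 v.1 u.1 hi hj (inner_intLT.1 hij) (inner_app.1 hv)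
        (inner_app.1 hu)
      exact ⟨h3, fun g hg => h4 g.1 (inner_app.1 hg)⟩

/-- Finite subsets of an inner model belong to it. -/
theorem IsFin.mem_inner {s : M} (hs : IsFin s) (hsN : Sub s N) : s ∈ₘ N := by
  refine fin_induction (fun s => s ∈ₘ N) hs ?_ fun c i _ hi hc => ?_
  · rw [← coe_zero (N := N)]
    exact (zeroM (Inner N)).2
  · have := (IntUltrapower.adjoin (⟨c, hc⟩ : Inner N) ⟨i, hsN i hi⟩).2
    rwa [coe_adjoin] at this

/-- The values of a function in an inner model may be changed in a definable way. -/
theorem exists_modified (R : Inner N → Inner N → Inner N → Prop)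
    [h : DP (fun v : Fin 3 → Inner N => R (v 0) (v 1) (v 2))] {f : M} (hf : f ∈ₘ N) {d c c' : Set M}
    (hfun : IsFun f d c) (hR : ∀ x v, App f x.1 v.1 → ∃! w, R x v w)
    (hc : ∀ x v w, App f x.1 v.1 → R x v w → w.1 ∈ c') :
    ∃ g, g ∈ₘ N ∧ IsFun g d c' ∧
      ∀ x v w : Inner N, App f x.1 v.1 → (App g x.1 w.1 ↔ R x v w) := by
  have hR' : ∀ {n : ℕ} (a b c : (Fin n → Inner N) → Inner N) [Tm a] [Tm b] [Tm c],
      DP fun v => R (a v) (b v) (c v) := fun a b c _ _ _ => DP.subst₃ h a b c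
  -- Replacement in `N` acts on the pairs in `f`, sending `⟨x, v⟩` to `⟨x, w⟩`. So the class `d`
  -- need not be known in `N`.
  obtain ⟨g, hg⟩ := replacement (M := Inner N)
    (fun p q => ∃ x v w, IsOPair p x v ∧ IsOPair q x w ∧ R x v w) ⟨f, hf⟩ (by
      rintro p hp q q' ⟨x, v, w, h1, h2, h3⟩ ⟨x', v', w', h1', h2', h3'⟩
      rw [isOPair_iff] at h1 h2 h1' h2'
      subst h1
      obtain ⟨rfl, rfl⟩ := opair_inj.1 h1'
      rw [h2, h2', (hR x v (inner_app.1 (app_iff.2 hp))).unique h3 h3'])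
  have key : ∀ x v w : Inner N, App f x.1 v.1 → (App g.1 x.1 w.1 ↔ R x v w) := by
    intro x v w hv
    rw [← inner_app, app_iff, hg]
    constructor
    · rintro ⟨p, hp, x', v', w', h1, h2, h3⟩
      rw [isOPair_iff] at h1 h2
      obtain ⟨rfl, rfl⟩ := opair_inj.1 h2
      rw [h1] at hp
      have := hfun.unique hv ((inner_app (f := ⟨f, hf⟩)).1 (app_iff.2 hp))
      rwa [Subtype.ext this]
    · intro hw
      exact ⟨opair x v, app_iff.1 ((inner_app (f := ⟨f, hf⟩)).2 hv), x, v, w, isOPair_iff.2 rfl,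
        isOPair_iff.2 rfl, hw⟩
  refine ⟨g.1, g.2, ⟨fun q hq => ?_, fun x hx => ?_⟩, key⟩
  · have hqN := hN.trans _ g.2 q hq
    obtain ⟨p, hp, x, v, w, h1, h2, h3⟩ := (hg ⟨q, hqN⟩).1 hq
    rw [isOPair_iff] at h1 h2
    subst h1
    have hv : App f x.1 v.1 := (inner_app (f := ⟨f, hf⟩)).1 (app_iff.2 hp)
    exact ⟨x.1, hfun.dom hv, w.1, hc x v w hv h3, isOPair_iff.2 (by
      rw [← coe_opair, ← h2])⟩
  · obtain ⟨v, hv⟩ := (hfun.2 x hx).exists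
    have hm := app_mem_transSet hN.trans hf hv
    obtain ⟨w, hw, hu⟩ := hR ⟨x, hm.1⟩ ⟨v, hm.2⟩ hv
    refine ⟨w.1, (key ⟨x, hm.1⟩ ⟨v, hm.2⟩ w hv).2 hw, fun y hy => ?_⟩
    have hm' := app_mem_transSet hN.trans g.2 hy
    exact congrArg Subtype.val (hu ⟨y, hm'.2⟩ ((key ⟨x, hm.1⟩ ⟨v, hm.2⟩ ⟨y, hm'.2⟩ hv).1 hy))

/-- The identity function of a set of an inner model. -/
theorem exists_identity {a : M} (ha : a ∈ₘ N) : ∃ g, g ∈ₘ N ∧ IsFun g (els a) (els a) := by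
  obtain ⟨g, hg⟩ := replacement (M := Inner N) (fun x p => IsOPair p x x) ⟨a, ha⟩
    (fun x _ p q hp hq => (isOPair_iff.1 hp).trans (isOPair_iff.1 hq).symm)
  refine ⟨g.1, g.2, fun p hp => ?_, fun x hx => ?_⟩
  · obtain ⟨x, hx, hp⟩ := (hg ⟨p, hN.trans _ g.2 p hp⟩).1 hp
    refine ⟨x.1, hx, x.1, hx, isOPair_iff.2 ?_⟩
    rw [← coe_opair, ← isOPair_iff.1 hp]
  · have hxN : x ∈ₘ N := hN.trans _ ha x hx
    refine ⟨x, ?_, fun y hy => ?_⟩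
    · exact (inner_app (x := ⟨x, hxN⟩) (y := ⟨x, hxN⟩)).1
        (app_iff.2 ((hg _).2 ⟨⟨x, hxN⟩, hx, isOPair_iff.2 rfl⟩))
    · have hyN := (app_mem_transSet hN.trans g.2 hy).2
      obtain ⟨z, _, hz⟩ := (hg _).1 (app_iff.1
        ((inner_app (x := ⟨x, hxN⟩) (y := ⟨y, hyN⟩)).2 hy))
      rw [isOPair_iff, opair_inj] at hz
      exact congrArg Subtype.val (hz.2.trans hz.1.symm)

/-- The second summand of a disjoint union in an inner model belongs to it. -/
theorem IsCoded.mem_inner {C A B : M} (h : IsCoded C A B) (hC : C ∈ₘ N) : B ∈ₘ N := by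
  -- `B` is recovered as the set of `y` with `⟨1, y⟩ ∈ C`; since `0 ≠ 1`, the first summand does not
  -- interfere.
  obtain ⟨b, hb⟩ := replacement (M := Inner N) (fun p y => IsOPair p (oneM (Inner N)) y) ⟨C, hC⟩
    (fun p _ y z hy hz => (opair_inj.1 ((isOPair_iff.1 hy).symm.trans (isOPair_iff.1 hz))).2)
  have key : ∀ y, y ∈ₘ B ↔ opair (oneM M) y ∈ₘ C := by
    intro y
    rw [h]
    simp only [isEmptySet_iff, isOne_iff, isOPair_iff, opair_inj]
    constructor
    · exact fun hy => Or.inr ⟨_, y, rfl, hy, rfl, rfl⟩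
    · rintro (⟨e, a, rfl, _, he, _⟩ | ⟨o, y, rfl, hy, _, rfl⟩)
      · exact absurd he.symm zero_ne_one
      · exact hy
  have : b.1 = B := ext_inner (fun z => by
    rw [hb, key]
    constructor
    · rintro ⟨p, hp, hpz⟩
      rw [isOPair_iff] at hpz
      subst hpz
      simpa [inner_eps] using hp
    · intro hz
      exact ⟨opair (oneM (Inner N)) z, by simpa [inner_eps] using hz, isOPair_iff.2 rfl⟩)
    fun z hz => (opair_mem_transSet hN.trans (hN.trans _ hC _ ((key z).1 hz))).2
  exact this ▸ b.2

end Absoluteness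

/-! ### The cardinal `k`, the space of functions and the sequences of the construction. -/

section Construction

variable {M : Type u} [setLang.Structure M] [hM : ModelZFCMinus M]

/-! ### The cardinal `k` -/

variable {k : M}

/-- Regularity bounds the constant function with value `a` on `ω`, and the bound exceeds `a`. -/
theorem IsInaccessible.exists_gt (hk : IsInaccessible k) {a : M} (ha : a ∈ₘ k) :
    ∃ b, b ∈ₘ k ∧ a ∈ₘ b := by
  obtain ⟨w, hw, hw'⟩ := hk.uncountable
  obtain ⟨f, hf, hf'⟩ := exists_isFun (fun _ y => y = a) w (els k)
    (fun _ _ => ⟨a, rfl, fun _ h => h⟩) (by rintro x _ _ rfl; exact ha)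
  obtain ⟨b, hb, hb'⟩ := hk.regular w f hw hf
  exact ⟨b, hb, hb' (zeroM M) a ((hf' _ _).2 ⟨(hw' _).2 isNat_zero, rfl⟩)⟩

theorem IsInaccessible.zero_eps (hk : IsInaccessible k) : zeroM M ∈ₘ k := by
  obtain ⟨w, hw, _⟩ := hk.uncountable
  rcases zero_eps_or_eq hk.isOrd with h | h
  · exact absurd (h ▸ hw) (not_eps_zero w)
  · exact h

theorem IsInaccessible.exists_gt_gt (hk : IsInaccessible k) {a b : M} (ha : a ∈ₘ k)
    (hb : b ∈ₘ k) : ∃ c, c ∈ₘ k ∧ a ∈ₘ c ∧ b ∈ₘ c := by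
  obtain ⟨c, hc, hac⟩ := hk.exists_gt ha
  obtain ⟨d, hd, hbd⟩ := hk.exists_gt hb
  rcases ord_trichotomy (hk.isOrd.of_eps hc) (hk.isOrd.of_eps hd) with h | rfl | h
  · exact ⟨d, hd, (hk.isOrd.of_eps hd).trans h hac, hbd⟩
  · exact ⟨c, hc, hac, hbd⟩
  · exact ⟨c, hc, hac, (hk.isOrd.of_eps hc).trans h hbd⟩

/-- A subset of `k` that has cardinality `k` is unbounded. -/
theorem IsInaccessible.unbounded (hk : IsInaccessible k) {B f a : M} (hB : Sub B k)
    (hf : IsBijection f B k) (ha : a ∈ₘ k) : ∃ v, v ∈ₘ B ∧ a ∈ₘ v := by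
  by_contra! hno
  obtain ⟨b, hb, hab⟩ := hk.exists_gt ha
  have hbo := hk.isOrd.of_eps hb
  have hBb : ∀ v, v ∈ₘ B → v ∈ₘ b := fun v hv => by
    rcases ord_trichotomy (hk.isOrd.of_eps (hB v hv)) (hk.isOrd.of_eps ha) with h | rfl | h
    · exact hbo.trans hab h
    · exact hab
    · exact absurd h (hno v hv)
  -- As `B ⊆ b`, the bijection extends by zero to `b`. By regularity its values lie below some `c <
  -- k`, but `c` is itself a value.
  obtain ⟨g, hg, hg'⟩ := exists_isFun
    (fun x y => (x ∈ₘ B ∧ App f x y) ∨ (¬ x ∈ₘ B ∧ IsEmptySet y)) b (els k) (by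
      intro x _
      by_cases hx : x ∈ₘ B
      · obtain ⟨y, hy, hu⟩ := hf.1.1.2 x hx
        exact ⟨y, Or.inl ⟨hx, hy⟩, fun z hz => hu z (hz.resolve_right fun h => h.1 hx).2⟩
      · exact ⟨zeroM M, Or.inr ⟨hx, not_eps_zero⟩, fun z hz =>
          isEmptySet_iff.1 (hz.resolve_left fun h => hx h.1).2⟩) (by
      rintro x y _ (⟨_, h⟩ | ⟨_, h⟩)
      · exact hf.1.1.cod h
      · exact isEmptySet_iff.1 h ▸ hk.zero_eps)
  obtain ⟨c, hc, hc'⟩ := hk.regular b g hb hg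
  obtain ⟨x, hx⟩ := hf.2 c hc
  have hxB : x ∈ₘ B := hf.1.1.dom hx
  exact eps_irrefl c (hc' x c ((hg' x c).2 ⟨hBb x hxB, Or.inl ⟨hxB, hx⟩⟩))

/-! ### Elements of the space -/

/-- Two tagged copies of `ω`, which is a set because it is an element of `k`. -/
theorem IsInaccessible.exists_ints (hk : IsInaccessible k) : ∃ Z : M, ∀ z, z ∈ₘ Z ↔ IsInt z := by
  obtain ⟨w, _, hw⟩ := hk.uncountable
  obtain ⟨a, ha⟩ := replacement (fun n z => IsIntNonneg z n) w (fun n _ y z hy hz => by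
    rw [isIntNonneg_iff] at hy hz
    exact hy.2.trans hz.2.symm)
  obtain ⟨b, hb⟩ := replacement (fun n z => IsIntNeg z n) w (fun n _ y z hy hz => by
    rw [isIntNeg_iff] at hy hz
    exact hy.2.trans hz.2.symm)
  refine ⟨cup a b, fun z => ?_⟩
  rw [eps_cup, ha, hb]
  constructor
  · rintro (⟨n, _, h⟩ | ⟨n, _, h⟩)
    · exact ⟨n, Or.inl h⟩
    · exact ⟨n, Or.inr h⟩
  · rintro ⟨n, h | h⟩
    · exact Or.inl ⟨n, (hw n).2 h.1, h⟩
    · exact Or.inr ⟨n, (hw n).2 h.1, h⟩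

theorem IsInaccessible.exists_mem_spaceX (hk : IsInaccessible k) (R : M → M → Prop)
    [DP (fun v : Fin 2 → M => R (v 0) (v 1))] (hR : ∀ i, IsInt i → ∃! v, R i v)
    (hR' : ∀ i v, IsInt i → R i v → v ∈ₘ k) :
    ∃ x ∈ SpaceX k, ∀ i v, App x i v ↔ IsInt i ∧ R i v := by
  obtain ⟨Z, hZ⟩ := hk.exists_ints
  obtain ⟨x, hx, hx'⟩ := exists_isFun R Z (els k) (fun i hi => hR i ((hZ i).1 hi))
    (fun i v hi => hR' i v ((hZ i).1 hi))
  have : els Z = {z | IsInt z} := Set.ext hZ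
  rw [this] at hx
  exact ⟨x, hx, fun i v => by rw [hx', hZ]⟩

theorem space_dom {x i v : M} (hx : x ∈ SpaceX k) (hv : App x i v) : IsInt i :=
  IsFun.dom (d := {z | IsInt z}) (c := els k) hx hv

theorem space_cod {x i v : M} (hx : x ∈ SpaceX k) (hv : App x i v) : v ∈ₘ k :=
  IsFun.cod (d := {z | IsInt z}) (c := els k) hx hv

theorem space_unique {x i u v : M} (hx : x ∈ SpaceX k) (hu : App x i u) (hv : App x i v) :
    u = v :=
  IsFun.unique (d := {z | IsInt z}) (c := els k) hx hu hv

theorem value_isOrd (hk : IsInaccessible k) {x i v : M} (hx : x ∈ SpaceX k) (hv : App x i v) :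
    IsOrd v :=
  hk.isOrd.of_eps (space_cod hx hv)

/-- The function that agrees with `x` up to `e` and with `y` beyond `e`. -/
theorem IsInaccessible.exists_splice (hk : IsInaccessible k) {x y : M} (hx : x ∈ SpaceX k)
    (hy : y ∈ SpaceX k) (e : M) : ∃ z ∈ SpaceX k, ∀ i v, App z i v ↔
      (IntLE i e ∧ App x i v) ∨ (¬ IntLE i e ∧ App y i v) := by
  obtain ⟨z, hz, hz'⟩ := hk.exists_mem_spaceX
    (fun i v => (IntLE i e ∧ App x i v) ∨ (¬ IntLE i e ∧ App y i v)) (by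
      intro i hi
      by_cases h : IntLE i e
      · simpa [h] using hx.2 i hi
      · simpa [h] using hy.2 i hi) (by
      rintro i v _ (⟨_, h⟩ | ⟨_, h⟩)
      · exact space_cod hx h
      · exact space_cod hy h)
  refine ⟨z, hz, fun i v => (hz' i v).trans (and_iff_right_of_imp ?_)⟩
  rintro (⟨_, h⟩ | ⟨_, h⟩)
  · exact space_dom hx h
  · exact space_dom hy h

/-- Only pairs straddling the cut need the extra hypothesis; all other conditions are inherited from
`x` or from `y`. -/
theorem Spread.splice {B w G x y z e : M} (hx : Spread B w G x)
    (hy : Spread B w G y) (hw : ∀ i, i ∈ₘ w → IsInt i) (he : IsInt e)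
    (hz : ∀ i v, App z i v ↔ (IntLE i e ∧ App x i v) ∨ (¬ IntLE i e ∧ App y i v))
    (hxy : ∀ i j v u, i ∈ₘ w → j ∈ₘ w → IntLE i e → IntLT e j → App x i v → App y j u →
      v ∈ₘ u ∧ ∀ g, App G v g → g ∈ₘ u) : Spread B w G z := by
  refine ⟨fun i v hi hv => ?_, fun i j v u hi hj hij hv hu => ?_⟩
  · rcases (hz i v).1 hv with ⟨_, h⟩ | ⟨_, h⟩
    · exact hx.1 i v hi h
    · exact hy.1 i v hi h
  · rcases (hz i v).1 hv with ⟨hie, h⟩ | ⟨hie, h⟩ <;> rcases (hz j u).1 hu with ⟨hje, h'⟩ | ⟨hje, h'⟩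
    · exact hx.2 i j v u hi hj hij h h'
    · refine hxy i j v u hi hj hie ?_ h h'
      by_contra hej
      exact hje (intLE_of_not_lt he (hw j hj) hej)
    · exact absurd (IntLE.trans (Or.inr hij) hje) hie
    · exact hy.2 i j v u hi hj hij h h'

/-- There are spread-out functions with arbitrarily large values. -/
theorem IsInaccessible.exists_spread (hk : IsInaccessible k) {B w G a : M} (hBk : Sub B k)
    (hB : ∀ a, a ∈ₘ k → ∃ v, v ∈ₘ B ∧ a ∈ₘ v) (hw : IsFin w) (hwi : ∀ i, i ∈ₘ w → IsInt i)
    (hG : IsFun G (els k) (els k)) (ha : a ∈ₘ k) :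
    ∃ y ∈ SpaceX k, Spread B w G y ∧ ∀ i v, i ∈ₘ w → App y i v → a ∈ₘ v := by
  -- The induction carries a bound `b` on the values so far and on their images under `G`. Integers
  -- are adjoined in increasing order, so a next value above `b` suffices.
  have := fin_int_induction (fun c => ∃ y b, y ∈ SpaceX k ∧ b ∈ₘ k ∧ Spread B c G y ∧
    ∀ i v, i ∈ₘ c → App y i v → a ∈ₘ v ∧ v ∈ₘ b ∧ ∀ g, App G v g → g ∈ₘ b) hw hwi ?_ ?_
  · obtain ⟨y, b, hy, _, hs, h⟩ := this
    exact ⟨y, hy, hs, fun i v hi hv => (h i v hi hv).1⟩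
  · obtain ⟨y, hy, _⟩ := hk.exists_mem_spaceX (fun _ v => v = zeroM M)
      (fun _ _ => ⟨_, rfl, fun _ h => h⟩) (by rintro i v _ rfl; exact hk.zero_eps)
    exact ⟨y, zeroM M, hy, hk.zero_eps, ⟨fun i _ hi => absurd hi (not_eps_zero i),
      fun i _ _ _ hi => absurd hi (not_eps_zero i)⟩, fun i _ hi => absurd hi (not_eps_zero i)⟩
  · rintro c i hcw hiw hlt ⟨y, b, hy, hb, hs, h⟩
    obtain ⟨g₀, hg₀⟩ := (hG.2 (zeroM M) hk.zero_eps).exists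
    -- The next value `v ∈ B` is taken above `a`, `b` and `G(0)`.
    obtain ⟨d, hd, had, hbd⟩ := hk.exists_gt_gt ha hb
    obtain ⟨d', hd', hdd', hgd'⟩ := hk.exists_gt_gt hd (hG.cod hg₀)
    obtain ⟨v, hvB, hv⟩ := hB d' hd'
    have hvo := hk.isOrd.of_eps (hBk v hvB)
    have hbv : b ∈ₘ v := hvo.trans (hvo.trans hv hdd') hbd
    have hav : a ∈ₘ v := hvo.trans (hvo.trans hv hdd') had
    have hgv : g₀ ∈ₘ v := hvo.trans hv hgd'
    obtain ⟨g, hg⟩ := (hG.2 v (hBk v hvB)).exists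
    obtain ⟨b', hb', hvb', hgb'⟩ := hk.exists_gt_gt (hBk v hvB) (hG.cod hg)
    have hbo' := hk.isOrd.of_eps hb'
    have hbb' : b ∈ₘ b' := hbo'.trans hvb' hbv
    obtain ⟨y', hy', hyy'⟩ := hk.exists_mem_spaceX
      (fun j u => (j = i ∧ u = v) ∨ (¬ j = i ∧ App y j u)) (by
        intro j hj
        by_cases hji : j = i
        · simp [hji]
        · simpa [hji] using hy.2 j hj) (by
        rintro j u _ (⟨_, rfl⟩ | ⟨_, h⟩)
        · exact hBk _ hvB
        · exact space_cod hy h)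
    have hnew : ∀ u, App y' i u → u = v := fun u hu => by
      rcases ((hyy' i u).1 hu).2 with h | h
      · exact h.2
      · exact absurd rfl h.1
    have hold : ∀ j u, j ∈ₘ c → App y' j u → App y j u := fun j u hj hu => by
      rcases ((hyy' j u).1 hu).2 with h | h
      · exact absurd (h.1 ▸ hlt j hj) IntLT.irrefl
      · exact h.2
    refine ⟨y', b', hy', hb', ⟨fun j u hj hu => ?_, fun j l u u' hj hl hjl hu hu' => ?_⟩,
      fun j u hj hu => ?_⟩
    · rcases eps_adjoin.1 hj with hj | rfl
      · exact hs.1 j u hj (hold j u hj hu)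
      · rw [hnew u hu]
        refine ⟨hvB, fun e g' he hg' => ?_⟩
        rw [isEmptySet_iff.1 he] at hg'
        rwa [hG.unique hg' hg₀]
    · rcases eps_adjoin.1 hj with hj | hj <;> rcases eps_adjoin.1 hl with hl | hl
      · exact hs.2 j l u u' hj hl hjl (hold j u hj hu) (hold l u' hl hu')
      · rw [hnew u' (hl ▸ hu')]
        obtain ⟨_, h1, h2⟩ := h j u hj (hold j u hj hu)
        exact ⟨hvo.trans hbv h1, fun g hg => hvo.trans hbv (h2 g hg)⟩
      · exact absurd hjl (hj ▸ (hlt l hl).asymm)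
      · exact absurd hjl (hj ▸ hl ▸ IntLT.irrefl)
    · rcases eps_adjoin.1 hj with hj | rfl
      · obtain ⟨h1, h2, h3⟩ := h j u hj (hold j u hj hu)
        exact ⟨h1, hbo'.trans hbb' h2, fun g hg => hbo'.trans hbb' (h3 g hg)⟩
      · rw [hnew u hu]
        exact ⟨hav, hvb', fun g' hg' => by rwa [hG.unique hg' hg]⟩

/-- On a finite set, the values of `x` and of `G` at these are bounded. -/
theorem IsInaccessible.exists_bound (hk : IsInaccessible k) {w G x : M} (hw : IsFin w)
    (hG : IsFun G (els k) (els k)) (hx : x ∈ SpaceX k) :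
    ∃ b, b ∈ₘ k ∧ ∀ i v, i ∈ₘ w → App x i v → v ∈ₘ b ∧ ∀ g, App G v g → g ∈ₘ b := by
  refine fin_induction (fun w => ∃ b, b ∈ₘ k ∧ ∀ i v, i ∈ₘ w → App x i v →
    v ∈ₘ b ∧ ∀ g, App G v g → g ∈ₘ b) hw ⟨zeroM M, hk.zero_eps,
      fun i _ hi => absurd hi (not_eps_zero i)⟩ ?_
  rintro c i _ _ ⟨b, hb, h⟩
  by_cases hi : IsInt i
  · obtain ⟨v, hv⟩ := (hx.2 i hi).exists
    have hvk := space_cod hx hv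
    obtain ⟨g, hg⟩ := (hG.2 v hvk).exists
    obtain ⟨d, hd, hvd, hgd⟩ := hk.exists_gt_gt hvk (hG.cod hg)
    obtain ⟨b', hb', hbb', hdb'⟩ := hk.exists_gt_gt hb hd
    have hbo' := hk.isOrd.of_eps hb'
    refine ⟨b', hb', fun j u hj hu => ?_⟩
    rcases eps_adjoin.1 hj with hj | rfl
    · obtain ⟨h1, h2⟩ := h j u hj hu
      exact ⟨hbo'.trans hbb' h1, fun g hg => hbo'.trans hbb' (h2 g hg)⟩
    · rw [space_unique hx hu hv]
      refine ⟨hbo'.trans hdb' hvd, fun g' hg' => ?_⟩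
      rw [hG.unique hg' hg]
      exact hbo'.trans hdb' hgd
  · refine ⟨b, hb, fun j u hj hu => ?_⟩
    rcases eps_adjoin.1 hj with hj | rfl
    · exact h j u hj hu
    · exact absurd (space_dom hx hu) hi

/-- If `G(v) ≤ G'(v) < u` with `u` an ordinal, then `G(v) < u`. This is what gives basic sets common
refinements. -/
theorem Spread.mono (hk : IsInaccessible k) {B B' w w' G G' x : M} (hx : x ∈ SpaceX k)
    (h : Spread B' w' G' x) (hB : Sub B' B) (hw : Sub w w') (hG' : IsFun G' (els k) (els k))
    (hGG' : ∀ v g g', App G v g → App G' v g' → g = g' ∨ g ∈ₘ g') : Spread B w G x := by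
  have key : ∀ v g u, IsOrd u → v ∈ₘ k → App G v g → (∀ g', App G' v g' → g' ∈ₘ u) → g ∈ₘ u := by
    intro v g u hu hv hg hg'
    obtain ⟨g', h'⟩ := (hG'.2 v hv).exists
    rcases hGG' v g g' hg h' with rfl | h2
    · exact hg' g h'
    · exact hu.trans (hg' g' h') h2
  refine ⟨fun i v hi hv => ?_, fun i j v u hi hj hij hv hu => ?_⟩
  · obtain ⟨h1, h2⟩ := h.1 i v (hw i hi) hv
    refine ⟨hB v h1, fun e g he hg => ?_⟩
    exact key e g v (value_isOrd hk hx hv) (isEmptySet_iff.1 he ▸ hk.zero_eps) hg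
      fun g' => h2 e g' he
  · obtain ⟨h1, h2⟩ := h.2 i j v u (hw i hi) (hw j hj) hij hv hu
    exact ⟨h1, fun g hg => key v g u (value_isOrd hk hx hu) (space_cod hx hv) hg h2⟩

/-! ### Consequences of the construction -/

variable {A₀ sA sB sX : M}

theorem IsOmegaConstruction.xi (hC : IsOmegaConstruction k A₀ sA sB sX) {n x : M} (hn : IsNat n)
    (hx : App sX n x) : IsOrd x ∧ ∃ A N, App sA n A ∧ IsL x N ∧ A ∈ₘ N ∧ InnerZFCMinus N := by
  obtain ⟨A, hA⟩ := (hC.seqA.2 n hn).exists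
  rcases hn.zero_or_succ with rfl | ⟨m, hm, rfl⟩
  · obtain ⟨h1, _, ⟨N, h2, h3, h4⟩, _⟩ := hC.zeroX _ _ not_eps_zero hx
    exact ⟨h1, A₀, N, hC.zeroA _ not_eps_zero, h2, h3, h4⟩
  · obtain ⟨y, hy⟩ := (hC.seqX.2 m hm).exists
    obtain ⟨h1, _, ⟨N, h2, h3, h4⟩, _⟩ := hC.succX m _ y A x hm (isSucc_iff.2 rfl) hy hA hx
    exact ⟨h1, A, N, hA, h2, h3, h4⟩

theorem IsOmegaConstruction.xi_mono (hC : IsOmegaConstruction k A₀ sA sB sX) {n : M}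
    (hn : IsNat n) : ∀ m, m ∈ₘ n → ∀ x y, App sX m x → App sX n y → x ∈ₘ y := by
  refine nat_induction (fun n => ∀ m, m ∈ₘ n → ∀ x y, App sX m x → App sX n y → x ∈ₘ y)
    (fun m hm => absurd hm (not_eps_zero m)) ?_ n hn
  intro n hn ih m hm x y hx hy
  obtain ⟨z, hz⟩ := (hC.seqX.2 n hn).exists
  obtain ⟨A, hA⟩ := (hC.seqA.2 _ hn.succM).exists
  obtain ⟨h1, h2, _⟩ := hC.succX n _ z A y hn (isSucc_iff.2 rfl) hz hA hy
  rcases eps_succM.1 hm with hm | rfl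
  · exact h1.trans h2 (ih m hm x z hx hz)
  · rwa [hC.seqX.unique hx hz]

theorem IsOmegaConstruction.innerModel (hC : IsOmegaConstruction k A₀ sA sB sX) {N : M}
    (hN : Level sX N) : InnerModel N := by
  obtain ⟨n, x, hn, hx, hL⟩ := hN
  obtain ⟨_, A, N', _, hL', _, hZ⟩ := hC.xi hn hx
  -- Monotonicity in both directions makes the level with a given index unique.
  have : N = N' := ext_eps fun z =>
    ⟨hL.mono hL' (Or.inl rfl) z, hL'.mono hL (Or.inl rfl) z⟩
  subst this
  exact ⟨hL.transitive, hZ.modelZFCMinus⟩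

theorem IsOmegaConstruction.level_directed (hC : IsOmegaConstruction k A₀ sA sB sX) {N N' : M}
    (hN : Level sX N) (hN' : Level sX N') : Sub N N' ∨ Sub N' N := by
  obtain ⟨n, x, hn, hx, hL⟩ := hN
  obtain ⟨n', x', hn', hx', hL'⟩ := hN'
  rcases ord_trichotomy hn.1 hn'.1 with h | rfl | h
  · exact Or.inl (hL.mono hL' (Or.inr (hC.xi_mono hn' _ h _ _ hx hx')))
  · exact Or.inl (hL.mono hL' (Or.inl (hC.seqX.unique hx hx')))
  · exact Or.inr (hL'.mono hL (Or.inr (hC.xi_mono hn _ h _ _ hx' hx)))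

theorem IsOmegaConstruction.exists_level₂ (hC : IsOmegaConstruction k A₀ sA sB sX) {a b : M}
    (ha : InLInf sX a) (hb : InLInf sX b) : ∃ N, Level sX N ∧ a ∈ₘ N ∧ b ∈ₘ N := by
  obtain ⟨N, hN, ha⟩ := inLInf_iff.1 ha
  obtain ⟨N', hN', hb⟩ := inLInf_iff.1 hb
  rcases hC.level_directed hN hN' with h | h
  · exact ⟨N', hN', h a ha, hb⟩
  · exact ⟨N, hN, ha, h b hb⟩

theorem IsOmegaConstruction.exists_level₃ (hC : IsOmegaConstruction k A₀ sA sB sX) {a b c : M}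
    (ha : InLInf sX a) (hb : InLInf sX b) (hc : InLInf sX c) :
    ∃ N, Level sX N ∧ a ∈ₘ N ∧ b ∈ₘ N ∧ c ∈ₘ N := by
  obtain ⟨N, hN, ha, hb⟩ := hC.exists_level₂ ha hb
  obtain ⟨N', hN', hc⟩ := inLInf_iff.1 hc
  rcases hC.level_directed hN hN' with h | h
  · exact ⟨N', hN', h a ha, h b hb, hc⟩
  · exact ⟨N, hN, ha, hb, h c hc⟩

/-- `B_m` is coded into `A_{m+1}`, an element of `L_{ξ_{m+1}}`. -/
theorem IsOmegaConstruction.inLInf_B (hC : IsOmegaConstruction k A₀ sA sB sX) {m B : M}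
    (hm : IsNat m) (hB : App sB m B) : InLInf sX B := by
  obtain ⟨x, hx⟩ := (hC.seqX.2 _ hm.succM).exists
  obtain ⟨_, C, N, hCm, hL, hCN, _⟩ := hC.xi hm.succM hx
  obtain ⟨A, hA⟩ := (hC.seqA.2 m hm).exists
  have hN : Level sX N := ⟨_, x, hm.succM, hx, hL⟩
  have := hC.innerModel hN
  exact inLInf_iff.2 ⟨N, hN, (hC.succA m _ A B C hm (isSucc_iff.2 rfl) hA hB hCm).mem_inner hCN⟩

theorem IsOmegaConstruction.B_anti (hC : IsOmegaConstruction k A₀ sA sB sX) {n : M}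
    (hn : IsNat n) : ∀ m, m = n ∨ m ∈ₘ n → ∀ B B', App sB m B → App sB n B' → Sub B' B := by
  refine nat_induction
    (fun n => ∀ m, m = n ∨ m ∈ₘ n → ∀ B B', App sB m B → App sB n B' → Sub B' B) ?_ ?_ n hn
  · rintro m (rfl | hm) B B' hB hB'
    · rw [hC.seqB.unique hB hB']
      exact fun _ h => h
    · exact absurd hm (not_eps_zero m)
  · rintro n hn ih m hm B B' hB hB'
    rcases hm with rfl | hm
    · rw [hC.seqB.unique hB hB']
      exact fun _ h => h
    obtain ⟨D, hD⟩ := (hC.seqB.2 n hn).exists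
    obtain ⟨x, hx⟩ := (hC.seqX.2 n hn).exists
    have hsub := (hC.succB n _ x D B' hn (isSucc_iff.2 rfl) hx hD hB').1
    exact fun z hz => ih m (eps_succM.1 hm).symm B D hB hD z (hsub z hz)

theorem IsOmegaConstruction.B_sub (hC : IsOmegaConstruction k A₀ sA sB sX) {n B : M}
    (hn : IsNat n) (hB : App sB n B) : Sub B k :=
  hC.B_anti hn (zeroM M) ((zero_eps_or_eq hn.1).imp_left Eq.symm) k B (hC.zeroB _ not_eps_zero) hB

theorem IsOmegaConstruction.B_unbounded (hC : IsOmegaConstruction k A₀ sA sB sX)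
    (hk : IsInaccessible k) {n B : M} (hn : IsNat n) (hB : App sB n B) {a : M} (ha : a ∈ₘ k) :
    ∃ v, v ∈ₘ B ∧ a ∈ₘ v := by
  rcases hn.zero_or_succ with rfl | ⟨m, hm, rfl⟩
  · rw [hC.seqB.unique hB (hC.zeroB _ not_eps_zero)]
    exact hk.exists_gt ha
  · obtain ⟨D, hD⟩ := (hC.seqB.2 m hm).exists
    obtain ⟨x, hx⟩ := (hC.seqX.2 m hm).exists
    obtain ⟨_, ⟨f, hf⟩, _⟩ := hC.succB m _ x D B hm (isSucc_iff.2 rfl) hx hD hB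
    exact hk.unbounded (hC.B_sub hn hB) hf ha

/-- A basic set asks for spread only at the least element and between neighbours. Since the values
increase, these inequalities propagate to all elements and all pairs. -/
theorem IsOmegaConstruction.mem_basicSet_iff (hC : IsOmegaConstruction k A₀ sA sB sX)
    (hk : IsInaccessible k) {w m B G x : M} (hw : IsFin w) (hwi : ∀ i, i ∈ₘ w → IsInt i)
    (hB : App sB m B) : x ∈ BasicSet k sB w m G ↔ x ∈ SpaceX k ∧ Spread B w G x := by
  have hval : x ∈ SpaceX k → ∀ i, i ∈ₘ w → ∃ v, App x i v := fun hx i hi =>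
    (hx.2 i (hwi i hi)).exists
  constructor
  · rintro ⟨hx, h1, h2, h3, h4⟩
    refine ⟨hx, fun i v hi hv => ⟨h2 i v B hi hv hB, fun e g he hg => ?_⟩,
      fun i j v u hi hj hij hv hu => ⟨h1 i j v u hi hj hij hv hu, fun g hg => ?_⟩⟩
    · obtain ⟨⟨a, ha, hmin⟩, _⟩ := hw.exists_min_max hwi ⟨i, hi⟩
      obtain ⟨u, hu⟩ := hval hx a ha
      have hgu : g ∈ₘ u := h3 a u e g ha (fun j hj => (hmin j hj).not_lt) hu he hg
      rcases hmin i hi with rfl | hai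
      · rwa [space_unique hx hv hu]
      · exact (value_isOrd hk hx hv).trans (h1 a i u v ha hi hai hu hv) hgu
    · obtain ⟨c, hc⟩ := separation (fun l => IntLT i l) w
      have hcw : Sub c w := fun z hz => ((hc z).1 hz).1
      obtain ⟨⟨l, hl, hmin⟩, _⟩ := (hw.subset hcw).exists_min_max (fun i h => hwi i (hcw i h))
        ⟨j, (hc j).2 ⟨hj, hij⟩⟩
      obtain ⟨hlw, hil⟩ := (hc l).1 hl
      obtain ⟨u', hu'⟩ := hval hx l hlw
      have hgu : g ∈ₘ u' := h4 i l v u' g hi hlw hil (fun p hp ⟨hip, hpl⟩ =>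
        (hmin p ((hc p).2 ⟨hp, hip⟩)).not_lt hpl) hv hu' hg
      rcases hmin j ((hc j).2 ⟨hj, hij⟩) with rfl | hlj
      · rwa [space_unique hx hu hu']
      · exact (value_isOrd hk hx hu).trans (h1 l j u' u hlw hj hlj hu' hu) hgu
  · rintro ⟨hx, h1, h2⟩
    refine ⟨hx, fun i j v u hi hj hij hv hu => (h2 i j v u hi hj hij hv hu).1,
      fun i v B' hi hv hB' => ?_, fun i v e g hi _ hv he hg => (h1 i v hi hv).2 e g he hg,
      fun i j v u g hi hj hij _ hv hu hg => (h2 i j v u hi hj hij hv hu).2 g hg⟩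
    rw [hC.seqB.unique hB' hB]
    exact (h1 i v hi hv).1

end Construction

/-! ### Agreement on a basic set, as an equivalence relation. -/

section Equivalence

variable {M : Type u} [setLang.Structure M] [hM : ModelZFCMinus M]

variable {k A₀ sA sB sX A : M}

/-- `w`, `B`, `G` determine a basic set of measure one. -/
structure IsBasis (k sB sX w B G : M) : Prop where
  fin : IsFin w
  int : ∀ i, i ∈ₘ w → IsInt i
  index : ∃ m, IsNat m ∧ App sB m B
  isFun : IsFun G (els k) (els k)
  inLInf : InLInf sX G

/-- Two functions in `L_{ξ_∞}` have a common upper bound. -/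
theorem IsOmegaConstruction.exists_sup (hC : IsOmegaConstruction k A₀ sA sB sX)
    (hk : IsInaccessible k) {G₁ G₂ : M} (h₁ : IsFun G₁ (els k) (els k)) (h₁' : InLInf sX G₁)
    (h₂ : IsFun G₂ (els k) (els k)) (h₂' : InLInf sX G₂) :
    ∃ G, IsFun G (els k) (els k) ∧ InLInf sX G ∧
      (∀ v g g', App G₁ v g → App G v g' → g = g' ∨ g ∈ₘ g') ∧
      ∀ v g g', App G₂ v g → App G v g' → g = g' ∨ g ∈ₘ g' := by
  obtain ⟨N, hN, h₁N, h₂N⟩ := hC.exists_level₂ h₁' h₂'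
  have := hC.innerModel hN
  let G₂' : Inner N := ⟨G₂, h₂N⟩
  -- `G` is the pointwise maximum, formed in a level that contains both functions.
  obtain ⟨G, hGN, hG, hG'⟩ := exists_modified (N := N) (c' := els k)
    (fun v g₁ g => ∃ g₂, App G₂' v g₂ ∧ ((g₁ ∈ₘ g₂ ∧ g = g₂) ∨ (¬ g₁ ∈ₘ g₂ ∧ g = g₁))) h₁N h₁
    (by
      intro v g₁ hv
      obtain ⟨g₂, hg₂⟩ := (h₂.2 v.1 (h₁.dom hv)).exists
      let g₂' : Inner N := ⟨g₂, (app_mem_transSet InnerModel.trans h₂N hg₂).2⟩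
      have hu : ∀ g : Inner N, App G₂' v g → g = g₂' := fun g hg =>
        Subtype.ext (h₂.unique (inner_app.1 hg) hg₂)
      by_cases hlt : g₁ ∈ₘ g₂'
      · refine ⟨g₂', ⟨g₂', inner_app.2 hg₂, Or.inl ⟨hlt, rfl⟩⟩, ?_⟩
        rintro g ⟨g', hg', h | h⟩
        · exact h.2.trans (hu g' hg')
        · exact absurd (hu g' hg' ▸ hlt) h.1
      · refine ⟨g₁, ⟨g₂', inner_app.2 hg₂, Or.inr ⟨hlt, rfl⟩⟩, ?_⟩
        rintro g ⟨g', hg', h | h⟩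
        · exact absurd (hu g' hg' ▸ h.1) hlt
        · exact h.2)
    (by
      rintro v g₁ g hv ⟨g₂, hg₂, ⟨_, rfl⟩ | ⟨_, rfl⟩⟩
      · exact h₂.cod (inner_app.1 hg₂)
      · exact h₁.cod hv)
  have key : ∀ v g, App G v g → ∃ g₁ g₂, App G₁ v g₁ ∧ App G₂ v g₂ ∧
      ((g₁ ∈ₘ g₂ ∧ g = g₂) ∨ (¬ g₁ ∈ₘ g₂ ∧ g = g₁)) := by
    intro v g hg
    obtain ⟨g₁, hg₁⟩ := (h₁.2 v (hG.dom hg)).exists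
    have hm := app_mem_transSet InnerModel.trans hGN hg
    have hm₁ := app_mem_transSet InnerModel.trans h₁N hg₁
    obtain ⟨g₂, hg₂, h⟩ := (hG' ⟨v, hm.1⟩ ⟨g₁, hm₁.2⟩ ⟨g, hm.2⟩ hg₁).1 hg
    refine ⟨g₁, g₂.1, hg₁, inner_app.1 hg₂, ?_⟩
    simpa [Subtype.ext_iff, inner_eps] using h
  refine ⟨G, hG, inLInf_iff.2 ⟨N, hN, hGN⟩, fun v g g' hg hg' => ?_, fun v g g' hg hg' => ?_⟩
  · obtain ⟨g₁, g₂, hg₁, hg₂, ⟨h, rfl⟩ | ⟨_, rfl⟩⟩ := key v g' hg'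
    · exact Or.inr (h₁.unique hg₁ hg ▸ h)
    · exact Or.inl (h₁.unique hg hg₁)
  · obtain ⟨g₁, g₂, hg₁, hg₂, ⟨_, rfl⟩ | ⟨h, rfl⟩⟩ := key v g' hg'
    · exact Or.inl (h₂.unique hg hg₂)
    · rw [h₂.unique hg hg₂]
      rcases ord_trichotomy (hk.isOrd.of_eps (h₁.cod hg₁)) (hk.isOrd.of_eps (h₂.cod hg₂)) with
        h' | h' | h'
      · exact absurd h' h
      · exact Or.inl h'.symm
      · exact Or.inr h'

/-- Take `w` empty, `B = B_0 = k` and the identity for `G`. Reflexivity of the equivalence rests on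
this. -/
theorem IsOmegaConstruction.exists_isBasis (hC : IsOmegaConstruction k A₀ sA sB sX) :
    ∃ w B G, IsBasis k sB sX w B G := by
  have hB := hC.zeroB _ (not_eps_zero (M := M))
  obtain ⟨N, hN, hkN⟩ := inLInf_iff.1 (hC.inLInf_B isNat_zero hB)
  have := hC.innerModel hN
  obtain ⟨G, hGN, hG⟩ := exists_identity hkN
  exact ⟨zeroM M, k, G, isFin_zero, fun i hi => absurd hi (not_eps_zero i),
    ⟨zeroM M, isNat_zero, hB⟩, hG, inLInf_iff.2 ⟨N, hN, hGN⟩⟩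

/-- Allows `w` to contain the two supports under comparison. -/
theorem IsBasis.enlarge (hk : IsInaccessible k) {w B G t : M} (h : IsBasis k sB sX w B G)
    (ht : IsFin t) (hti : ∀ i, i ∈ₘ t → IsInt i) :
    IsBasis k sB sX (cup w t) B G ∧ ∀ x ∈ SpaceX k, Spread B (cup w t) G x → Spread B w G x := by
  refine ⟨⟨h.fin.cup ht, fun i hi => ?_, h.index, h.isFun, h.inLInf⟩, fun x hx hs => ?_⟩
  · rcases eps_cup.1 hi with hi | hi
    · exact h.int i hi
    · exact hti i hi
  · exact hs.mono hk hx (fun _ h => h) (fun _ h => eps_cup.2 (Or.inl h)) h.isFun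
      fun v g g' hg hg' => Or.inl (h.isFun.unique hg hg')

/-- Two basic sets contain a third one. -/
theorem IsOmegaConstruction.exists_inter (hC : IsOmegaConstruction k A₀ sA sB sX)
    (hk : IsInaccessible k) {w₁ B₁ G₁ w₂ B₂ G₂ : M} (h₁ : IsBasis k sB sX w₁ B₁ G₁)
    (h₂ : IsBasis k sB sX w₂ B₂ G₂) : ∃ w B G, IsBasis k sB sX w B G ∧
      ∀ x ∈ SpaceX k, Spread B w G x → Spread B₁ w₁ G₁ x ∧ Spread B₂ w₂ G₂ x := by
  obtain ⟨G, hG, hG', hG₁, hG₂⟩ := hC.exists_sup hk h₁.isFun h₁.inLInf h₂.isFun h₂.inLInf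
  obtain ⟨m₁, hm₁, hB₁⟩ := h₁.index
  obtain ⟨m₂, hm₂, hB₂⟩ := h₂.index
  obtain ⟨m, B, hm, hB, hs₁, hs₂⟩ : ∃ m B, IsNat m ∧ App sB m B ∧ Sub B B₁ ∧ Sub B B₂ := by
    rcases ord_trichotomy hm₁.1 hm₂.1 with h | rfl | h
    · exact ⟨m₂, B₂, hm₂, hB₂, hC.B_anti hm₂ m₁ (Or.inr h) B₁ B₂ hB₁ hB₂, fun _ h => h⟩
    · exact ⟨m₁, B₂, hm₂, hB₂, hC.B_anti hm₂ m₁ (Or.inl rfl) B₁ B₂ hB₁ hB₂, fun _ h => h⟩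
    · exact ⟨m₁, B₁, hm₁, hB₁, fun _ h => h, hC.B_anti hm₁ m₂ (Or.inr h) B₂ B₁ hB₂ hB₁⟩
  have hw : ∀ i, i ∈ₘ cup w₁ w₂ → IsInt i := fun i hi => by
    rcases eps_cup.1 hi with hi | hi
    · exact h₁.int i hi
    · exact h₂.int i hi
  refine ⟨cup w₁ w₂, B, G, ⟨h₁.fin.cup h₂.fin, hw, ⟨m, hm, hB⟩, hG, hG'⟩, fun x hx hs => ⟨?_, ?_⟩⟩
  · exact hs.mono hk hx hs₁ (fun _ h => eps_cup.2 (Or.inl h)) hG hG₁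
  · exact hs.mono hk hx hs₂ (fun _ h => eps_cup.2 (Or.inr h)) hG hG₂

/-- The set on which two functions agree is measurable. -/
theorem IsOmegaConstruction.isMeasurable (hC : IsOmegaConstruction k A₀ sA sB sX) {f g : M}
    (hf : f ∈ FunClass k sX A) (hg : g ∈ FunClass k sX A) :
    IsMeasurable k sX {x | x ∈ SpaceX k ∧ ∀ v, App f x v ↔ App g x v} := by
  obtain ⟨N, hN, hfN, hgN⟩ := hC.exists_level₂ hf.1 hg.1
  have := hC.innerModel hN
  let g' : Inner N := ⟨g, hgN⟩
  -- The characteristic function arises from `f` by changing the value `v` at `x` to 1 if `g(x) = v`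
  -- and to 0 otherwise. It is supported by the union of the two supports.
  obtain ⟨c, hcN, hc, hc'⟩ := exists_modified (N := N) (c' := els (succM (oneM M)))
    (fun x v w => (App g' x v ∧ w = oneM (Inner N)) ∨ (¬ App g' x v ∧ w = zeroM (Inner N)))
    hfN hf.2.1 (by
      intro x v _
      by_cases h : App g' x v <;> simp [h]) (by
      rintro x v w _ (⟨_, rfl⟩ | ⟨_, rfl⟩)
      · simp [els]
      · simp [els, oneM])
  have key : ∀ x ∈ SpaceX k, ∀ w, App c x w ↔ ((∀ v, App f x v ↔ App g x v) ∧ w = oneM M) ∨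
      (¬ (∀ v, App f x v ↔ App g x v) ∧ w = zeroM M) := by
    intro x hx w
    obtain ⟨v, hv⟩ := (hf.2.1.2 x hx).exists
    have hm := app_mem_transSet InnerModel.trans hfN hv
    have hP : (∀ v, App f x v ↔ App g x v) ↔ App g x v := by
      refine ⟨fun h => (h v).1 hv, fun h u => ⟨fun hu => ?_, fun hu => ?_⟩⟩
      · rwa [hf.2.1.unique hu hv]
      · rwa [hg.2.1.unique hu h]
    have h := fun w => hc' ⟨x, hm.1⟩ ⟨v, hm.2⟩ w hv
    simp only [Subtype.ext_iff, inner_app, coe_one, coe_zero] at h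
    rw [hP]
    constructor
    · intro hw
      exact (h ⟨w, (app_mem_transSet InnerModel.trans hcN hw).2⟩).1 hw
    · rintro (⟨h', rfl⟩ | ⟨h', rfl⟩)
      · rw [← coe_one (N := N)]
        exact (h _).2 (Or.inl ⟨h', coe_one⟩)
      · rw [← coe_zero (N := N)]
        exact (h _).2 (Or.inr ⟨h', coe_zero⟩)
  obtain ⟨s, hs, hsi, hs'⟩ := hf.2.2
  obtain ⟨t, ht, hti, ht'⟩ := hg.2.2
  refine ⟨c, _, _, isTwo_iff.2 rfl, isOne_iff.2 rfl, ⟨inLInf_iff.2 ⟨N, hN, hcN⟩, hc, cup s t,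
    hs.cup ht, fun i hi => ?_, fun x hx y hy hxy v => ?_⟩, fun x hx => ?_⟩
  · rcases eps_cup.1 hi with hi | hi
    · exact hsi i hi
    · exact hti i hi
  · have h1 := hs' x hx y hy fun i hi => hxy i (eps_cup.2 (Or.inl hi))
    have h2 := ht' x hx y hy fun i hi => hxy i (eps_cup.2 (Or.inr hi))
    rw [key x hx, key y hy]
    simp only [h1, h2]
  · rw [key x hx]
    simp [hx, zero_ne_one.symm]

/-- The set of agreement is always measurable, so only the inclusion of a basic set remains. -/
theorem IsOmegaConstruction.equivalent_iff (hC : IsOmegaConstruction k A₀ sA sB sX)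
    (hk : IsInaccessible k) {f g : M} (hf : f ∈ FunClass k sX A) (hg : g ∈ FunClass k sX A) :
    Equivalent k sB sX f g ↔ ∃ w B G, IsBasis k sB sX w B G ∧
      ∀ x ∈ SpaceX k, Spread B w G x → ∀ v, App f x v ↔ App g x v := by
  constructor
  · rintro ⟨_, _, w, m, G, hw, hwi, hm, hG, hG', hsub⟩
    obtain ⟨B, hB⟩ := (hC.seqB.2 m hm).exists
    exact ⟨w, B, G, ⟨hw, hwi, ⟨m, hm, hB⟩, hG, hG'⟩, fun x hx hs =>
      (hsub ((hC.mem_basicSet_iff hk hw hwi hB).2 ⟨hx, hs⟩)).2⟩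
  · rintro ⟨w, B, G, ⟨hw, hwi, ⟨m, hm, hB⟩, hG, hG'⟩, h⟩
    refine ⟨fun x hx => hx.1, hC.isMeasurable hf hg, w, m, G, hw, hwi, hm, hG, hG',
      fun x hx => ?_⟩
    obtain ⟨h1, h2⟩ := (hC.mem_basicSet_iff hk hw hwi hB).1 hx
    exact ⟨h1, h x h1 h2⟩

theorem IsOmegaConstruction.equivalent_refl (hC : IsOmegaConstruction k A₀ sA sB sX)
    (hk : IsInaccessible k) {f : M} (hf : f ∈ FunClass k sX A) : Equivalent k sB sX f f := by
  obtain ⟨w, B, G, h⟩ := hC.exists_isBasis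
  exact (hC.equivalent_iff hk hf hf).2 ⟨w, B, G, h, fun _ _ _ _ => Iff.rfl⟩

theorem IsOmegaConstruction.equivalent_symm (hC : IsOmegaConstruction k A₀ sA sB sX)
    (hk : IsInaccessible k) {f g : M} (hf : f ∈ FunClass k sX A) (hg : g ∈ FunClass k sX A)
    (h : Equivalent k sB sX f g) : Equivalent k sB sX g f := by
  rw [hC.equivalent_iff hk hf hg] at h
  obtain ⟨w, B, G, hb, h⟩ := h
  exact (hC.equivalent_iff hk hg hf).2 ⟨w, B, G, hb, fun x hx hs v => (h x hx hs v).symm⟩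

theorem IsOmegaConstruction.equivalent_trans (hC : IsOmegaConstruction k A₀ sA sB sX)
    (hk : IsInaccessible k) {f g h : M} (hf : f ∈ FunClass k sX A) (hg : g ∈ FunClass k sX A)
    (hh : h ∈ FunClass k sX A) (hfg : Equivalent k sB sX f g) (hgh : Equivalent k sB sX g h) :
    Equivalent k sB sX f h := by
  rw [hC.equivalent_iff hk hf hg] at hfg
  rw [hC.equivalent_iff hk hg hh] at hgh
  obtain ⟨w₁, B₁, G₁, hb₁, h₁⟩ := hfg
  obtain ⟨w₂, B₂, G₂, hb₂, h₂⟩ := hgh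
  obtain ⟨w, B, G, hb, hs⟩ := hC.exists_inter hk hb₁ hb₂
  exact (hC.equivalent_iff hk hf hh).2 ⟨w, B, G, hb, fun x hx hx' v =>
    (h₁ x hx (hs x hx hx').1 v).trans (h₂ x hx (hs x hx hx').2 v)⟩

theorem IsOmegaConstruction.eqClass_eq_iff (hC : IsOmegaConstruction k A₀ sA sB sX)
    (hk : IsInaccessible k) {f g : M} (hf : f ∈ FunClass k sX A) (hg : g ∈ FunClass k sX A) :
    eqClass k sB sX A f = eqClass k sB sX A g ↔ Equivalent k sB sX f g := by
  constructor
  · intro h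
    have : g ∈ eqClass k sB sX A g := ⟨hg, hC.equivalent_refl hk hg⟩
    rw [← h] at this
    exact this.2
  · intro h
    ext x
    refine and_congr_right fun hx => ⟨fun h' => ?_, fun h' => ?_⟩
    · exact hC.equivalent_trans hk hg hf hx (hC.equivalent_symm hk hf hg h) h'
    · exact hC.equivalent_trans hk hf hg hx h h'

end Equivalence

/-! ### Intersections of block supports, and the minimum. -/

section MinimumSupport

variable {M : Type u} [setLang.Structure M] [hM : ModelZFCMinus M]

variable {k A₀ sA sB sX A : M}

/-- If `f` and `f'` agree on a basic set and have convex supports `s` and `t`, with a point of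
`s \ t` below a point of `t \ s`, then on the basic set `f` depends only on the restriction to
`s ∩ t`. -/
theorem depends_on_cap_of_lt (hC : IsOmegaConstruction k A₀ sA sB sX) (hk : IsInaccessible k)
    {f f' s t w B G i₀ j₀ : M} (hs : FinConvex s) (ht : FinConvex t)
    (hfs : IsFunSupport k f s) (hft : IsFunSupport k f' t) (hb : IsBasis k sB sX w B G)
    (hsw : Sub s w)
    (heq : ∀ x ∈ SpaceX k, Spread B w G x → ∀ v, App f x v ↔ App f' x v)
    (hi₀ : i₀ ∈ₘ s) (hi₀' : ¬ i₀ ∈ₘ t) (hj₀ : j₀ ∈ₘ t) (hj₀' : ¬ j₀ ∈ₘ s) (hlt : IntLT i₀ j₀)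
    {x y : M} (hx : x ∈ SpaceX k) (hy : y ∈ SpaceX k) (hxs : Spread B w G x)
    (hys : Spread B w G y) (hxy : Agree (cap s t) x y) (v : M) : App f x v ↔ App f y v := by
  -- A point of `s` above `j₀` would enclose `j₀` together with `i₀`, forcing `j₀ ∈ s`. The bound on
  -- `t` is dual.
  have hsj : ∀ i, i ∈ₘ s → IntLT i j₀ := fun i hi => by
    rcases int_trichotomy (hs.2.1 i hi) (ht.2.1 j₀ hj₀) with h | rfl | h
    · exact h
    · exact absurd hi hj₀'
    · exact absurd (hs.2.2 i₀ i j₀ hi₀ hi hlt h) hj₀'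
  have hti : ∀ j, j ∈ₘ t → IntLT i₀ j := fun j hj => by
    rcases int_trichotomy (hs.2.1 i₀ hi₀) (ht.2.1 j hj) with h | rfl | h
    · exact h
    · exact absurd hj hi₀'
    · exact absurd (ht.2.2 j j₀ i₀ hj hj₀ h hlt) hi₀'
  by_cases hne : ∃ e, e ∈ₘ s ∧ e ∈ₘ t
  · obtain ⟨e, hes, het⟩ := hne
    have he := hs.2.1 e hes
    obtain ⟨z, hz, hz'⟩ := hk.exists_splice hx hy e
    have hzs : Spread B w G z := by
      refine hxs.splice hys hb.int he hz' fun i j v u hi hj hie hej hv hu => ?_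
      -- The common value `a = x(e) = y(e)` bridges the cut: `x(i) ≤ a < y(j)`, and likewise
      -- `G(x(i)) < y(j)`.
      obtain ⟨a, ha⟩ := space_total hx he
      have ha' := (hxy e (eps_cap.2 ⟨hes, het⟩) a).1 ha
      obtain ⟨h1, h2⟩ := hys.2 e j a u (hsw e hes) hj hej ha' hu
      rcases hie with rfl | hie
      · rw [space_unique hx hv ha]
        exact ⟨h1, h2⟩
      · have huo := value_isOrd hk hy hu
        obtain ⟨h3, h4⟩ := hxs.2 i e v a hi (hsw e hes) hie hv ha
        exact ⟨huo.trans h1 h3, fun g hg => huo.trans h1 (h4 g hg)⟩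
    have hxz : Agree s x z := by
      intro i hi u
      rw [hz']
      by_cases h : IntLE i e
      · simp [h]
      · have hei : IntLT e i := by
          by_contra h'
          exact h (intLE_of_not_lt he (hs.2.1 i hi) h')
        -- Points of `s` beyond `e` lie between `e` and `j₀`, hence in `t`, where `x` and `y` agree.
        simpa [h] using hxy i (eps_cap.2 ⟨hi, ht.2.2 e j₀ i het hj₀ hei (hsj i hi)⟩) u
    have hzy : Agree t z y := by
      intro i hi u
      rw [hz']
      by_cases h : IntLE i e
      · have his : i ∈ₘ s := by
          rcases h with rfl | h
          · exact hes
          · exact hs.2.2 i₀ e i hi₀ hes (hti i hi) h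
        simpa [h] using hxy i (eps_cap.2 ⟨his, hi⟩) u
      · simp [h]
    rw [hfs.2.2 x hx z hz hxz v, heq z hz hzs v, hft.2.2 z hz y hy hzy v, heq y hy hys v]
  -- With disjoint blocks the cut is at the maximum of `s`, and all of `t` lies beyond it.
  · obtain ⟨_, e, hes, hmax⟩ := hs.1.exists_min_max hs.2.1 ⟨i₀, hi₀⟩
    have he := hs.2.1 e hes
    have hte : ∀ j, j ∈ₘ t → ¬ IntLE j e := by
      rintro j hj (rfl | h)
      · exact hne ⟨j, hes, hj⟩
      · exact hne ⟨j, hs.2.2 i₀ e j hi₀ hes (hti j hj) h, hj⟩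
    obtain ⟨b₁, hb₁, hxb⟩ := hk.exists_bound hb.fin hb.isFun hx
    obtain ⟨b₂, hb₂, hyb⟩ := hk.exists_bound hb.fin hb.isFun hy
    obtain ⟨b, hbk, hb₁b, hb₂b⟩ := hk.exists_gt_gt hb₁ hb₂
    obtain ⟨m, hm, hB⟩ := hb.index
    -- The values of `q` on `w` exceed the bounds for both `x` and `y`, so either can be continued
    -- by `q`; the common value is `f'(q)`.
    obtain ⟨q, hq, hqs, hqb⟩ := hk.exists_spread (hC.B_sub hm hB)
      (fun a ha => hC.B_unbounded hk hm hB ha) hb.fin hb.int hb.isFun hbk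
    have key : ∀ x ∈ SpaceX k, Spread B w G x → ∀ b', b' ∈ₘ b →
        (∀ i v, i ∈ₘ w → App x i v → v ∈ₘ b' ∧ ∀ g, App G v g → g ∈ₘ b') →
        (App f x v ↔ App f' q v) := by
      intro x hx hxs b' hb' hxb
      obtain ⟨z, hz, hz'⟩ := hk.exists_splice hx hq e
      have hzs : Spread B w G z := by
        refine hxs.splice hqs hb.int he hz' fun i j v u hi hj _ _ hv hu => ?_
        have huo := value_isOrd hk hq hu
        have hbu := huo.trans (hqb j u hj hu) hb'
        obtain ⟨h1, h2⟩ := hxb i v hi hv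
        exact ⟨huo.trans hbu h1, fun g hg => huo.trans hbu (h2 g hg)⟩
      have hxz : Agree s x z := fun i hi u => by simp [hz', hmax i hi]
      have hzq : Agree t z q := fun i hi u => by simp [hz', hte i hi]
      rw [hfs.2.2 x hx z hz hxz v, heq z hz hzs v, hft.2.2 z hz q hq hzq v]
    rw [key x hx hxs b₁ hb₁b hxb, key y hy hys b₂ hb₂b hyb]

/-- If `f` and `f'` agree on a basic set and have convex supports `s` and `t`, then on the basic
set `f` depends only on the restriction to `s ∩ t`. -/
theorem depends_on_cap (hC : IsOmegaConstruction k A₀ sA sB sX) (hk : IsInaccessible k)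
    {f f' s t w B G : M} (hs : FinConvex s) (ht : FinConvex t)
    (hfs : IsFunSupport k f s) (hft : IsFunSupport k f' t) (hb : IsBasis k sB sX w B G)
    (hsw : Sub s w) (htw : Sub t w)
    (heq : ∀ x ∈ SpaceX k, Spread B w G x → ∀ v, App f x v ↔ App f' x v)
    {x y : M} (hx : x ∈ SpaceX k) (hy : y ∈ SpaceX k) (hxs : Spread B w G x)
    (hys : Spread B w G y) (hxy : Agree (cap s t) x y) (v : M) : App f x v ↔ App f y v := by
  -- For nested blocks the intersection is the smaller one, which is already a support.
  by_cases hst : Sub s t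
  · exact hfs.2.2 x hx y hy (hxy.mono fun i hi => eps_cap.2 ⟨hi, hst i hi⟩) v
  by_cases hts : Sub t s
  · rw [heq x hx hxs, heq y hy hys]
    exact hft.2.2 x hx y hy (hxy.mono fun i hi => eps_cap.2 ⟨hts i hi, hi⟩) v
  unfold Sub at hst hts
  push Not at hst hts
  obtain ⟨i₀, hi₀, hi₀'⟩ := hst
  obtain ⟨j₀, hj₀, hj₀'⟩ := hts
  rcases int_trichotomy (hs.2.1 i₀ hi₀) (ht.2.1 j₀ hj₀) with h | rfl | h
  · exact depends_on_cap_of_lt hC hk hs ht hfs hft hb hsw heq hi₀ hi₀' hj₀ hj₀' h hx hy hxs hys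
      hxy v
  · exact absurd hj₀ hi₀'
  · rw [heq x hx hxs, heq y hy hys]
    exact depends_on_cap_of_lt hC hk ht hs hft hfs hb htw
      (fun x hx hxs v => (heq x hx hxs v).symm) hj₀ hj₀' hi₀ hi₀' h hx hy hxs hys
      (hxy.mono fun i hi => eps_cap.2 (eps_cap.1 hi).symm) v

/-- A function that on a basic set depends only on the restriction to `u` is equal on that set to
one with support `u`. -/
theorem exists_funSupport (hC : IsOmegaConstruction k A₀ sA sB sX) (hk : IsInaccessible k)
    {f u w B G : M} (hf : f ∈ FunClass k sX A) (hb : IsBasis k sB sX w B G) (hu : IsFin u)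
    (huw : Sub u w)
    (hdep : ∀ x ∈ SpaceX k, ∀ y ∈ SpaceX k, Spread B w G x → Spread B w G y → Agree u x y →
      ∀ v, App f x v ↔ App f y v) :
    ∃ g ∈ FunClass k sX A, Equivalent k sB sX f g ∧ IsFunSupport k g u := by
  obtain ⟨m, hm, hB⟩ := hb.index
  obtain ⟨N, hN, hfN, hBN, hGN⟩ := hC.exists_level₃ hf.1 (hC.inLInf_B hm hB) hb.inLInf
  have := hC.innerModel hN
  -- Any point of the space would do as `q`. It provides the default value `v₀ = f(q)`, which lies
  -- in both `A` and `N`, and it shows that the integers in `w` belong to `N`.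
  obtain ⟨q, hq, _⟩ := hk.exists_spread (hC.B_sub hm hB)
    (fun a ha => hC.B_unbounded hk hm hB ha) hb.fin hb.int hb.isFun hk.zero_eps
  obtain ⟨v₀, hv₀⟩ := (hf.2.1.2 q hq).exists
  have hqN := app_mem_transSet InnerModel.trans hfN hv₀
  have hwN : Sub w N := fun i hi => by
    obtain ⟨v, hv⟩ := space_total hq (hb.int i hi)
    exact (app_mem_transSet InnerModel.trans hqN.1 hv).1
  let f' : Inner N := ⟨f, hfN⟩
  let B' : Inner N := ⟨B, hBN⟩
  let G' : Inner N := ⟨G, hGN⟩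
  let w' : Inner N := ⟨w, hb.fin.mem_inner hwN⟩
  let u' : Inner N := ⟨u, hu.mem_inner fun i hi => hwN i (huw i hi)⟩
  let v' : Inner N := ⟨v₀, hqN.2⟩
  -- The whole space lies in `N`, since every `x` occurs in a pair of `f ∈ N`.
  have hdom : ∀ x, x ∈ SpaceX k → x ∈ₘ N := fun x hx => by
    obtain ⟨v, hv⟩ := (hf.2.1.2 x hx).exists
    exact (app_mem_transSet InnerModel.trans hfN hv).1
  -- The new value at `x` is `f(y)` for any `y` in the basic set that agrees with `x` on `u`, and
  -- `v₀` if there is none.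
  let R : M → M → Prop := fun x v =>
    (∃ y ∈ SpaceX k, Spread B w G y ∧ Agree u x y ∧ App f y v) ∨
      ((¬ ∃ y ∈ SpaceX k, Spread B w G y ∧ Agree u x y) ∧ v = v₀)
  -- Inside `N`, membership in the space is expressed as being in the domain of `f`.
  have hR : ∀ x v : Inner N,
      ((∃ y, Spread B' w' G' y ∧ Agree u' x y ∧ App f' y v) ∨
      ((¬ ∃ y a, App f' y a ∧ Spread B' w' G' y ∧ Agree u' x y) ∧ v = v')) ↔ R x.1 v.1 := by
    intro x v
    simp only [inner_spread, inner_agree, inner_app, Subtype.ext_iff]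
    refine or_congr ⟨?_, ?_⟩ (and_congr_left fun _ => not_congr ⟨?_, ?_⟩)
    · rintro ⟨y, h1, h2, h3⟩
      exact ⟨y.1, hf.2.1.dom h3, h1, h2, h3⟩
    · rintro ⟨y, hy, h⟩
      exact ⟨⟨y, hdom y hy⟩, h⟩
    · rintro ⟨y, a, h1, h2⟩
      exact ⟨y.1, hf.2.1.dom h1, h2⟩
    · rintro ⟨y, hy, h⟩
      obtain ⟨a, ha⟩ := (hf.2.1.2 y hy).exists
      exact ⟨⟨y, hdom y hy⟩, ⟨a, (app_mem_transSet InnerModel.trans hfN ha).2⟩, ha, h⟩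
  have hRu : ∀ x, ∃! v, R x v := by
    intro x
    by_cases h : ∃ y ∈ SpaceX k, Spread B w G y ∧ Agree u x y
    · obtain ⟨y, hy, hys, hxy⟩ := h
      obtain ⟨v, hv⟩ := (hf.2.1.2 y hy).exists
      refine ⟨v, Or.inl ⟨y, hy, hys, hxy, hv⟩, ?_⟩
      rintro v₁ (⟨y₁, hy₁, hys₁, hxy₁, hv₁⟩ | ⟨h, _⟩)
      · exact hf.2.1.unique hv₁ ((hdep y hy y₁ hy₁ hys hys₁ (hxy.symm.trans hxy₁) v).1 hv)
      · exact absurd ⟨y, hy, hys, hxy⟩ h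
    · refine ⟨v₀, Or.inr ⟨h, rfl⟩, ?_⟩
      rintro v₁ (⟨y₁, hy₁, hys₁, hxy₁, _⟩ | ⟨_, h'⟩)
      · exact absurd ⟨y₁, hy₁, hys₁, hxy₁⟩ h
      · exact h'
  have hRA : ∀ x v, R x v → v ∈ₘ A := by
    rintro x v (⟨y, _, _, _, h⟩ | ⟨_, rfl⟩)
    · exact hf.2.1.cod h
    · exact hf.2.1.cod hv₀
  have hRN : ∀ x v, R x v → v ∈ₘ N := by
    rintro x v (⟨y, _, _, _, h⟩ | ⟨_, rfl⟩)
    · exact (app_mem_transSet InnerModel.trans hfN h).2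
    · exact hqN.2
  obtain ⟨g, hgN, hg, hg'⟩ := exists_modified (N := N) (c' := els A)
    (fun x _ v => (∃ y, Spread B' w' G' y ∧ Agree u' x y ∧ App f' y v) ∨
      ((¬ ∃ y a, App f' y a ∧ Spread B' w' G' y ∧ Agree u' x y) ∧ v = v')) hfN hf.2.1
    (by
      intro x _ _
      obtain ⟨v, hv, hv'⟩ := hRu x.1
      exact ⟨⟨v, hRN _ v hv⟩, (hR _ _).2 hv, fun v₁ h => Subtype.ext (hv' _ ((hR _ _).1 h))⟩)
    (fun x _ v _ h => hRA _ _ ((hR _ _).1 h))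
  have hgR : ∀ x ∈ SpaceX k, ∀ v, App g x v ↔ R x v := by
    intro x hx v
    obtain ⟨a, ha⟩ := (hf.2.1.2 x hx).exists
    have haN := (app_mem_transSet InnerModel.trans hfN ha).2
    constructor
    · intro h
      have hvN := (app_mem_transSet InnerModel.trans hgN h).2
      exact (hR ⟨x, hdom x hx⟩ ⟨v, hvN⟩).1 ((hg' ⟨x, hdom x hx⟩ ⟨a, haN⟩ ⟨v, hvN⟩ ha).1 h)
    · intro h
      have hvN := hRN x v h
      exact (hg' ⟨x, hdom x hx⟩ ⟨a, haN⟩ ⟨v, hvN⟩ ha).2 ((hR ⟨x, hdom x hx⟩ ⟨v, hvN⟩).2 h)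
  have hgu : IsFunSupport k g u := by
    refine ⟨hu, fun i hi => hb.int i (huw i hi), fun x hx y hy hxy v => ?_⟩
    -- The relation `R` refers to `x` only through agreement on `u`, so equal restrictions give
    -- equal values.
    replace hxy : Agree u x y := hxy
    have h : ∀ z, Agree u x z ↔ Agree u y z := fun z => ⟨hxy.symm.trans, hxy.trans⟩
    rw [hgR x hx, hgR y hy]
    simp only [R, h]
  have hgF : g ∈ FunClass k sX A := ⟨inLInf_iff.2 ⟨N, hN, hgN⟩, hg, u, hgu⟩
  refine ⟨g, hgF, (hC.equivalent_iff hk hf hgF).2 ⟨w, B, G, hb, fun x hx hxs v => ?_⟩, hgu⟩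
  rw [hgR x hx]
  refine ⟨fun h => Or.inl ⟨x, hx, hxs, fun _ _ _ => Iff.rfl, h⟩, ?_⟩
  rintro (⟨y, hy, hys, hxy, h⟩ | ⟨h, _⟩)
  · exact (hdep x hx y hy hxs hys hxy v).2 h
  · exact absurd ⟨x, hx, hxs, fun _ _ _ => Iff.rfl⟩ h

/-- `s` supports the class of `f`. -/
def SupportsClass (k sB sX A f s : M) : Prop :=
  ∃ g, g ∈ FunClass k sX A ∧ Equivalent k sB sX f g ∧ IsFunSupport k g s

/-- Equivalence of functions is first-order over `M`, whereas classes are subsets of `M`. Phrased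
through functions, being a support can enter separation and finite induction in `M`. -/
instance DP.supportsClass {n : ℕ} (a b c d e : M) (t : (Fin n → M) → M) [Tm t] :
    DP (fun v => SupportsClass a b c d e (t v)) :=
  DP.subst₁ (P := fun s => SupportsClass a b c d e s)
    (by unfold SupportsClass; infer_instance) t

theorem SupportsClass.cap (hC : IsOmegaConstruction k A₀ sA sB sX) (hk : IsInaccessible k)
    {f s t : M} (hf : f ∈ FunClass k sX A) (hs : FinConvex s) (ht : FinConvex t)
    (hfs : SupportsClass k sB sX A f s) (hft : SupportsClass k sB sX A f t) :
    SupportsClass k sB sX A f (cap s t) := by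
  obtain ⟨g₁, hg₁, hfg₁, hgs⟩ := hfs
  obtain ⟨g₂, hg₂, hfg₂, hgt⟩ := hft
  obtain ⟨w₀, B, G, hb₀, heq₀⟩ := (hC.equivalent_iff hk hg₁ hg₂).1
    (hC.equivalent_trans hk hg₁ hf hg₂ (hC.equivalent_symm hk hf hg₁ hfg₁) hfg₂)
  obtain ⟨hb, hsub⟩ := hb₀.enlarge hk (hs.1.cup ht.1) (fun i hi => by
    rcases eps_cup.1 hi with hi | hi
    · exact hs.2.1 i hi
    · exact ht.2.1 i hi)
  have hsw : Sub s (cup w₀ (cup s t)) := fun i hi => by simp [hi]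
  have htw : Sub t (cup w₀ (cup s t)) := fun i hi => by simp [hi]
  obtain ⟨g, hg, hg₁g, hgu⟩ := exists_funSupport hC hk hg₁ hb (hs.cap ht).1
    (fun i hi => hsw i (eps_cap.1 hi).1) fun x hx y hy hxs hys hxy =>
      depends_on_cap hC hk hs ht hgs hgt hb hsw htw
        (fun x hx hxs => heq₀ x hx (hsub x hx hxs)) hx hy hxs hys hxy
  exact ⟨g, hg, hC.equivalent_trans hk hf hg₁ hg hfg₁ hg₁g, hgu⟩

/-- The class of a function has a minimum convex support. -/
theorem exists_minimum_support (hC : IsOmegaConstruction k A₀ sA sB sX) (hk : IsInaccessible k)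
    {f : M} (hf : f ∈ FunClass k sX A) : ∃ s₀, FinConvex s₀ ∧ SupportsClass k sB sX A f s₀ ∧
      ∀ s, FinConvex s → SupportsClass k sB sX A f s → Sub s₀ s := by
  obtain ⟨r, hr⟩ := hf.2.2
  obtain ⟨s, hrs, hs⟩ := exists_finConvex hr.1 hr.2.1
  have hfs : SupportsClass k sB sX A f s := ⟨f, hf, hC.equivalent_refl hk hf, hs.1, hs.2.1,
    fun x hx y hy hxy => hr.2.2 x hx y hy fun i hi => hxy i (hrs i hi)⟩
  -- `c` collects the points of `s` that some block support misses. Induction over `c` intersects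
  -- these supports one at a time, leaving a block support disjoint from `c`; any further omission
  -- would put a point of it into `c`.
  obtain ⟨c, hc⟩ := separation
    (fun i => ∃ t, FinConvex t ∧ SupportsClass k sB sX A f t ∧ ¬ i ∈ₘ t) s
  have hcs : IsFin c := hs.1.subset fun i hi => ((hc i).1 hi).1
  obtain ⟨t, hts, ht, hft, htc⟩ := fin_induction (fun c => ∃ t, Sub t s ∧ FinConvex t ∧
      SupportsClass k sB sX A f t ∧ ∀ i, i ∈ₘ c → ¬ i ∈ₘ t) hcs
    ⟨s, fun _ h => h, hs, hfs, fun i hi => absurd hi (not_eps_zero i)⟩ (by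
      rintro d i _ hi ⟨t, hts, ht, hft, htd⟩
      obtain ⟨_, t', ht', hft', hit'⟩ := (hc i).1 hi
      refine ⟨cap t t', fun j hj => hts j (eps_cap.1 hj).1, ht.cap ht', hft.cap hC hk hf ht ht' hft',
        fun j hj hjt => ?_⟩
      obtain ⟨h1, h2⟩ := eps_cap.1 hjt
      rcases eps_adjoin.1 hj with hj | rfl
      · exact htd j hj h1
      · exact hit' h2)
  refine ⟨t, ht, hft, fun t' ht' hft' i hi => ?_⟩
  by_contra hit'
  exact htc i ((hc i).2 ⟨hts i hi, t', ht', hft', hit'⟩) hi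

/-- Equality of classes amounts to equivalence of representatives, which returns the question to
functions in `M`. -/
theorem isBlockSupport_iff (hC : IsOmegaConstruction k A₀ sA sB sX) (hk : IsInaccessible k)
    {f s : M} (hf : f ∈ FunClass k sX A) :
    IsBlockSupport k sB sX A (eqClass k sB sX A f) s ↔
      FinConvex s ∧ SupportsClass k sB sX A f s := by
  rw [IsBlockSupport, isBlock_iff]
  refine and_congr_right fun _ => exists_congr fun g => and_congr_right fun hg => ?_
  rw [hC.eqClass_eq_iff hk hf hg]

end MinimumSupport

end IntUltrapower

open IntUltrapower in
theorem mainTheorem5 {M : Type u} [setLang.Structure M]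
    (hM : IsModelZFCMinus M) (hL : VEqL M)
    (k : M) (hwc : IsWeaklyCompact k) (hlargest : IsLargestCardinal k)
    (A₀ sA sB sX : M) (hC : IsOmegaConstruction k A₀ sA sB sX)
    (A : M) (hA : InLInf sX A)
    (x : Set M) (hx : x ∈ Ultrapower k sB sX A) :
    ∃ s₀, IsBlockSupport k sB sX A x s₀ ∧
      ∀ s, IsBlockSupport k sB sX A x s → Sub s₀ s := by
  have : ModelZFCMinus M := ⟨hM⟩
  obtain ⟨f, hf, rfl⟩ := hx
  obtain ⟨s₀, h₁, h₂, h₃⟩ := exists_minimum_support hC hwc.1 hf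
  refine ⟨s₀, (isBlockSupport_iff hC hwc.1 hf).2 ⟨h₁, h₂⟩, fun s hs => ?_⟩
  obtain ⟨h₄, h₅⟩ := (isBlockSupport_iff hC hwc.1 hf).1 hs
  exact h₃ s h₄ h₅
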